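/- Let $k\ge 2$, $n\ge 1$. For $\tau\in\otimes^k\mathbb R^n$ and $\eta\in\otimes^{k-1}\mathbb R^n$ let $\tau[\eta]\in\mathbb R^n$ be the vector with entries $\tau[\eta](i)=\sum_{i_1,\dots,i_{k-1}}\tau_{i i_1\cdots i_{k-1}}\eta_{i_1\cdots i_{k-1}}$, and for $w\in\mathbb R^n$ let $\tau[w^{\otimes k}]=\langle\tau,w^{\otimes k}\rangle$ (entrywise inner product). Let $X=\beta v^{\otimes k}+Z\in\otimes^k\mathbb R^n$, where $\beta\in\mathbb R$, $v\in\mathbb R^n$ is a unit vector, and the $n^k$ entries of $Z$ are i.i.d. $N(0,1/n)$. Fix a (deterministic) unit vector $u\in\mathbb R^n$ and let $$u_0=u,\qquad u_{t+1}=\frac{X[u_t^{\otimes(k-1)}]}{\|X[u_t^{\otimes(k-1)}]\|}.$$ There is a universal constant $c>0$ such that for all $k\ge2$, $\varepsilon>0$, $c_0>0$ there are $C>0$ and $n_0$, depending only on $k,\varepsilon,c_0$, for which the following holds for all $n\ge n_0$ and all $\beta,v,u$ as above satisfying $$|\langle u,v\rangle|\ge c_0/\sqrt n,\qquad |\beta\langle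 u,v\rangle^{k-2}|\ge n^{\varepsilon}.$$ Say that an event holds with high probability if its probability is at least $1-Cn^{-c\log n}$, put $T_0=1+\frac1\varepsilon\Big(\frac12+\frac{2\log|\beta|}{\log n}\Big)$, and define the target $(\beta_*,v_*(t))$ by 1. $(\beta,\,v)$ if $k$ is odd and $\beta>0$; 2. $(-\beta,\,-v)$ if $k$ is odd and $\beta<0$; 3. $(\beta,\,\mathrm{sgn}(\langle u,v\rangle)\,v)$ if $k$ is even and $\beta>0$; 4. $(\beta,\,(-1)^t\,\mathrm{sgn}(\langle u,v\rangle)\,v)$ if $k$ is even and $\beta<0$. (a) (Convergence, respectively alternation.) With high probability, simultaneously for all integers $t\ge T_0$, $$\big|X[u_t^{\otimes k}]-\beta_*\big|\le C\Big(\frac{\log n}{\sqrt n}+\frac1{|\beta|}\Big),\qquad \|u_t-v_*(t)\|\le\frac{C}{|\beta|}.$$ Moreover, if $k$ is even and $\beta<0$, then with high probability the sequence $(X[u_t^{\otimes k}],u_t)_{t\ge0}$ does not converge. (b) (Expansions.) For every fixed unit vector $a\in\mathbb R^n$ and every integer $T\ge T_0$, with high probability the estimators $\hat v=u_T$ and $\hat\beta=X[u_T^{\otimes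 k}]$ satisfy, with $v_*=v_*(T)$ and $\xi_*=Z[v_*^{\otimes(k-1)}]$, $$\Big|\langle a,\hat v\rangle-\Big(1-\frac1{2\beta_*^2}\Big)\langle a,v_*\rangle-\frac{\langle a,\xi_*\rangle-\langle a,v_*\rangle\langle v_*,\xi_*\rangle}{\beta_*}\Big|\le C\Big(\frac{\log n}{\beta^2\sqrt n}+\frac{(\log n)^{3/2}}{|\beta|^{3/2}n^{3/4}}+\frac{|\langle a,v\rangle|}{\beta^4}\Big),$$ $$\Big|\hat\beta-\beta_*-\langle\xi_*,v_*\rangle+\frac{k/2-1}{\beta_*}\Big|\le C\Big(\frac{\log n}{|\beta|\sqrt n}+\frac{(\log n)^{3/2}}{|\beta|^{1/2}n^{3/4}}+\frac1{|\beta|^3}\Big).$$ (c) The entries of $\xi=Z[v^{\otimes(k-1)}]$ are i.i.d. $N(0,1/n)$. -/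

import Mathlib

open Real Filter Topology MeasureTheory ProbabilityTheory

noncomputable section

/-- `k`-th order tensors over `ℝ^n`, identified with their arrays of `n^k` entries. -/
abbrev Tensor (n k : ℕ) : Type := (Fin k → Fin n) → ℝ

/-- The entrywise inner product of two tensors. -/
def tensorInner {n k : ℕ} (τ η : Tensor n k) : ℝ := ∑ I, τ I * η I

/-- The rank one tensor `v^{⊗k}`. -/
def tensorPow {n : ℕ} (v : EuclideanSpace ℝ (Fin n)) (k : ℕ) : Tensor n k :=
  fun I => ∏ j, v (I j)

/-- The multi-index `(i, i₁, …, i_{k-1})` obtained by putting `i` in front of `J = (i₁, …, i_{k-1})`. -/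
def consIndex {n k : ℕ} (i : Fin n) (J : Fin (k - 1) → Fin n) : Fin k → Fin n :=
  fun j => if h : (j : ℕ) = 0 then i else J ⟨(j : ℕ) - 1, by omega⟩

/-- The action `τ[η] ∈ ℝ^n` of a `k`-th order tensor `τ` (`k ≥ 1`) on a `(k-1)`-th order tensor `η`:
`τ[η](i) = ∑ τ_{i i₁ … i_{k-1}} η_{i₁ … i_{k-1}}`. -/
def tensorAct {n k : ℕ} (τ : Tensor n k) (η : Tensor n (k - 1)) : EuclideanSpace ℝ (Fin n) :=
  WithLp.toLp 2 fun i => ∑ J : Fin (k - 1) → Fin n, τ (consIndex i J) * η J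

/-- The scalar `τ[v^{⊗k}] = ⟨τ, v^{⊗k}⟩`. -/
def tensorEval {n k : ℕ} (τ : Tensor n k) (v : EuclideanSpace ℝ (Fin n)) : ℝ :=
  tensorInner τ (tensorPow v k)

/-- The rank one spiked tensor `X = β v^{⊗k} + Z`. -/
def spikedTensor {n k : ℕ} (β : ℝ) (v : EuclideanSpace ℝ (Fin n)) (Z : Tensor n k) : Tensor n k :=
  β • tensorPow v k + Z

/-- Tensor power iteration:
`u₀ = u`, `u_{t+1} = X[u_t^{⊗(k-1)}] / ‖X[u_t^{⊗(k-1)}]‖`. -/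
def powerIter {n k : ℕ} (X : Tensor n k) (u : EuclideanSpace ℝ (Fin n)) :
    ℕ → EuclideanSpace ℝ (Fin n)
  | 0 => u
  | t + 1 =>
      ‖tensorAct X (tensorPow (powerIter X u t) (k - 1))‖⁻¹ •
        tensorAct X (tensorPow (powerIter X u t) (k - 1))

/-- The family `Y` consists of independent `N(0, 1/n)` random variables. -/
def IsIIDGaussian {Ω ι : Type*} [MeasurableSpace Ω] (n : ℕ) (P : Measure Ω) (Y : ι → Ω → ℝ) :
    Prop :=
  (∀ i, HasLaw (Y i) (gaussianReal 0 ((n : NNReal)⁻¹)) P) ∧ iIndepFun Y P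

/-- The event `E` holds with probability at least `1 - C n^{-c log n}`
(stated through the outer measure of the complement). -/
def HoldsWHP {Ω : Type*} [MeasurableSpace Ω] (P : Measure Ω) (c C : ℝ) (n : ℕ) (E : Ω → Prop) :
    Prop :=
  P {ω | ¬ E ω} ≤ ENNReal.ofReal (C * (n : ℝ) ^ (-(c * log n)))

/-- The number of iterations `1 + (1/ε) (1/2 + 2 log|β| / log n)`. -/
def iterThreshold (n : ℕ) (ε β : ℝ) : ℝ := 1 + 1 / ε * (1 / 2 + 2 * log |β| / log n)

/-- The pair `(X[w^{⊗k}], w)` is close to `(b, z)`. In the regime `|β| ≥ n^ε` both error bounds tend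
to `0` as `n → ∞`. -/
def CloseTo {n k : ℕ} (C β : ℝ) (X : Tensor n k) (w : EuclideanSpace ℝ (Fin n))
    (b : ℝ) (z : EuclideanSpace ℝ (Fin n)) : Prop :=
  |tensorEval X w - b| ≤ C * (log n / √n + 1 / |β|) ∧ ‖w - z‖ ≤ C / |β|

/-- First order expansion of `⟨a, w⟩` around `(b, z)`, with `ξ = Z[z^{⊗(k-1)}]`. -/
def VectorExpansion {n k : ℕ} (C : ℝ) (Z : Tensor n k) (a w : EuclideanSpace ℝ (Fin n))
    (b : ℝ) (z : EuclideanSpace ℝ (Fin n)) : Prop :=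
  |inner ℝ a w -
      ((1 - 1 / (2 * b ^ 2)) * inner ℝ a z +
        (inner ℝ a (tensorAct Z (tensorPow z (k - 1))) -
          inner ℝ a z * inner ℝ z (tensorAct Z (tensorPow z (k - 1)))) / b)| ≤
    C * (log n / (b ^ 2 * √n) +
      (log n) ^ (3 / 2 : ℝ) / (|b| ^ (3 / 2 : ℝ) * (n : ℝ) ^ (3 / 4 : ℝ)) +
      |inner ℝ a z| / b ^ 4)

/-- First order expansion of the estimated signal size `bhat` around `(b, z)`,
with `ξ = Z[z^{⊗(k-1)}]`. -/
def SizeExpansion {n k : ℕ} (C : ℝ) (Z : Tensor n k) (bhat : ℝ)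
    (b : ℝ) (z : EuclideanSpace ℝ (Fin n)) : Prop :=
  |bhat - (b + inner ℝ (tensorAct Z (tensorPow z (k - 1))) z - ((k : ℝ) / 2 - 1) / b)| ≤
    C * (log n / (|b| * √n) +
      (log n) ^ (3 / 2 : ℝ) / (|b| ^ (1 / 2 : ℝ) * (n : ℝ) ^ (3 / 4 : ℝ)) +
      1 / |b| ^ 3)

/-- With high probability, `(X[u_t^{⊗k}], u_t)` is close to `(b, z t)` simultaneously for all times
`t` past the threshold. A constant `z` means convergence to `(b, z)`. -/
def IterApproaches {Ω : Type*} [MeasurableSpace Ω] {n k : ℕ} (P : Measure Ω) (c C ε β : ℝ)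
    (X : Ω → Tensor n k) (u : EuclideanSpace ℝ (Fin n))
    (b : ℝ) (z : ℕ → EuclideanSpace ℝ (Fin n)) : Prop :=
  HoldsWHP P c C n fun ω => ∀ t : ℕ, iterThreshold n ε β ≤ t →
    CloseTo C β (X ω) (powerIter (X ω) u t) b (z t)

/-- For every fixed unit vector `a` and every time `T` past the threshold, with high probability
the estimators `u_T` and `X[u_T^{⊗k}]` satisfy the expansions around `(b, z T)`. -/
def IterExpansions {Ω : Type*} [MeasurableSpace Ω] {n k : ℕ} (P : Measure Ω) (c C ε β : ℝ)
    (X Z : Ω → Tensor n k) (u : EuclideanSpace ℝ (Fin n))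
    (b : ℝ) (z : ℕ → EuclideanSpace ℝ (Fin n)) : Prop :=
  ∀ a : EuclideanSpace ℝ (Fin n), ‖a‖ = 1 → ∀ T : ℕ, iterThreshold n ε β ≤ T →
    HoldsWHP P c C n fun ω =>
      VectorExpansion C (Z ω) a (powerIter (X ω) u T) b (z T) ∧
      SizeExpansion C (Z ω) (tensorEval (X ω) (powerIter (X ω) u T)) b (z T)

end

/-! The obstacle is that the iterates depend on `Z`, so `Z[u_t^{⊗(k-1)}]` is not Gaussian. The
remedy is to read `Z` as an `n × n^{k-1}` Gaussian matrix which power iteration only sees through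
its products with the vectors `u_t^{⊗(k-1)}`. Orthogonalize these queries, starting from
`v^{⊗(k-1)}`. A product with a direction orthogonal to everything asked before is a fresh Gaussian
vector, independent of the past (`Exploration.lintegral_run`). Hence, with `ξ = Z[v^{⊗(k-1)}]` and
`L = log n / √n`, the noise at `u_t` equals `⟨v,u_t⟩^{k-1} ξ` plus a remainder. In the directions
`v`, `a` and `ξ`, the remainder is at most `L` times a constant times the norm of the direction
times the distance of `u_t^{⊗(k-1)}` from the line through `v^{⊗(k-1)}`. This holds for a fixed
number `N` of steps (`IsIIDGaussian.measure_inner_noise_le`). A net argument also bounds the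
injective norm of `Z` by a constant `K`, so `w ↦ Z[w^{⊗(k-1)}]` is bounded and Lipschitz on balls.
These facts form `RegularNoise`; everything after it is deterministic.

Signs are absorbed by comparing `u_t` with `z_t = σ_t v`, where `σ_{t+1} = sgn(β) σ_t^{k-1}`, which
turns `β` into `B = |β|`. As long as the overlap with `z_t` is small, each step multiplies it by at
least a constant times `n^ε`, so about `1/(2ε)` steps lift it from order `n^{-1/2}` to `1/2`
(`SignedDynamics.growth`). From then on the signal dominates and `‖u_t - z_t‖ = O(1/B)`. This makes
the remainder smaller by another factor `1/B`, and expanding the normalization of `B z + ξ + ρ`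
gives the expansions (`RegularDynamics.expansions`).

This covers only times below `N`. For later times, an aligned step contracts distances by a factor
`O(1/B)` and the targets have period two, so `u_{t+2j}` and `u_t` become closer than the error terms
and late iterates inherit the expansions of early ones (`RegularDynamics.late_expansions`). A single
event of high probability thus controls all times. -/

/-! ### Linear functions of i.i.d. Gaussian entries. -/

namespace IsIIDGaussian

variable {Ω ι : Type*} [MeasurableSpace Ω] {n : ℕ} {P : Measure Ω}
  {Y : ι → Ω → ℝ}

theorem hasGaussianLaw_eval (h : IsIIDGaussian n P Y) (i : ι) : HasGaussianLaw (Y i) P :=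
  (h.1 i).hasGaussianLaw

theorem integral_eval (h : IsIIDGaussian n P Y) (i : ι) : ∫ ω, Y i ω ∂P = 0 := by
  rw [(h.1 i).integral_eq, integral_id_gaussianReal]

theorem precomp {κ : Type*} (h : IsIIDGaussian n P Y) {f : κ → ι} (hf : Function.Injective f) :
    IsIIDGaussian n P (fun j => Y (f j)) :=
  ⟨fun j => h.1 (f j), h.2.precomp hf⟩

theorem hasGaussianLaw [Finite ι] (h : IsIIDGaussian n P Y) :
    HasGaussianLaw (fun ω i => Y i ω) P :=
  iIndepFun.hasGaussianLaw h.hasGaussianLaw_eval h.2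

theorem covariance_eval [DecidableEq ι] (h : IsIIDGaussian n P Y) (i j : ι) :
    cov[Y i, Y j; P] = if i = j then (n : ℝ)⁻¹ else 0 := by
  split_ifs with hij
  · subst hij
    rw [covariance_self (h.1 i).aemeasurable, (h.1 i).variance_eq, variance_id_gaussianReal]
    simp
  · exact (h.2.indepFun hij).covariance_eq_zero (h.hasGaussianLaw_eval i).memLp_two
      (h.hasGaussianLaw_eval j).memLp_two

theorem hasGaussianLaw_linear [Fintype ι] (h : IsIIDGaussian n P Y) {κ : Type*} [Fintype κ]
    (c : κ → ι → ℝ) : HasGaussianLaw (fun ω k => ∑ i, c k i * Y i ω) P := by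
  let T : (ι → ℝ) →L[ℝ] (κ → ℝ) :=
    ContinuousLinearMap.pi fun k => ∑ i, c k i • ContinuousLinearMap.proj i
  have := h.hasGaussianLaw.map_fun T
  simpa [T] using this

variable [IsProbabilityMeasure P]

theorem covariance_linear [Fintype ι] (h : IsIIDGaussian n P Y) (c d : ι → ℝ) :
    cov[fun ω => ∑ i, c i * Y i ω, fun ω => ∑ i, d i * Y i ω; P] =
      (∑ i, c i * d i) * (n : ℝ)⁻¹ := by
  classical
  rw [covariance_fun_sum_fun_sum (fun i => (h.hasGaussianLaw_eval i).memLp_two.const_mul _)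
    (fun i => (h.hasGaussianLaw_eval i).memLp_two.const_mul _)]
  simp_rw [covariance_const_mul_left, covariance_const_mul_right, h.covariance_eval]
  simp [Finset.sum_mul, mul_assoc]

theorem hasLaw_linear [Fintype ι] (h : IsIIDGaussian n P Y) (c : ι → ℝ) :
    HasLaw (fun ω => ∑ i, c i * Y i ω)
      (gaussianReal 0 ((∑ i, c i ^ 2) * (n : ℝ)⁻¹).toNNReal) P := by
  have h1 : HasGaussianLaw (fun ω => ∑ i, c i * Y i ω) P :=
    (h.hasGaussianLaw_linear (fun _ : Unit => c)).eval ()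
  refine ⟨h1.aemeasurable, ?_⟩
  rw [h1.map_eq_gaussianReal, ← covariance_self h1.aemeasurable, h.covariance_linear,
    integral_finsetSum _ fun i _ => ((h.hasGaussianLaw_eval i).integrable.const_mul _)]
  simp_rw [integral_const_mul, h.integral_eval]
  simp [sq]

/-- The combination is a centred Gaussian of variance at most `A / n`, hence sub-Gaussian;
Chernoff's bound is applied to `c` and to `-c`. Working with an upper bound `A > 0` admits
degenerate coefficients. -/
theorem measure_lt_abs_linear_le [Fintype ι] (h : IsIIDGaussian n P Y) (hn : 0 < n) (c : ι → ℝ)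
    {A r : ℝ} (hA : 0 < A) (hc : ∑ i, c i ^ 2 ≤ A) (hr : 0 ≤ r) :
    P {ω | r < |∑ i, c i * Y i ω|} ≤ ENNReal.ofReal (2 * exp (-(n * r ^ 2 / (2 * A)))) := by
  have hn' : (0 : ℝ) < n := by exact_mod_cast hn
  have key : ∀ c : ι → ℝ, ∑ i, c i ^ 2 ≤ A →
      P.real {ω | r ≤ ∑ i, c i * Y i ω} ≤ exp (-(n * r ^ 2 / (2 * A))) := by
    intro c hc
    have hm : HasSubgaussianMGF (fun ω => ∑ i, c i * Y i ω) (A * (n : ℝ)⁻¹).toNNReal P := by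
      have hl := h.hasLaw_linear c
      have h1 : HasGaussianLaw (fun ω => ∑ i, c i * Y i ω) P :=
        (h.hasGaussianLaw_linear (fun _ : Unit => c)).eval ()
      refine ⟨fun t => ?_, fun t => ?_⟩
      · have hi := integrable_exp_mul_gaussianReal (μ := 0)
          (v := ((∑ i, c i ^ 2) * (n : ℝ)⁻¹).toNNReal) t
        rw [← hl.map_eq] at hi
        exact (integrable_map_measure (by fun_prop) hl.aemeasurable).1 hi
      · rw [mgf_gaussianReal hl.map_eq]
        rw [Real.coe_toNNReal _ (by positivity), Real.coe_toNNReal _ (by positivity)]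
        simp only [zero_mul, zero_add]
        gcongr
    refine (hm.measure_ge_le hr).trans_eq ?_
    rw [Real.coe_toNNReal _ (by positivity)]
    congr 1
    field_simp
  have hsub : {ω | r < |∑ i, c i * Y i ω|} ⊆
      {ω | r ≤ ∑ i, c i * Y i ω} ∪ {ω | r ≤ ∑ i, (-c i) * Y i ω} := by
    intro ω hω
    simp only [Set.mem_ofPred_eq, Set.mem_union, neg_mul, Finset.sum_neg_distrib] at hω ⊢
    exact (lt_abs.1 hω).imp le_of_lt le_of_lt
  refine (measure_mono hsub).trans ?_
  rw [← ofReal_measureReal]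
  refine ENNReal.ofReal_le_ofReal ((measureReal_union_le _ _).trans ?_)
  have := key c hc
  have := key (fun i => -c i) (by simpa using hc)
  linarith

/-- Distinct rows use disjoint entries, so the coefficient vectors are orthonormal; jointly Gaussian
variables that are uncorrelated are independent. -/
theorem rows [Fintype ι] {κ : Type*} [Fintype κ] {Y : κ × ι → Ω → ℝ} (h : IsIIDGaussian n P Y)
    {c : ι → ℝ} (hc : ∑ j, c j ^ 2 = 1) :
    IsIIDGaussian n P (fun i ω => ∑ j, c j * Y (i, j) ω) := by
  classical
  let C : κ → κ × ι → ℝ := fun i p => if p.1 = i then c p.2 else 0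
  have hC : ∀ i ω, ∑ p, C i p * Y p ω = ∑ j, c j * Y (i, j) ω := by
    intro i ω
    rw [Fintype.sum_prod_type]
    simp [C, ite_mul]
  have hCC : ∀ i j, ∑ p, C i p * C j p = if i = j then 1 else 0 := by
    intro i j
    rw [Fintype.sum_prod_type]
    simp only [C, ite_mul, zero_mul, mul_ite, mul_zero]
    by_cases hij : i = j
    · subst hij
      simp [← hc, sq]
    · have : ∀ x, x = i → ¬ x = j := by rintro x rfl; exact hij
      simp only [hij, if_false]
      refine Finset.sum_eq_zero fun x _ => Finset.sum_eq_zero fun y _ => ?_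
      split_ifs <;> simp_all
  refine ⟨fun i => ?_, ?_⟩
  · have := h.hasLaw_linear (C i)
    simp_rw [hC, sq, hCC] at this
    have h0 : ((n : ℝ)⁻¹).toNNReal = (n : NNReal)⁻¹ := by
      rw [Real.toNNReal_inv]; simp
    simpa [h0] using this
  · have hg := h.hasGaussianLaw_linear C
    simp_rw [hC] at hg
    refine hg.iIndepFun_of_covariance_eq_zero fun i j hij => ?_
    have := h.covariance_linear (C i) (C j)
    simp_rw [hC] at this
    rw [this, hCC]
    simp [hij]

theorem pi [Fintype ι] : IsIIDGaussian n
    (Measure.pi fun _ : ι => gaussianReal 0 (n : NNReal)⁻¹) (fun i M => M i) :=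
  ⟨fun i => (measurePreserving_eval (fun _ : ι => gaussianReal 0 (n : NNReal)⁻¹) i).hasLaw, iIndepFun_pi (X := fun _ x => x) fun _ => by fun_prop⟩

theorem map_eq [Fintype ι] (h : IsIIDGaussian n P Y) :
    P.map (fun ω i => Y i ω) = Measure.pi fun _ : ι => gaussianReal 0 (n : NNReal)⁻¹ := by
  rw [(iIndepFun_iff_map_fun_eq_pi_map fun i => (h.1 i).aemeasurable).1 h.2]
  congr
  ext1 i
  exact (h.1 i).map_eq

/-- Transfers bounds from the canonical product space to `P`. The inequality needs no measurability
of `s`, which spares measurability proofs for the events below. -/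
theorem measure_le [Fintype ι] (h : IsIIDGaussian n P Y) (s : Set (ι → ℝ)) :
    P {ω | (fun i => Y i ω) ∈ s} ≤
      (Measure.pi fun _ : ι => gaussianReal 0 (n : NNReal)⁻¹) s := by
  rw [← h.map_eq]
  exact Measure.le_map_apply (aemeasurable_pi_iff.2 fun i => (h.1 i).aemeasurable) s

end IsIIDGaussian

/-! ### Exponential moments of squares and concentration of the squared norm. -/

theorem integrable_exp_mul_sq_gaussianReal {v : NNReal} (hv : v ≠ 0) {t : ℝ} (ht : 2 * t * v < 1) :
    Integrable (fun x : ℝ => exp (t * x ^ 2)) (gaussianReal 0 v) := by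
  have hv' : (0 : ℝ) < v := by positivity
  rw [gaussianReal_of_var_ne_zero _ hv, integrable_withDensity_iff_integrable_smul₀'
    (by fun_prop) (by simp [gaussianPDF])]
  have hb : 0 < 1 / (2 * (v : ℝ)) - t := by
    rw [sub_pos, lt_div_iff₀ (by positivity)]; linarith
  refine ((integrable_exp_neg_mul_sq hb).const_mul (√(2 * π * v))⁻¹).congr (ae_of_all _ fun x => ?_)
  simp only [gaussianPDF, gaussianPDFReal, smul_eq_mul]
  rw [ENNReal.toReal_ofReal (by positivity), mul_assoc (√(2 * π * v))⁻¹, ← exp_add]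
  congr 2
  field_simp
  ring

theorem integral_exp_mul_sq_gaussianReal {v : NNReal} (hv : v ≠ 0) {t : ℝ} (ht : 2 * t * v < 1) :
    ∫ x : ℝ, exp (t * x ^ 2) ∂(gaussianReal 0 v) = (√(1 - 2 * t * v))⁻¹ := by
  have hv' : (0 : ℝ) < v := by positivity
  rw [integral_gaussianReal_eq_integral_smul hv]
  have : ∀ x : ℝ, gaussianPDFReal 0 v x • exp (t * x ^ 2) =
      (√(2 * π * v))⁻¹ * exp (-(1 / (2 * (v : ℝ)) - t) * x ^ 2) := by
    intro x
    simp only [gaussianPDFReal, smul_eq_mul]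
    rw [mul_assoc, ← exp_add]
    congr 2
    field_simp
    ring
  simp_rw [this]
  rw [integral_const_mul, integral_gaussian, ← sqrt_inv, ← sqrt_inv, ← sqrt_mul (by positivity)]
  congr 1
  have h1 : (1 : ℝ) - 2 * t * v ≠ 0 := by linarith
  have h2 : 1 / (2 * (v : ℝ)) - t = (1 - 2 * t * v) / (2 * v) := by field_simp
  rw [h2]
  field_simp

theorem inv_sqrt_one_sub_le {s : ℝ} (hs : |s| ≤ 1 / 4) :
    (√(1 - 2 * s))⁻¹ ≤ exp (s + 4 * s ^ 2) := by
  have hs' := abs_le.1 hs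
  have h2s : |2 * s| ≤ 1 / 2 := by rw [abs_mul, abs_two]; linarith
  -- First-order Taylor expansion of `log (1 - 2s)`: the remainder is at most `8 s²`, and the square
  -- root halves it to `4 s²`.
  have h := Real.abs_log_sub_add_sum_range_le (x := 2 * s) (by linarith) 1
  simp only [Finset.sum_range_one, zero_add, pow_one, Nat.cast_zero, div_one] at h
  have h3 : |2 * s| ^ (1 + 1) / (1 - |2 * s|) ≤ 8 * s ^ 2 := by
    rw [div_le_iff₀ (by linarith), sq_abs]
    nlinarith [sq_nonneg s]
  have h4 := (abs_le.1 (h.trans h3)).1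
  have hpos : 0 < 1 - 2 * s := by linarith
  rw [← exp_log (inv_pos.2 (sqrt_pos.2 hpos)), log_inv, log_sqrt hpos.le]
  exact exp_le_exp.2 (by linarith)

namespace IsIIDGaussian

variable {Ω : Type*} [MeasurableSpace Ω] {n : ℕ} {P : Measure Ω} [IsProbabilityMeasure P]
  {Y : Fin n → Ω → ℝ}

theorem mgf_sum_sq_le (h : IsIIDGaussian n P Y) (hn : 0 < n) {t : ℝ} (ht : |t| ≤ n / 4) :
    Integrable (fun ω => exp (t * ∑ i, Y i ω ^ 2)) P ∧
      mgf (fun ω => ∑ i, Y i ω ^ 2) P t ≤ exp (t + 4 * t ^ 2 / n) := by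
  have hn' : (0 : ℝ) < n := by exact_mod_cast hn
  have hv : (n : NNReal)⁻¹ ≠ 0 := by positivity
  have hs : |t / n| ≤ 1 / 4 := by
    rw [abs_div, abs_of_pos hn', div_le_iff₀ hn']; linarith
  have ht' : 2 * t * ((n : NNReal)⁻¹ : NNReal) < 1 := by
    have := (abs_le.1 hs).2
    push_cast
    rw [← div_eq_mul_inv, mul_div_assoc]
    linarith
  have hI := h.2.comp (fun _ x => x ^ 2) (fun _ => by fun_prop)
  have hmeas : ∀ i, AEMeasurable (fun ω => Y i ω ^ 2) P := fun i => (h.1 i).aemeasurable.pow_const 2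
  have hint : ∀ i, Integrable (fun ω => exp (t * Y i ω ^ 2)) P := by
    intro i
    have := integrable_exp_mul_sq_gaussianReal hv ht'
    rw [← (h.1 i).map_eq] at this
    exact (integrable_map_measure (by fun_prop) (h.1 i).aemeasurable).1 this
  have hsum : (fun ω => ∑ i, Y i ω ^ 2) = ∑ i, fun ω => Y i ω ^ 2 := by ext; simp
  constructor
  -- If the exponential were not integrable, its Bochner integral would be `0`, whereas the product
  -- formula for independent summands makes it positive.
  · by_contra hni
    have h0 : mgf (fun ω => ∑ i, Y i ω ^ 2) P t = 0 := integral_undef hni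
    have h1 := iIndepFun.mgf_sum₀ (t := t) hI hmeas Finset.univ
    have h2 : 0 < ∏ i, mgf (fun ω => Y i ω ^ 2) P t :=
      Finset.prod_pos fun i _ => mgf_pos (hint i)
    rw [hsum] at h0
    exact h2.ne' (h1.symm.trans h0)
  · rw [hsum]
    have := iIndepFun.mgf_sum₀ (t := t) hI hmeas Finset.univ
    refine (this.trans_le ?_)
    have h1 : ∀ i, mgf (fun ω => Y i ω ^ 2) P t ≤ exp (t / n + 4 * (t / n) ^ 2) := by
      intro i
      have h2 : mgf (fun ω => Y i ω ^ 2) P t = (√(1 - 2 * (t / n)))⁻¹ := by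
        have := integral_exp_mul_sq_gaussianReal hv ht'
        rw [← (h.1 i).map_eq, integral_map (h.1 i).aemeasurable (by fun_prop)] at this
        rw [mgf, this]
        push_cast
        rw [← div_eq_mul_inv, mul_div_assoc]
      rw [h2]
      exact inv_sqrt_one_sub_le hs
    refine (Finset.prod_le_prod (fun i _ => mgf_nonneg) fun i _ => h1 i).trans_eq ?_
    rw [Finset.prod_const, ← exp_nat_mul]
    congr 1
    simp only [Finset.card_univ, Fintype.card_fin]
    field_simp

theorem measure_lt_abs_sum_sq_sub_one_le (h : IsIIDGaussian n P Y) (hn : 0 < n) {r : ℝ}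
    (hr : 0 ≤ r) (hr' : r ≤ 2) :
    P {ω | r < |∑ i, Y i ω ^ 2 - 1|} ≤ ENNReal.ofReal (2 * exp (-(n * r ^ 2 / 16))) := by
  have hn' : (0 : ℝ) < n := by exact_mod_cast hn
  have hsub : {ω | r < |∑ i, Y i ω ^ 2 - 1|} ⊆
      {ω | 1 + r ≤ ∑ i, Y i ω ^ 2} ∪ {ω | ∑ i, Y i ω ^ 2 ≤ 1 - r} := by
    intro ω hω
    simp only [Set.mem_ofPred_eq, Set.mem_union] at hω ⊢
    rcases lt_abs.1 hω with h1 | h1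
    · left; linarith
    · right; linarith
  refine (measure_mono hsub).trans ?_
  rw [← ofReal_measureReal]
  refine ENNReal.ofReal_le_ofReal ((measureReal_union_le _ _).trans ?_)
  -- The Chernoff parameter `t = n r / 8` minimizes `-t r + 4 t² / n`; the assumption `r ≤ 2` keeps
  -- it in the range `|t| ≤ n / 4`.
  have hpos : 0 ≤ n * r / 8 := by positivity
  have hle : n * r / 8 ≤ n / 4 := by nlinarith
  obtain ⟨i1, m1⟩ := h.mgf_sum_sq_le hn (t := n * r / 8) (by rwa [abs_of_nonneg hpos])
  obtain ⟨i2, m2⟩ := h.mgf_sum_sq_le hn (t := -(n * r / 8)) (by rwa [abs_neg, abs_of_nonneg hpos])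
  have b1 := (measure_ge_le_exp_mul_mgf (1 + r) hpos i1).trans
    (mul_le_mul_of_nonneg_left m1 (exp_pos _).le)
  have b2 := (measure_le_le_exp_mul_mgf (1 - r) (neg_nonpos.2 hpos) i2).trans
    (mul_le_mul_of_nonneg_left m2 (exp_pos _).le)
  rw [← exp_add] at b1 b2
  have e1 : -(n * r / 8) * (1 + r) + (n * r / 8 + 4 * (n * r / 8) ^ 2 / n) = -(n * r ^ 2 / 16) := by
    field_simp; ring
  have e2 : -(-(n * r / 8)) * (1 - r) + (-(n * r / 8) + 4 * (-(n * r / 8)) ^ 2 / n) =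
      -(n * r ^ 2 / 16) := by
    field_simp; ring
  rw [e1] at b1
  rw [e2] at b2
  linarith

end IsIIDGaussian

/-! ### Gaussian arrays: orthogonal directions carry independent information. -/

namespace IsIIDGaussian

variable {Ω ι : Type*} [MeasurableSpace Ω] {n : ℕ} {P : Measure Ω} [IsProbabilityMeasure P]
  {Y : ι → Ω → ℝ}

theorem indepFun_linear [Fintype ι] (h : IsIIDGaussian n P Y) {κ κ' : Type*} [Fintype κ]
    [Fintype κ'] {c : κ → ι → ℝ} {d : κ' → ι → ℝ} (hcd : ∀ a b, ∑ i, c a i * d b i = 0) :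
    IndepFun (fun ω a => ∑ i, c a i * Y i ω) (fun ω b => ∑ i, d b i * Y i ω) P := by
  let T : (ι → ℝ) →L[ℝ] (κ → ℝ) × (κ' → ℝ) :=
    (ContinuousLinearMap.pi fun k => ∑ i, c k i • ContinuousLinearMap.proj i).prod
      (ContinuousLinearMap.pi fun k => ∑ i, d k i • ContinuousLinearMap.proj i)
  have hT := h.hasGaussianLaw.map_fun T
  refine HasGaussianLaw.indepFun_of_covariance_eval (by simpa [T] using hT) fun a b => ?_
  rw [h.covariance_linear, hcd, zero_mul]

end IsIIDGaussian

/-- The product measure under which all entries are independent `N(0, 1/n)` variables. -/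
noncomputable abbrev gaussianPi (n : ℕ) (ι : Type*) [Fintype ι] : Measure (ι → ℝ) :=
  Measure.pi fun _ : ι => gaussianReal 0 (n : NNReal)⁻¹

section Matrix

variable {n : ℕ} {J : Type*} [Fintype J]

/-- The action of an array indexed by `Fin n × J` on a vector indexed by `J`. -/
noncomputable def matAct (M : Fin n × J → ℝ) (x : EuclideanSpace ℝ J) : EuclideanSpace ℝ (Fin n) :=
  WithLp.toLp 2 fun i => ∑ j, M (i, j) * x j

/-- The rank one array `c ⊗ e`. -/
def rankOne (c : EuclideanSpace ℝ (Fin n)) (e : EuclideanSpace ℝ J) : Fin n × J → ℝ :=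
  fun p => c p.1 * e p.2

theorem matAct_apply (M : Fin n × J → ℝ) (x : EuclideanSpace ℝ J) (i : Fin n) :
    matAct M x i = ∑ j, M (i, j) * x j := rfl

theorem matAct_add (M : Fin n × J → ℝ) (x y : EuclideanSpace ℝ J) :
    matAct M (x + y) = matAct M x + matAct M y := by
  ext i; simp [matAct_apply, mul_add, Finset.sum_add_distrib]

theorem matAct_smul (M : Fin n × J → ℝ) (c : ℝ) (x : EuclideanSpace ℝ J) :
    matAct M (c • x) = c • matAct M x := by
  ext i; simp [matAct_apply, Finset.mul_sum, mul_left_comm]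

theorem matAct_zero (M : Fin n × J → ℝ) : matAct M (0 : EuclideanSpace ℝ J) = 0 := by
  ext i; simp [matAct_apply]

theorem matAct_sum (M : Fin n × J → ℝ) {κ : Type*} (s : Finset κ) (x : κ → EuclideanSpace ℝ J) :
    matAct M (∑ i ∈ s, x i) = ∑ i ∈ s, matAct M (x i) := by
  classical
  induction s using Finset.induction_on with
  | empty => simp [matAct_zero]
  | insert a s ha ih => rw [Finset.sum_insert ha, Finset.sum_insert ha, matAct_add, ih]

/-- Queries orthogonal to `f` do not notice the change `c ⊗ f`. Invariance under such changes is how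
"does not depend on the answer along `f`" is expressed below. -/
theorem matAct_add_rankOne (M : Fin n × J → ℝ) (c : EuclideanSpace ℝ (Fin n))
    (f x : EuclideanSpace ℝ J) :
    matAct (M + rankOne c f) x = matAct M x + (inner ℝ f x : ℝ) • c := by
  ext i
  simp only [matAct_apply, Pi.add_apply, rankOne, add_mul, Finset.sum_add_distrib, PiLp.add_apply,
    PiLp.smul_apply, smul_eq_mul, PiLp.inner_apply, RCLike.inner_apply, conj_trivial,
    Finset.sum_mul]
  congr 1
  exact Finset.sum_congr rfl fun j _ => by ring

theorem measurable_matAct :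
    Measurable fun p : (Fin n × J → ℝ) × EuclideanSpace ℝ J => matAct p.1 p.2 := by
  unfold matAct
  fun_prop

theorem sum_sq_mul_sq (d : EuclideanSpace ℝ (Fin n)) (e : EuclideanSpace ℝ J) :
    ∑ p : Fin n × J, (d p.1 * e p.2) ^ 2 = ‖d‖ ^ 2 * ‖e‖ ^ 2 := by
  rw [EuclideanSpace.real_norm_sq_eq, EuclideanSpace.real_norm_sq_eq, Fintype.sum_prod_type,
    Finset.sum_mul_sum]
  simp_rw [mul_pow]

theorem inner_matAct (M : Fin n × J → ℝ) (d : EuclideanSpace ℝ (Fin n)) (e : EuclideanSpace ℝ J) :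
    inner ℝ d (matAct M e) = ∑ p : Fin n × J, (d p.1 * e p.2) * M p := by
  rw [Fintype.sum_prod_type]
  simp only [PiLp.inner_apply, RCLike.inner_apply, conj_trivial, matAct_apply, Finset.sum_mul]
  exact Finset.sum_congr rfl fun i _ => Finset.sum_congr rfl fun j _ => by ring

theorem gaussianPi_lt_abs_inner_matAct_le (hn : 0 < n) (d : EuclideanSpace ℝ (Fin n))
    {e : EuclideanSpace ℝ J} (he : ‖e‖ ≤ 1) {r : ℝ} (hr : 0 ≤ r) :
    gaussianPi n (Fin n × J) {M | r * ‖d‖ < |inner ℝ d (matAct M e)|} ≤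
      ENNReal.ofReal (2 * exp (-(n * r ^ 2 / 2))) := by
  by_cases hd : d = 0
  · simp [hd]
  have hd' : 0 < ‖d‖ := norm_pos_iff.2 hd
  have := IsIIDGaussian.pi.measure_lt_abs_linear_le (n := n) (ι := Fin n × J) hn
    (fun p => d p.1 * e p.2) (A := ‖d‖ ^ 2) (r := r * ‖d‖) (by positivity)
    (by rw [sum_sq_mul_sq]
        exact mul_le_of_le_one_right (by positivity) (pow_le_one₀ (norm_nonneg _) he))
    (by positivity)
  simp_rw [← inner_matAct] at this
  refine this.trans_eq ?_
  congr 4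
  field_simp

/-- Both maps are linear in the entries, and their coefficient vectors are orthogonal because the
second one projects each row onto the complement of the unit vector `e`. -/
theorem indepFun_matAct_sub_rankOne {e : EuclideanSpace ℝ J} (he : ‖e‖ = 1) :
    IndepFun (fun M => matAct M e) (fun M => M - rankOne (matAct M e) e)
      (gaussianPi n (Fin n × J)) := by
  classical
  let c : Fin n → Fin n × J → ℝ := fun i q => if q.1 = i then e q.2 else 0
  let d : Fin n × J → Fin n × J → ℝ := fun p q =>
    (if q = p then 1 else 0) - (if q.1 = p.1 then e q.2 * e p.2 else 0)
  have he2 : ∑ j, e j * e j = 1 := by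
    have := EuclideanSpace.real_norm_sq_eq e
    rw [he] at this
    simpa [sq] using this.symm
  have hcd : ∀ a b, ∑ q, c a q * d b q = 0 := by
    rintro a ⟨b1, b2⟩
    simp only [c, d, Fintype.sum_prod_type, ite_mul, zero_mul]
    rw [Finset.sum_eq_single a (fun x _ hx => by simp [hx]) (by simp)]
    simp only [if_true, mul_sub, Finset.sum_sub_distrib, Prod.mk.injEq]
    by_cases hab : a = b1
    · subst hab
      simp [← mul_assoc, ← Finset.sum_mul, he2]
    · simp [hab]
  have h := (IsIIDGaussian.pi (n := n) (ι := Fin n × J)).indepFun_linear hcd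
  have h' := h.comp (φ := fun f => (WithLp.toLp 2 f : EuclideanSpace ℝ (Fin n))) (ψ := id)
    (by fun_prop) measurable_id
  have e1 : ((fun f => (WithLp.toLp 2 f : EuclideanSpace ℝ (Fin n))) ∘
      fun (M : Fin n × J → ℝ) a => ∑ q, c a q * M q) = fun M => matAct M e := by
    ext M i
    simp only [Function.comp_apply, c, Fintype.sum_prod_type, matAct_apply, ite_mul, zero_mul]
    rw [Finset.sum_eq_single i (fun x _ hx => by simp [hx]) (by simp)]
    simp [mul_comm]
  have e2 : (id ∘ fun (M : Fin n × J → ℝ) b => ∑ q, d b q * M q) =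
      fun M => M - rankOne (matAct M e) e := by
    ext M p
    simp only [Function.comp_apply, id, d, sub_mul, Finset.sum_sub_distrib, ite_mul, one_mul,
      zero_mul, Finset.sum_ite_eq', Finset.mem_univ, if_true, Pi.sub_apply, rankOne, matAct_apply]
    congr 1
    rw [Fintype.sum_prod_type, Finset.sum_eq_single p.1 (fun x _ hx => by simp [hx]) (by simp)]
    simp only [if_true, Finset.sum_mul]
    exact Finset.sum_congr rfl fun j _ => by ring
  rwa [e1, e2] at h'

/-- The invariance makes `φ` see its second argument only through the part projected off `e`, which
is independent of the answer along `e`; so the array there may be replaced by an independent copy.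
For `e = 0` the answer is constant and nothing has to be shown. -/
theorem lintegral_matAct_eq {e : EuclideanSpace ℝ J} (he : ‖e‖ = 1 ∨ e = 0)
    {φ : EuclideanSpace ℝ (Fin n) × (Fin n × J → ℝ) → ENNReal} (hφ : Measurable φ)
    (hinv : ∀ r M c, φ (r, M + rankOne c e) = φ (r, M)) :
    ∫⁻ M, φ (matAct M e, M) ∂gaussianPi n (Fin n × J) =
      ∫⁻ M, ∫⁻ M', φ (matAct M e, M') ∂gaussianPi n (Fin n × J) ∂gaussianPi n (Fin n × J) := by
  rcases he with he | rfl
  · have hinv' : ∀ r M, φ (r, M) = φ (r, M - rankOne (matAct M e) e) := by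
      intro r M
      rw [← hinv r (M - rankOne (matAct M e) e) (matAct M e), sub_add_cancel]
    have hm1 : Measurable fun M : Fin n × J → ℝ => matAct M e :=
      measurable_matAct.comp (measurable_id.prodMk measurable_const)
    have hm2 : Measurable fun M : Fin n × J → ℝ => M - rankOne (matAct M e) e := by
      unfold rankOne matAct
      fun_prop
    have hI := (indepFun_iff_map_prod_eq_prod_map_map hm1.aemeasurable hm2.aemeasurable).1
      (indepFun_matAct_sub_rankOne (n := n) he)
    calc ∫⁻ M, φ (matAct M e, M) ∂gaussianPi n (Fin n × J)
        = ∫⁻ M, φ (matAct M e, M - rankOne (matAct M e) e) ∂gaussianPi n (Fin n × J) :=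
          lintegral_congr fun M => hinv' _ _
      _ = ∫⁻ p, φ p ∂(gaussianPi n (Fin n × J)).map
            (fun M => (matAct M e, M - rankOne (matAct M e) e)) :=
          (lintegral_map hφ (hm1.prodMk hm2)).symm
      _ = ∫⁻ M, ∫⁻ M', φ (matAct M e, M' - rankOne (matAct M' e) e)
            ∂gaussianPi n (Fin n × J) ∂gaussianPi n (Fin n × J) := by
          rw [hI, lintegral_prod _ hφ.aemeasurable, lintegral_map (hφ.lintegral_prod_right') hm1]
          refine lintegral_congr fun M => ?_
          rw [lintegral_map (by fun_prop) hm2]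
      _ = _ := by simp_rw [← hinv']
  · simp [matAct_zero]

end Matrix

/-! ### Adaptive exploration of a Gaussian array. -/

/-- A sequential exploration of an array: in state `s` at time `t` the direction `dir t s` is
queried, and the answer leads to the next state. The queried directions are unit vectors or zero,
and each one is orthogonal to the directions known before. -/
structure Exploration (n : ℕ) (J S : Type*) [Fintype J] [MeasurableSpace S] where
  init : S
  dir : ℕ → S → EuclideanSpace ℝ J
  step : ℕ → S → EuclideanSpace ℝ (Fin n) → S
  good : ℕ → S → Prop
  known : ℕ → S → Set (EuclideanSpace ℝ J)
  measurable_dir : ∀ t, Measurable (dir t)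
  measurable_step : ∀ t, Measurable fun p : S × EuclideanSpace ℝ (Fin n) => step t p.1 p.2
  good_init : good 0 init
  good_step : ∀ t s r, good t s → good (t + 1) (step t s r)
  norm_dir : ∀ t s, good t s → ‖dir t s‖ = 1 ∨ dir t s = 0
  inner_dir : ∀ t s, good t s → ∀ f ∈ known t s, inner ℝ f (dir t s) = 0
  known_step : ∀ t s r, good t s → known t s ⊆ known (t + 1) (step t s r)
  dir_mem : ∀ t s r, good t s → dir t s ∈ known (t + 1) (step t s r)

namespace Exploration

variable {n : ℕ} {J S : Type*} [Fintype J] [MeasurableSpace S] (A : Exploration n J S)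

/-- The state of the exploration of the array `M` at time `t`. -/
noncomputable def run (M : Fin n × J → ℝ) : ℕ → S
  | 0 => A.init
  | t + 1 => A.step t (run M t) (matAct M (A.dir t (run M t)))

theorem good_run (M : Fin n × J → ℝ) (t : ℕ) : A.good t (A.run M t) := by
  induction t with
  | zero => exact A.good_init
  | succ t ih => exact A.good_step t _ _ ih

theorem measurable_run (t : ℕ) : Measurable fun M => A.run M t := by
  induction t with
  | zero => exact measurable_const
  | succ t ih =>
    exact (A.measurable_step t).comp (ih.prodMk
      (measurable_matAct.comp (measurable_id.prodMk ((A.measurable_dir t).comp ih))))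

/-- This is the conditioning principle, stated without conditional expectations: towards functionals
blind to the known directions, the array behaves as an independent copy given the current state. -/
theorem lintegral_run (t : ℕ) {h : S × (Fin n × J → ℝ) → ENNReal} (hh : Measurable h)
    (hinv : ∀ s, A.good t s → ∀ f ∈ A.known t s, ∀ M c, h (s, M + rankOne c f) = h (s, M)) :
    ∫⁻ M, h (A.run M t, M) ∂gaussianPi n (Fin n × J) =
      ∫⁻ M, ∫⁻ M', h (A.run M t, M') ∂gaussianPi n (Fin n × J) ∂gaussianPi n (Fin n × J) := by
  induction t generalizing h with
  | zero => simp [run]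
  | succ t ih =>
    have hm : Measurable fun p : S × (Fin n × J → ℝ) =>
        A.step t p.1 (matAct p.2 (A.dir t p.1)) :=
      (A.measurable_step t).comp (measurable_fst.prodMk
        (measurable_matAct.comp (measurable_snd.prodMk ((A.measurable_dir t).comp measurable_fst))))
    have key : ∀ s, A.good t s → ∀ f ∈ A.known t s, ∀ (M : Fin n × J → ℝ) c,
        matAct (M + rankOne c f) (A.dir t s) = matAct M (A.dir t s) := by
      intro s hs f hf M c
      rw [matAct_add_rankOne, A.inner_dir t s hs f hf, zero_smul, add_zero]
    -- The induction hypothesis is used on both sides of the goal. `h1` frees the state at time `t`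
    -- from the array on the left, `h2` does so on the right; with the state frozen, what remains is
    -- the statement for a single query.
    have h1 := ih (h := fun p => h (A.step t p.1 (matAct p.2 (A.dir t p.1)), p.2))
      (hh.comp (hm.prodMk measurable_snd)) (by
        intro s hs f hf M c
        simp only [key s hs f hf]
        exact hinv _ (A.good_step t s _ hs) f (A.known_step t s _ hs hf) M c)
    have h2 := ih (h := fun p => ∫⁻ M', h (A.step t p.1 (matAct p.2 (A.dir t p.1)), M')
        ∂gaussianPi n (Fin n × J))
      ((hh.lintegral_prod_right').comp hm) (by
        intro s hs f hf M c
        simp only [key s hs f hf])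
    simp only [run]
    rw [h1, h2]
    refine lintegral_congr fun M => ?_
    have hg := A.good_run M t
    exact lintegral_matAct_eq (A.norm_dir t _ hg)
      (φ := fun p => h (A.step t (A.run M t) p.1, p.2))
      (hh.comp (((A.measurable_step t).comp (measurable_const.prodMk measurable_fst)).prodMk
        measurable_snd))
      (fun r M' c => hinv _ (A.good_step t _ r hg) _ (A.dir_mem t _ r hg) M' c)

/-- The test vector is a function of the state and the queried direction is orthogonal to the known
ones. After decoupling, both are fixed and the tail of a single Gaussian variable applies. -/
theorem gaussianPi_lt_abs_inner_le (hn : 0 < n) (t : ℕ) {d : S → EuclideanSpace ℝ (Fin n)}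
    (hd : Measurable d) {r : ℝ} (hr : 0 ≤ r) :
    gaussianPi n (Fin n × J) {M | r * ‖d (A.run M t)‖ <
      |inner ℝ (d (A.run M t)) (matAct M (A.dir t (A.run M t)))|} ≤
      ENNReal.ofReal (2 * exp (-(n * r ^ 2 / 2))) := by
  let B : Set (S × (Fin n × J → ℝ)) :=
    {p | r * ‖d p.1‖ < |inner ℝ (d p.1) (matAct p.2 (A.dir t p.1))|}
  have hB : MeasurableSet B := by
    have h1 : Measurable fun p : S × (Fin n × J → ℝ) => matAct p.2 (A.dir t p.1) :=
      measurable_matAct.comp (measurable_snd.prodMk ((A.measurable_dir t).comp measurable_fst))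
    have h2 : Measurable fun p : S × (Fin n × J → ℝ) => d p.1 := hd.comp measurable_fst
    exact measurableSet_lt (by fun_prop) (by
      have := h2.inner (𝕜 := ℝ) h1
      fun_prop)
  have hrun := A.measurable_run t
  have h1 := A.lintegral_run t (h := B.indicator 1) (measurable_one.indicator hB) (by
    intro s hs f hf M c
    have : (s, M + rankOne c f) ∈ B ↔ (s, M) ∈ B := by
      simp only [B, Set.mem_ofPred_eq, matAct_add_rankOne, A.inner_dir t s hs f hf, zero_smul,
        add_zero]
    simp only [Set.indicator, this, Pi.one_apply])
  have h2 : gaussianPi n (Fin n × J) {M | r * ‖d (A.run M t)‖ <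
      |inner ℝ (d (A.run M t)) (matAct M (A.dir t (A.run M t)))|} =
      ∫⁻ M, B.indicator 1 (A.run M t, M) ∂gaussianPi n (Fin n × J) := by
    exact (lintegral_indicator_one ((hrun.prodMk measurable_id) hB)).symm
  rw [h2, h1]
  have h3 : ∀ M, ∫⁻ M', B.indicator 1 (A.run M t, M') ∂gaussianPi n (Fin n × J) ≤
      ENNReal.ofReal (2 * exp (-(n * r ^ 2 / 2))) := by
    intro M
    have he : ‖A.dir t (A.run M t)‖ ≤ 1 := by
      rcases A.norm_dir t _ (A.good_run M t) with h | h <;> simp [h]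
    refine le_trans (le_of_eq ?_) (gaussianPi_lt_abs_inner_matAct_le hn (d (A.run M t)) he hr)
    exact lintegral_indicator_one (measurable_prodMk_left (x := A.run M t) hB)
  calc _ ≤ ∫⁻ _, ENNReal.ofReal (2 * exp (-(n * r ^ 2 / 2))) ∂gaussianPi n (Fin n × J) :=
        lintegral_mono h3
    _ = _ := by simp

end Exploration

/-! ### Reduction of arbitrary adaptive queries to orthogonal ones. -/

/-- An algorithm which at time `t` with memory `w` queries an array at the vector `query t w`, and
updates its memory with the answer. -/
structure QueryAlgorithm (n : ℕ) (J W : Type*) [Fintype J] [MeasurableSpace W] where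
  init : W
  query : ℕ → W → EuclideanSpace ℝ J
  update : ℕ → W → EuclideanSpace ℝ (Fin n) → W
  measurable_query : ∀ t, Measurable (query t)
  measurable_update : ∀ t, Measurable fun p : W × EuclideanSpace ℝ (Fin n) => update t p.1 p.2

namespace QueryAlgorithm

variable {n : ℕ} {J W : Type*} [Fintype J] [MeasurableSpace W] (A : QueryAlgorithm n J W)

/-- The memory of the algorithm at time `t`, when it is run on the array `M`. -/
noncomputable def memory (M : Fin n × J → ℝ) : ℕ → W
  | 0 => A.init
  | t + 1 => A.update t (memory M t) (matAct M (A.query t (memory M t)))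

/-- Directions explored so far, the answers, and the memory of the algorithm. -/
abbrev State (n : ℕ) (J W : Type*) :=
  (ℕ → EuclideanSpace ℝ J) × (ℕ → EuclideanSpace ℝ (Fin n)) × W

/-- The part of the query that is orthogonal to the explored directions. -/
noncomputable def residual (t : ℕ) (s : State n J W) : EuclideanSpace ℝ J :=
  A.query t s.2.2 - ∑ j ∈ Finset.range t, (inner ℝ (s.1 j) (A.query t s.2.2) : ℝ) • s.1 j

/-- The normalized residual. -/
noncomputable def newDir (t : ℕ) (s : State n J W) : EuclideanSpace ℝ J :=
  ‖A.residual t s‖⁻¹ • A.residual t s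

/-- The answer to the query, computed from the answers along the explored directions. -/
noncomputable def answer (t : ℕ) (s : State n J W) (r : EuclideanSpace ℝ (Fin n)) :
    EuclideanSpace ℝ (Fin n) :=
  ∑ j ∈ Finset.range t, (inner ℝ (s.1 j) (A.query t s.2.2) : ℝ) • s.2.1 j +
    (inner ℝ (A.newDir t s) (A.query t s.2.2) : ℝ) • r

/-- The explored directions form an orthonormal family, up to zero vectors. -/
def GoodState (t : ℕ) (s : State n J W) : Prop :=
  (∀ i < t, ∀ j < t, i ≠ j → inner ℝ (s.1 i) (s.1 j) = (0 : ℝ)) ∧ ∀ i < t, ‖s.1 i‖ = 1 ∨ s.1 i = 0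

theorem inner_residual {t : ℕ} {s : State n J W} (hs : GoodState t s) {i : ℕ} (hi : i < t) :
    inner ℝ (s.1 i) (A.residual t s) = (0 : ℝ) := by
  rw [residual, inner_sub_right, inner_sum, Finset.sum_eq_single i]
  · rw [inner_smul_right, real_inner_self_eq_norm_sq]
    rcases hs.2 i hi with h | h <;> simp [h]
  · intro j hj hji
    rw [inner_smul_right, hs.1 i hi j (Finset.mem_range.1 hj) hji.symm, mul_zero]
  · intro h
    exact absurd (Finset.mem_range.2 hi) h

theorem inner_newDir {t : ℕ} {s : State n J W} (hs : GoodState t s) {i : ℕ} (hi : i < t) :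
    inner ℝ (s.1 i) (A.newDir t s) = (0 : ℝ) := by
  rw [newDir, inner_smul_right, A.inner_residual hs hi, mul_zero]

theorem norm_newDir (t : ℕ) (s : State n J W) : ‖A.newDir t s‖ = 1 ∨ A.newDir t s = 0 := by
  by_cases h : A.residual t s = 0
  · right; simp [newDir, h]
  · left; simp [newDir, norm_smul, h]

/-- Gram–Schmidt: the coefficient of the new direction is the norm of the residual. If the residual
vanishes, the convention `‖0‖⁻¹ = 0` makes the new direction zero and the identity persists. -/
theorem query_eq {t : ℕ} {s : State n J W} (hs : GoodState t s) :
    A.query t s.2.2 = ∑ j ∈ Finset.range t, (inner ℝ (s.1 j) (A.query t s.2.2) : ℝ) • s.1 j +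
      (inner ℝ (A.newDir t s) (A.query t s.2.2) : ℝ) • A.newDir t s := by
  have h1 : inner ℝ (A.residual t s) (A.query t s.2.2) = ‖A.residual t s‖ ^ 2 := by
    have h2 : A.query t s.2.2 = A.residual t s +
        ∑ j ∈ Finset.range t, (inner ℝ (s.1 j) (A.query t s.2.2) : ℝ) • s.1 j := by
      rw [residual]; abel
    rw [h2, inner_add_right, inner_sum, real_inner_self_eq_norm_sq, Finset.sum_eq_zero, add_zero]
    intro j hj
    rw [inner_smul_right, real_inner_comm (s.1 j), A.inner_residual hs (Finset.mem_range.1 hj), mul_zero]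
  have h3 : (inner ℝ (A.newDir t s) (A.query t s.2.2) : ℝ) • A.newDir t s = A.residual t s := by
    rw [newDir, real_inner_smul_left, h1, smul_smul]
    by_cases h : A.residual t s = 0
    · simp [h]
    · have : ‖A.residual t s‖ ≠ 0 := norm_ne_zero_iff.2 h
      rw [show ‖A.residual t s‖⁻¹ * ‖A.residual t s‖ ^ 2 * ‖A.residual t s‖⁻¹ = 1 by field_simp,
        one_smul]
  rw [h3, residual]
  abel

theorem measurable_query_memory (t : ℕ) : Measurable fun s : State n J W => A.query t s.2.2 :=
  (A.measurable_query t).comp (measurable_snd.comp measurable_snd)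

theorem measurable_state_fst (j : ℕ) : Measurable fun s : State n J W => s.1 j :=
  (measurable_pi_apply j).comp measurable_fst

theorem measurable_state_snd (j : ℕ) : Measurable fun s : State n J W => s.2.1 j :=
  (measurable_pi_apply j).comp (measurable_fst.comp measurable_snd)

theorem measurable_residual (t : ℕ) : Measurable fun s : State n J W => A.residual t s := by
  have h1 := A.measurable_query_memory t
  unfold residual
  refine h1.sub (Finset.measurable_sum _ fun j _ => ?_)
  have h2 := measurable_state_fst (n := n) (J := J) (W := W) j
  exact (h2.inner (𝕜 := ℝ) h1).smul h2

theorem measurable_newDir (t : ℕ) : Measurable fun s : State n J W => A.newDir t s := by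
  unfold newDir
  exact (A.measurable_residual t).norm.inv.smul (A.measurable_residual t)

theorem measurable_answer (t : ℕ) :
    Measurable fun p : State n J W × EuclideanSpace ℝ (Fin n) => A.answer t p.1 p.2 := by
  have h1 := A.measurable_query_memory t
  have h3 := A.measurable_newDir t
  unfold answer
  refine Measurable.add ?_ (((h3.inner (𝕜 := ℝ) h1).comp measurable_fst).smul measurable_snd)
  refine Measurable.comp (g := fun s : State n J W => ∑ j ∈ Finset.range t,
    (inner ℝ (s.1 j) (A.query t s.2.2) : ℝ) • s.2.1 j) ?_ measurable_fst
  refine Finset.measurable_sum _ fun j _ => ?_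
  have h2 := measurable_state_fst (n := n) (J := J) (W := W) j
  exact (h2.inner (𝕜 := ℝ) h1).smul (measurable_state_snd j)

/-- The exploration of the array performed by the algorithm, with orthogonalized queries. -/
noncomputable def exploration : Exploration n J (State n J W) where
  init := (0, 0, A.init)
  dir := A.newDir
  step t s r := (Function.update s.1 t (A.newDir t s), Function.update s.2.1 t r,
    A.update t s.2.2 (A.answer t s r))
  good := GoodState
  known t s := {f | ∃ j < t, s.1 j = f}
  measurable_dir := A.measurable_newDir
  measurable_step t := by
    have h1 := A.measurable_newDir t
    have h2 := A.measurable_answer t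
    refine Measurable.prodMk ?_ (Measurable.prodMk ?_ ?_)
    · exact (measurable_update' (a := t) (X := fun _ : ℕ => EuclideanSpace ℝ J)).comp
        ((measurable_fst.comp measurable_fst).prodMk (h1.comp measurable_fst))
    · exact (measurable_update' (a := t) (X := fun _ : ℕ => EuclideanSpace ℝ (Fin n))).comp
        ((measurable_fst.comp (measurable_snd.comp measurable_fst)).prodMk measurable_snd)
    · exact (A.measurable_update t).comp
        ((measurable_snd.comp (measurable_snd.comp measurable_fst)).prodMk h2)
  good_init := ⟨fun i hi => absurd hi (Nat.not_lt_zero i), fun i hi => absurd hi (Nat.not_lt_zero i)⟩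
  good_step t s r hs := by
    refine ⟨fun i hi j hj hij => ?_, fun i hi => ?_⟩
    · rcases Nat.lt_succ_iff_lt_or_eq.1 hi with hi | rfl <;>
        rcases Nat.lt_succ_iff_lt_or_eq.1 hj with hj | rfl
      · simpa [hi.ne, hj.ne] using hs.1 i hi j hj hij
      · simpa [hi.ne] using A.inner_newDir hs hi
      · rw [real_inner_comm]
        simpa [hj.ne] using A.inner_newDir hs hj
      · exact absurd rfl hij
    · rcases Nat.lt_succ_iff_lt_or_eq.1 hi with hi | rfl
      · simpa [hi.ne] using hs.2 i hi
      · simpa using A.norm_newDir i s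
  norm_dir t s _ := A.norm_newDir t s
  inner_dir := by
    rintro t s hs f ⟨j, hj, rfl⟩
    exact A.inner_newDir hs hj
  known_step := by
    rintro t s r - f ⟨j, hj, rfl⟩
    exact ⟨j, hj.trans t.lt_succ_self, by simp [hj.ne]⟩
  dir_mem t s r _ := ⟨t, t.lt_succ_self, by simp⟩

/-- The direction explored at time `t` when the algorithm is run on `M`. -/
noncomputable def direction (M : Fin n × J → ℝ) (t : ℕ) : EuclideanSpace ℝ J :=
  A.newDir t (A.exploration.run M t)

theorem run_fst (M : Fin n × J → ℝ) (t : ℕ) :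
    ∀ j < t, (A.exploration.run M t).1 j = A.direction M j := by
  induction t with
  | zero => exact fun j hj => absurd hj (Nat.not_lt_zero j)
  | succ t ih =>
    intro j hj
    rcases Nat.lt_succ_iff_lt_or_eq.1 hj with hj | rfl
    · simpa [Exploration.run, exploration, hj.ne] using ih j hj
    · simp [Exploration.run, exploration, direction]

theorem run_snd (M : Fin n × J → ℝ) (t : ℕ) :
    ∀ j < t, (A.exploration.run M t).2.1 j = matAct M (A.direction M j) := by
  induction t with
  | zero => exact fun j hj => absurd hj (Nat.not_lt_zero j)
  | succ t ih =>
    intro j hj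
    rcases Nat.lt_succ_iff_lt_or_eq.1 hj with hj | rfl
    · simpa [Exploration.run, exploration, hj.ne] using ih j hj
    · simp [Exploration.run, exploration, direction]

/-- The exploration never asks the original queries; by linearity it reconstructs their answers from
those along the orthogonalized directions, and so simulates the algorithm. -/
theorem run_memory (M : Fin n × J → ℝ) (t : ℕ) :
    (A.exploration.run M t).2.2 = A.memory M t := by
  induction t with
  | zero => rfl
  | succ t ih =>
    have h : A.answer t (A.exploration.run M t) (matAct M (A.direction M t)) =
        matAct M (A.query t (A.memory M t)) := by
      rw [← ih, A.query_eq (A.exploration.good_run M t), matAct_add, matAct_sum, answer, matAct_smul]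
      congr 1
      refine Finset.sum_congr rfl fun j hj => ?_
      rw [matAct_smul, A.run_snd M t j (Finset.mem_range.1 hj),
        A.run_fst M t j (Finset.mem_range.1 hj)]
    have h' : (A.exploration.run M (t + 1)).2.2 = A.update t (A.exploration.run M t).2.2
      (A.answer t (A.exploration.run M t) (matAct M (A.direction M t))) := rfl
    rw [h', h, ih, memory]

theorem query_memory_eq (M : Fin n × J → ℝ) (t : ℕ) :
    A.query t (A.memory M t) = ∑ j ∈ Finset.range (t + 1),
      (inner ℝ (A.direction M j) (A.query t (A.memory M t)) : ℝ) • A.direction M j := by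
  have h := A.query_eq (A.exploration.good_run M t)
  rw [A.run_memory] at h
  rw [Finset.sum_range_succ]
  refine h.trans ?_
  rw [← direction]
  congr 1
  exact Finset.sum_congr rfl fun j hj => by rw [A.run_fst M t j (Finset.mem_range.1 hj)]

theorem inner_direction (M : Fin n × J → ℝ) {i j : ℕ} (hij : i < j) :
    inner ℝ (A.direction M i) (A.direction M j) = (0 : ℝ) := by
  rw [← A.run_fst M j i hij]
  exact A.inner_newDir (A.exploration.good_run M j) hij

theorem norm_direction_le (M : Fin n × J → ℝ) (t : ℕ) : ‖A.direction M t‖ ≤ 1 := by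
  rcases A.norm_newDir t (A.exploration.run M t) with h | h <;> simp [direction, h]

theorem direction_zero (M : Fin n × J → ℝ) (h : ‖A.query 0 A.init‖ = 1) :
    A.direction M 0 = A.query 0 A.init := by
  simp [direction, newDir, residual, Exploration.run, exploration, h]

/-- Apart from its component along the first query, every query has a noise of the order of the
fluctuation of a single Gaussian variable. -/
theorem abs_inner_query_sub_le (M : Fin n × J → ℝ) (h : ‖A.query 0 A.init‖ = 1) {t : ℕ}
    {d : EuclideanSpace ℝ (Fin n)} {r : ℝ}
    (hr : ∀ j, 1 ≤ j → j ≤ t → |inner ℝ d (matAct M (A.direction M j))| ≤ r) :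
    |inner ℝ d (matAct M (A.query t (A.memory M t)) -
      (inner ℝ (A.query 0 A.init) (A.query t (A.memory M t)) : ℝ) • matAct M (A.query 0 A.init))| ≤
      t * (r * ‖A.query t (A.memory M t) -
        (inner ℝ (A.query 0 A.init) (A.query t (A.memory M t)) : ℝ) • A.query 0 A.init‖) := by
  set x := A.query t (A.memory M t) with hx
  set x₀ := A.query 0 A.init
  have h0 := A.direction_zero M h
  set y := x - (inner ℝ x₀ x : ℝ) • x₀ with hy
  -- Later directions are orthogonal to the first query, so their coefficients can be read off from
  -- the residual `y`. This gives `‖y‖` instead of `‖x‖` in the bound, which is small once the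
  -- iterates align with the signal.
  have hc : ∀ j, 1 ≤ j → inner ℝ (A.direction M j) x = (inner ℝ (A.direction M j) y : ℝ) := by
    intro j hj
    rw [hy, inner_sub_right, inner_smul_right, real_inner_comm x₀,
      show x₀ = A.direction M 0 from h0.symm, A.inner_direction M hj, mul_zero, sub_zero]
  have hxs := A.query_memory_eq M t
  rw [← hx, Finset.sum_range_succ', h0] at hxs
  have h1 : matAct M x - (inner ℝ x₀ x : ℝ) • matAct M x₀ = ∑ j ∈ Finset.range t,
      (inner ℝ (A.direction M (j + 1)) y : ℝ) • matAct M (A.direction M (j + 1)) := by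
    conv_lhs => rw [hxs]
    rw [matAct_add, matAct_smul, ← hxs, add_sub_cancel_right, matAct_sum]
    refine Finset.sum_congr rfl fun j _ => ?_
    rw [matAct_smul, hc (j + 1) (by omega)]
  rw [h1, inner_sum]
  refine (Finset.abs_sum_le_sum_abs _ _).trans ?_
  have h2 : ∀ j ∈ Finset.range t, |inner ℝ d ((inner ℝ (A.direction M (j + 1)) y : ℝ) •
      matAct M (A.direction M (j + 1)))| ≤ r * ‖y‖ := by
    intro j hj
    have hj' := Finset.mem_range.1 hj
    rw [inner_smul_right, abs_mul, mul_comm]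
    refine mul_le_mul (hr (j + 1) (by omega) (by omega)) ?_ (abs_nonneg _)
      ((abs_nonneg _).trans (hr (j + 1) (by omega) (by omega)))
    refine (abs_real_inner_le_norm _ _).trans ?_
    exact mul_le_of_le_one_left (norm_nonneg _) (A.norm_direction_le M _)
  refine (Finset.sum_le_sum h2).trans_eq ?_
  simp

/-- A union bound over the directions `1, …, N`. Direction `0` is excluded, as its contribution is
subtracted; therefore the test vector may depend on the answer to the first query, which is part of
the state at all times `t ≥ 1`. -/
theorem gaussianPi_abs_inner_query_sub_le (hn : 0 < n) (h : ‖A.query 0 A.init‖ = 1) (N : ℕ)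
    {D : (Fin n × J → ℝ) → EuclideanSpace ℝ (Fin n)} {d : State n J W → EuclideanSpace ℝ (Fin n)}
    (hd : Measurable d) (hdD : ∀ M t, 1 ≤ t → d (A.exploration.run M t) = D M)
    {r : ℝ} (hr : 0 ≤ r) :
    gaussianPi n (Fin n × J) {M | ¬ ∀ t ≤ N, |inner ℝ (D M) (matAct M (A.query t (A.memory M t)) -
      (inner ℝ (A.query 0 A.init) (A.query t (A.memory M t)) : ℝ) • matAct M (A.query 0 A.init))| ≤
      t * (r * ‖D M‖ * ‖A.query t (A.memory M t) -
        (inner ℝ (A.query 0 A.init) (A.query t (A.memory M t)) : ℝ) • A.query 0 A.init‖)} ≤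
      ENNReal.ofReal (N * (2 * exp (-(n * r ^ 2 / 2)))) := by
  have hsub : {M | ¬ ∀ t ≤ N, |inner ℝ (D M) (matAct M (A.query t (A.memory M t)) -
      (inner ℝ (A.query 0 A.init) (A.query t (A.memory M t)) : ℝ) • matAct M (A.query 0 A.init))| ≤
      t * (r * ‖D M‖ * ‖A.query t (A.memory M t) -
        (inner ℝ (A.query 0 A.init) (A.query t (A.memory M t)) : ℝ) • A.query 0 A.init‖)} ⊆
      ⋃ j ∈ Finset.Icc 1 N, {M | r * ‖d (A.exploration.run M j)‖ <
        |inner ℝ (d (A.exploration.run M j)) (matAct M (A.exploration.dir j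
          (A.exploration.run M j)))|} := by
    intro M hM
    by_contra hM'
    simp only [Set.mem_iUnion, Finset.mem_Icc, not_exists, Set.mem_ofPred_eq, not_lt] at hM'
    refine hM fun t ht => A.abs_inner_query_sub_le M h fun j hj hjt => ?_
    have := hM' j ⟨hj, hjt.trans ht⟩
    rw [hdD M j hj] at this
    exact this
  refine (measure_mono hsub).trans ((measure_biUnion_finset_le _ _).trans ?_)
  refine (Finset.sum_le_sum fun j _ => A.exploration.gaussianPi_lt_abs_inner_le hn j hd hr).trans_eq ?_
  rw [Finset.sum_const, Nat.card_Icc, Nat.add_sub_cancel, nsmul_eq_mul,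
    ENNReal.ofReal_mul (Nat.cast_nonneg N), ENNReal.ofReal_natCast]

end QueryAlgorithm

/-! ### Nets and the injective norm of a Gaussian tensor. -/

/-- A `1`-separated subset of the ball of radius `2` of maximal cardinality is a net; the
cardinality is bounded by the volume estimate behind Besicovitch's covering theorem. -/
theorem exists_finset_net (E : Type*) [NormedAddCommGroup E] [NormedSpace ℝ E]
    [FiniteDimensional ℝ E] : ∃ s : Finset E, s.card ≤ 5 ^ Module.finrank ℝ E ∧
      (∀ c ∈ s, ‖c‖ ≤ 2) ∧ ∀ x : E, ‖x‖ ≤ 2 → ∃ c ∈ s, ‖x - c‖ ≤ 1 := by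
  classical
  let p : Finset E → Prop := fun s =>
    (∀ c ∈ s, ‖c‖ ≤ 2) ∧ ∀ c ∈ s, ∀ d ∈ s, c ≠ d → 1 ≤ ‖c - d‖
  have hb : ∀ s, p s → s.card ≤ 5 ^ Module.finrank ℝ E := fun s hs =>
    Besicovitch.card_le_of_separated s hs.1 hs.2
  obtain ⟨s, hs, hmax⟩ : ∃ s, p s ∧ ∀ s', p s' → s'.card ≤ s.card := by
    have hex : ∃ m, ∃ s, p s ∧ s.card = m := ⟨0, ∅, by simp [p], rfl⟩
    have hbd : ∀ m, (∃ s, p s ∧ s.card = m) → m ≤ 5 ^ Module.finrank ℝ E := by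
      rintro m ⟨s, hs, rfl⟩
      exact hb s hs
    obtain ⟨m, ⟨s, hs, rfl⟩, hm⟩ := Nat.findGreatest_spec (P := fun m => ∃ s, p s ∧ s.card = m)
      (Nat.zero_le (5 ^ Module.finrank ℝ E)) ⟨∅, by simp [p], rfl⟩ |> fun h =>
      (⟨_, h, fun m' hm' => Nat.le_findGreatest (hbd m' hm') hm'⟩ :
        ∃ m, (∃ s, p s ∧ s.card = m) ∧ ∀ m', (∃ s, p s ∧ s.card = m') → m' ≤ m)
    exact ⟨s, hs, fun s' hs' => hm _ ⟨s', hs', rfl⟩⟩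
  refine ⟨s, hb s hs, hs.1, fun x hx => ?_⟩
  by_contra hcon
  push Not at hcon
  have hxs : x ∉ s := fun h => by
    have := hcon x h
    simp at this
    linarith
  have hp : p (insert x s) := by
    refine ⟨fun c hc => ?_, fun c hc d hd hcd => ?_⟩
    · rcases Finset.mem_insert.1 hc with rfl | hc
      exacts [hx, hs.1 c hc]
    · rcases Finset.mem_insert.1 hc with hc' | hc' <;>
        rcases Finset.mem_insert.1 hd with hd' | hd'
      · exact absurd (hc'.trans hd'.symm) hcd
      · rw [hc']; exact (hcon d hd').le
      · rw [hd', norm_sub_rev]; exact (hcon c hc').le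
      · exact hs.2 c hc' d hd' hcd
  have := hmax _ hp
  rw [Finset.card_insert_of_notMem hxs] at this
  omega

theorem abs_le_of_net {E : Type*} [NormedAddCommGroup E] [NormedSpace ℝ E]
    [FiniteDimensional ℝ E] {s : Finset E} (hs : ∀ x : E, ‖x‖ ≤ 2 → ∃ c ∈ s, ‖x - c‖ ≤ 1)
    (φ : E →ₗ[ℝ] ℝ) {A : ℝ} (hA : 0 ≤ A) (hφ : ∀ c ∈ s, |φ c| ≤ A) (x : E) : |φ x| ≤ A * ‖x‖ := by
  let ψ : E →L[ℝ] ℝ := LinearMap.toContinuousLinearMap φ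
  -- Doubling a unit vector puts it in the ball of radius `2`, where a net point is at distance at
  -- most `1`. The approximation error is then half the operator norm and can be absorbed.
  have h1 : ‖ψ‖ ≤ (A + ‖ψ‖) / 2 := by
    refine ContinuousLinearMap.opNorm_le_of_unit_norm (by positivity) fun x hx => ?_
    obtain ⟨c, hc, hxc⟩ := hs ((2 : ℝ) • x) (by simp [norm_smul, hx])
    have h2 : ψ ((2 : ℝ) • x) = ψ c + ψ ((2 : ℝ) • x - c) := by rw [← map_add]; congr 1; abel
    have h3 : ‖ψ ((2 : ℝ) • x - c)‖ ≤ ‖ψ‖ * 1 :=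
      (ψ.le_opNorm _).trans (mul_le_mul_of_nonneg_left hxc (norm_nonneg _))
    have h4 : ‖ψ c‖ ≤ A := hφ c hc
    have h5 : ‖ψ ((2 : ℝ) • x)‖ = 2 * ‖ψ x‖ := by rw [map_smul, norm_smul]; simp
    have h6 : ‖ψ ((2 : ℝ) • x)‖ ≤ ‖ψ c‖ + ‖ψ ((2 : ℝ) • x - c)‖ := by rw [h2]; exact norm_add_le _ _
    linarith
  have h2 : ‖ψ‖ ≤ A := by linarith
  exact (ψ.le_opNorm x).trans (mul_le_mul_of_nonneg_right h2 (norm_nonneg _))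

/-- The slots are released from the net one at a time, each by the linear case, which loses no
constant. -/
theorem MultilinearMap.abs_le_of_net {E ι : Type*} [Fintype ι] [NormedAddCommGroup E]
    [NormedSpace ℝ E] [FiniteDimensional ℝ E] {s : Finset E}
    (hs : ∀ x : E, ‖x‖ ≤ 2 → ∃ c ∈ s, ‖x - c‖ ≤ 1) (f : MultilinearMap ℝ (fun _ : ι => E) ℝ)
    {A : ℝ} (hA : 0 ≤ A) (hf : ∀ x : ι → E, (∀ j, x j ∈ s) → |f x| ≤ A) (x : ι → E) :
    |f x| ≤ A * ∏ j, ‖x j‖ := by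
  classical
  have key : ∀ R : Finset ι, ∀ x : ι → E, (∀ j ∉ R, x j ∈ s) → |f x| ≤ A * ∏ j ∈ R, ‖x j‖ := by
    intro R
    induction R using Finset.induction_on with
    | empty => intro x hx; simpa using hf x fun j => hx j (by simp)
    | insert r R hr ih =>
      intro x hx
      have h1 : |f.toLinearMap x r (x r)| ≤ (A * ∏ j ∈ R, ‖x j‖) * ‖x r‖ := by
        refine _root_.abs_le_of_net hs _ (by positivity) (fun c hc => ?_) _
        have h2 := ih (Function.update x r c) fun j hj => by
          by_cases hjr : j = r
          · subst hjr; simpa using hc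
          · simpa [hjr] using hx j (by simp [hj, hjr])
        have h3 : ∏ j ∈ R, ‖Function.update x r c j‖ = ∏ j ∈ R, ‖x j‖ :=
          Finset.prod_congr rfl fun j hj => by
            rw [Function.update_of_ne (ne_of_mem_of_not_mem hj hr)]
        rw [h3] at h2
        exact h2
      rw [Finset.prod_insert hr]
      have h4 : f.toLinearMap x r (x r) = f x := by simp
      rw [h4] at h1
      linarith
  exact key Finset.univ x fun j hj => absurd (Finset.mem_univ j) hj

section Tensor

variable {n k : ℕ}

/-- The multilinear form of a tensor. -/
noncomputable def tensorForm (τ : Tensor n k) :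
    MultilinearMap ℝ (fun _ : Fin k => EuclideanSpace ℝ (Fin n)) ℝ :=
  ∑ I : Fin k → Fin n, τ I • (MultilinearMap.mkPiAlgebra ℝ (Fin k) ℝ).compLinearMap
    fun j => (EuclideanSpace.proj (I j) : EuclideanSpace ℝ (Fin n) →L[ℝ] ℝ).toLinearMap

theorem tensorForm_apply (τ : Tensor n k) (x : Fin k → EuclideanSpace ℝ (Fin n)) :
    tensorForm τ x = ∑ I, (∏ j, x j (I j)) * τ I := by
  simp [tensorForm, mul_comm]

theorem sum_prod_apply_sq (x : Fin k → EuclideanSpace ℝ (Fin n)) :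
    ∑ I : Fin k → Fin n, (∏ j, x j (I j)) ^ 2 = ∏ j, ‖x j‖ ^ 2 := by
  simp_rw [EuclideanSpace.real_norm_sq_eq, ← Finset.prod_pow]
  rw [Finset.prod_univ_sum, Fintype.piFinset_univ]

/-- A bound for the injective norm of the noise. -/
noncomputable def noiseBound (k : ℕ) : ℝ := 2 ^ k * √(4 * k + 2)

/-- There are at most `5^{nk} ≤ e^{2nk}` tuples of net points, each giving a Gaussian of variance at
most `4^k / n`. The choice `noiseBound k ^ 2 = 4^k (4k + 2)` makes each tail `2 e^{-n(2k+1)}`, so a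
factor `e^{-n}` survives the union bound. -/
theorem IsIIDGaussian.measure_injectiveNorm_le {Ω : Type*} [MeasurableSpace Ω] {P : Measure Ω}
    [IsProbabilityMeasure P] {Z : Ω → Tensor n k} (h : IsIIDGaussian n P (fun I ω => Z ω I))
    (hn : 0 < n) :
    P {ω | ¬ ∀ x, |tensorForm (Z ω) x| ≤ noiseBound k * ∏ j, ‖x j‖} ≤
      ENNReal.ofReal (2 * exp (-n)) := by
  classical
  obtain ⟨s, hcard, hs2, hs⟩ := exists_finset_net (EuclideanSpace ℝ (Fin n))
  rw [finrank_euclideanSpace_fin] at hcard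
  have hA : 0 ≤ noiseBound k := by unfold noiseBound; positivity
  have hsub : {ω | ¬ ∀ x, |tensorForm (Z ω) x| ≤ noiseBound k * ∏ j, ‖x j‖} ⊆
      ⋃ x ∈ Fintype.piFinset fun _ : Fin k => s, {ω | noiseBound k < |tensorForm (Z ω) x|} := by
    intro ω hω
    by_contra hcon
    simp only [Set.mem_iUnion, Fintype.mem_piFinset, not_exists, Set.mem_ofPred_eq, not_lt] at hcon
    exact hω fun x => (tensorForm (Z ω)).abs_le_of_net hs hA (fun x hx => hcon x hx) x
  have hterm : ∀ x ∈ Fintype.piFinset fun _ : Fin k => s,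
      P {ω | noiseBound k < |tensorForm (Z ω) x|} ≤
        ENNReal.ofReal (2 * exp (-(n * (2 * k + 1)))) := by
    intro x hx
    have hx' := Fintype.mem_piFinset.1 hx
    simp_rw [tensorForm_apply]
    refine (h.measure_lt_abs_linear_le hn _ (A := 4 ^ k) (by positivity) ?_ hA).trans_eq ?_
    · rw [sum_prod_apply_sq]
      calc ∏ j, ‖x j‖ ^ 2 ≤ ∏ _j : Fin k, (4 : ℝ) :=
            Finset.prod_le_prod (fun j _ => by positivity) fun j _ => by
              nlinarith [hs2 _ (hx' j), norm_nonneg (x j)]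
        _ = 4 ^ k := by simp
    · congr 3
      rw [noiseBound, mul_pow, sq_sqrt (by positivity), ← pow_mul, mul_comm k 2, pow_mul]
      norm_num
      field_simp
      ring
  refine (measure_mono hsub).trans ((measure_biUnion_finset_le _ _).trans ?_)
  refine (Finset.sum_le_sum hterm).trans ?_
  rw [Finset.sum_const, nsmul_eq_mul, ← ENNReal.ofReal_natCast, ← ENNReal.ofReal_mul (by positivity)]
  refine ENNReal.ofReal_le_ofReal ?_
  have hc : ((Fintype.piFinset fun _ : Fin k => s).card : ℝ) ≤ exp (n * (2 * k)) := by
    rw [Fintype.card_piFinset_const]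
    push_cast
    have h5 : (5 : ℝ) ≤ exp 2 := by
      have := Real.exp_one_gt_d9
      have h2 : exp 2 = exp 1 * exp 1 := by rw [← exp_add]; norm_num
      rw [h2]; nlinarith
    calc (s.card : ℝ) ^ k ≤ ((5 : ℝ) ^ n) ^ k := by
          gcongr
          exact_mod_cast hcard
      _ ≤ ((exp 2) ^ n) ^ k := by gcongr
      _ = exp (n * (2 * k)) := by
          rw [← pow_mul, ← exp_nat_mul]
          congr 1
          push_cast
          ring
  calc _ ≤ exp (n * (2 * k)) * (2 * exp (-(n * (2 * k + 1)))) := by gcongr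
    _ = 2 * exp (-n) := by
        rw [mul_left_comm, ← exp_add]
        congr 2
        ring

end Tensor

/-! ### Algebra of tensors and rank one tensors. -/

section TensorAlgebra

variable {n k : ℕ}

/-- Splitting off the first entry of a multi-index. -/
def consIndexEquiv (n : ℕ) (hk : 0 < k) :
    Fin n × (Fin (k - 1) → Fin n) ≃ (Fin k → Fin n) where
  toFun p := consIndex p.1 p.2
  invFun I := (I ⟨0, hk⟩, fun j => I ⟨j + 1, by omega⟩)
  left_inv p := by ext <;> simp [consIndex]
  right_inv I := by
    ext j
    by_cases h : (j : ℕ) = 0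
    · have : j = ⟨0, hk⟩ := Fin.ext h
      simp [consIndex, this]
    · have : (⟨(j : ℕ) - 1 + 1, by omega⟩ : Fin k) = j := Fin.ext (by simp; omega)
      simp [consIndex, h, this]

theorem sum_consIndex (hk : 0 < k) (g : (Fin k → Fin n) → ℝ) :
    ∑ I, g I = ∑ i, ∑ J : Fin (k - 1) → Fin n, g (consIndex i J) := by
  rw [← (consIndexEquiv n hk).sum_comp, Fintype.sum_prod_type]
  rfl

/-- The family of vectors `(y, w, …, w)`. -/
def consConst (k : ℕ) (y w : EuclideanSpace ℝ (Fin n)) : Fin k → EuclideanSpace ℝ (Fin n) :=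
  fun j => if (j : ℕ) = 0 then y else w

theorem prod_consConst (hk : 0 < k) (y w : EuclideanSpace ℝ (Fin n)) (i : Fin n)
    (J : Fin (k - 1) → Fin n) :
    ∏ j, consConst k y w j (consIndex i J j) = y i * tensorPow w (k - 1) J := by
  obtain ⟨m, rfl⟩ : ∃ m, k = m + 1 := ⟨k - 1, by omega⟩
  rw [Fin.prod_univ_succ]
  simp [consConst, consIndex, tensorPow]

theorem inner_tensorAct (hk : 0 < k) (τ : Tensor n k) (y w : EuclideanSpace ℝ (Fin n)) :
    inner ℝ y (tensorAct τ (tensorPow w (k - 1))) = tensorForm τ (consConst k y w) := by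
  rw [tensorForm_apply, sum_consIndex hk]
  simp only [prod_consConst hk, PiLp.inner_apply, RCLike.inner_apply, conj_trivial, tensorAct,
    Finset.sum_mul]
  exact Finset.sum_congr rfl fun i _ => Finset.sum_congr rfl fun J _ => by ring

theorem consConst_self (w : EuclideanSpace ℝ (Fin n)) : consConst k w w = fun _ => w := by
  ext j; simp [consConst]

theorem tensorEval_eq_inner (hk : 0 < k) (τ : Tensor n k) (w : EuclideanSpace ℝ (Fin n)) :
    tensorEval τ w = inner ℝ w (tensorAct τ (tensorPow w (k - 1))) := by
  rw [inner_tensorAct hk, consConst_self, tensorForm_apply]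
  exact Finset.sum_congr rfl fun I _ => mul_comm _ _

theorem sum_tensorPow_mul (v w : EuclideanSpace ℝ (Fin n)) (m : ℕ) :
    ∑ J, tensorPow v m J * tensorPow w m J = inner ℝ v w ^ m := by
  simp only [PiLp.inner_apply, RCLike.inner_apply, conj_trivial, Fintype.sum_pow, tensorPow,
    ← Finset.prod_mul_distrib]
  exact Finset.sum_congr rfl fun I _ => Finset.prod_congr rfl fun j _ => by ring

theorem tensorPow_consIndex (hk : 0 < k) (v : EuclideanSpace ℝ (Fin n)) (i : Fin n)
    (J : Fin (k - 1) → Fin n) : tensorPow v k (consIndex i J) = v i * tensorPow v (k - 1) J := by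
  rw [← prod_consConst hk, consConst_self]
  rfl

theorem tensorAct_spikedTensor (hk : 0 < k) (β : ℝ) (v : EuclideanSpace ℝ (Fin n)) (Z : Tensor n k)
    (w : EuclideanSpace ℝ (Fin n)) :
    tensorAct (spikedTensor β v Z) (tensorPow w (k - 1)) =
      (β * inner ℝ v w ^ (k - 1)) • v + tensorAct Z (tensorPow w (k - 1)) := by
  ext i
  simp only [tensorAct, spikedTensor, Pi.add_apply, Pi.smul_apply, smul_eq_mul, add_mul,
    Finset.sum_add_distrib, PiLp.add_apply, PiLp.smul_apply, tensorPow_consIndex hk,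
    ← sum_tensorPow_mul, Finset.mul_sum, Finset.sum_mul]
  congr 1
  exact Finset.sum_congr rfl fun J _ => by ring

theorem tensorPow_smul (c : ℝ) (w : EuclideanSpace ℝ (Fin n)) (m : ℕ) :
    tensorPow (c • w) m = c ^ m • tensorPow w m := by
  ext I
  simp [tensorPow, Finset.prod_mul_distrib]

theorem tensorAct_smul (τ : Tensor n k) (c : ℝ) (η : Tensor n (k - 1)) :
    tensorAct τ (c • η) = c • tensorAct τ η := by
  ext i
  simp [tensorAct, Finset.mul_sum, mul_left_comm]

theorem norm_le_of_forall_inner_le {E : Type*} [NormedAddCommGroup E] [InnerProductSpace ℝ E]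
    {x : E} {C : ℝ} (hC : 0 ≤ C) (h : ∀ y : E, ‖y‖ = 1 → inner ℝ y x ≤ C) : ‖x‖ ≤ C := by
  by_cases hx : x = 0
  · simpa [hx] using hC
  · have h1 := h (‖x‖⁻¹ • x) (by simp [norm_smul, hx])
    have hx' : ‖x‖ ≠ 0 := norm_ne_zero_iff.2 hx
    rw [real_inner_smul_left, real_inner_self_eq_norm_sq] at h1
    rwa [sq, inv_mul_cancel_left₀ hx'] at h1

theorem norm_tensorAct_le (hk : 0 < k) {Z : Tensor n k} {K : ℝ} (hK : 0 ≤ K)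
    (hZ : ∀ x, |tensorForm Z x| ≤ K * ∏ j, ‖x j‖) {w : EuclideanSpace ℝ (Fin n)} (hw : ‖w‖ ≤ 1) :
    ‖tensorAct Z (tensorPow w (k - 1))‖ ≤ K := by
  refine norm_le_of_forall_inner_le hK fun y hy => ?_
  rw [inner_tensorAct hk]
  refine (le_abs_self _).trans ((hZ _).trans ?_)
  refine mul_le_of_le_one_right hK (Finset.prod_le_one (fun _ _ => norm_nonneg _) fun j _ => ?_)
  unfold consConst
  split_ifs
  exacts [hy.le, hw]

/-- The radius is `2` because the contraction argument evaluates the noise at iterates rescaled by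
the inverse of an overlap that is at least `1/2`. -/
theorem norm_tensorAct_sub_le (hk : 0 < k) {Z : Tensor n k} {K : ℝ} (hK : 0 ≤ K)
    (hZ : ∀ x, |tensorForm Z x| ≤ K * ∏ j, ‖x j‖) {w w' : EuclideanSpace ℝ (Fin n)}
    (hw : ‖w‖ ≤ 2) (hw' : ‖w'‖ ≤ 2) :
    ‖tensorAct Z (tensorPow w (k - 1)) - tensorAct Z (tensorPow w' (k - 1))‖ ≤
      K * k * 2 ^ (k - 1) * ‖w - w'‖ := by
  refine norm_le_of_forall_inner_le (by positivity) fun y hy => ?_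
  rw [inner_sub_right, inner_tensorAct hk, inner_tensorAct hk]
  refine (le_abs_self _).trans ?_
  have h := (tensorForm Z).norm_image_sub_le_of_bound hK (fun m => hZ m) (consConst k y w)
    (consConst k y w')
  rw [Real.norm_eq_abs, Fintype.card_fin] at h
  refine h.trans ?_
  have h2 : ∀ z : EuclideanSpace ℝ (Fin n), ‖z‖ ≤ 2 → ‖consConst k y z‖ ≤ 2 := fun z hz => by
    refine (pi_norm_le_iff_of_nonneg (by norm_num)).2 fun j => ?_
    unfold consConst
    split_ifs
    · rw [hy]; norm_num
    · exact hz
  have h3 : ‖consConst k y w - consConst k y w'‖ ≤ ‖w - w'‖ := by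
    refine (pi_norm_le_iff_of_nonneg (norm_nonneg _)).2 fun j => ?_
    simp only [Pi.sub_apply, consConst]
    split_ifs <;> simp
  have h4 : max ‖consConst k y w‖ ‖consConst k y w'‖ ≤ 2 := max_le (h2 w hw) (h2 w' hw')
  gcongr

/-- The rank one tensor `w^{⊗m}` as an element of a Euclidean space. -/
noncomputable def tensorPowLp (w : EuclideanSpace ℝ (Fin n)) (m : ℕ) :
    EuclideanSpace ℝ (Fin m → Fin n) := WithLp.toLp 2 (tensorPow w m)

theorem inner_tensorPowLp (v w : EuclideanSpace ℝ (Fin n)) (m : ℕ) :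
    inner ℝ (tensorPowLp v m) (tensorPowLp w m) = (inner ℝ v w : ℝ) ^ m := by
  rw [← sum_tensorPow_mul]
  simp only [PiLp.inner_apply, RCLike.inner_apply, conj_trivial, tensorPowLp]
  exact Finset.sum_congr rfl fun J _ => mul_comm _ _

theorem norm_tensorPowLp {w : EuclideanSpace ℝ (Fin n)} (hw : ‖w‖ = 1) (m : ℕ) :
    ‖tensorPowLp w m‖ = 1 := by
  have h : ‖tensorPowLp w m‖ ^ 2 = 1 := by
    rw [← real_inner_self_eq_norm_sq, inner_tensorPowLp, real_inner_self_eq_norm_sq, hw]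
    simp
  nlinarith [norm_nonneg (tensorPowLp w m)]

/-- Pythagoras. This is the norm of the residual query, hence the scale of the fluctuations at `w`.
-/
theorem norm_tensorPowLp_sub {v w : EuclideanSpace ℝ (Fin n)} (hv : ‖v‖ = 1) (hw : ‖w‖ = 1)
    (m : ℕ) : ‖tensorPowLp w m - ((inner ℝ v w : ℝ) ^ m) • tensorPowLp v m‖ =
      √(1 - ((inner ℝ v w : ℝ) ^ m) ^ 2) := by
  rw [← sqrt_sq (norm_nonneg (tensorPowLp w m - _)), norm_sub_sq_real, norm_smul,
    norm_tensorPowLp hv, norm_tensorPowLp hw, inner_smul_right, inner_tensorPowLp,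
    real_inner_comm v w]
  congr 1
  simp only [norm_eq_abs, mul_one, sq_abs]
  ring

/-- A tensor as an array with the first index separated. -/
def tensorArray (τ : Tensor n k) : Fin n × (Fin (k - 1) → Fin n) → ℝ :=
  fun p => τ (consIndex p.1 p.2)

theorem matAct_tensorArray (τ : Tensor n k) (w : EuclideanSpace ℝ (Fin n)) :
    matAct (tensorArray τ) (tensorPowLp w (k - 1)) = tensorAct τ (tensorPow w (k - 1)) := rfl

theorem measurable_tensorPowLp (m : ℕ) :
    Measurable fun w : EuclideanSpace ℝ (Fin n) => tensorPowLp w m := by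
  unfold tensorPowLp tensorPow
  fun_prop

theorem IsIIDGaussian.array_entries {Ω : Type*} [MeasurableSpace Ω] {P : Measure Ω} (hk : 0 < k)
    {Z : Ω → Tensor n k} (h : IsIIDGaussian n P (fun I ω => Z ω I)) :
    IsIIDGaussian n P (fun p ω => tensorArray (Z ω) p) :=
  h.precomp (f := consIndexEquiv n hk) (consIndexEquiv n hk).injective

theorem sum_tensorPow_sq {v : EuclideanSpace ℝ (Fin n)} (hv : ‖v‖ = 1) (m : ℕ) :
    ∑ J, tensorPow v m J ^ 2 = 1 := by
  simp_rw [sq, sum_tensorPow_mul, real_inner_self_eq_norm_sq, hv]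
  simp

theorem IsIIDGaussian.noise_entries {Ω : Type*} [MeasurableSpace Ω] {P : Measure Ω}
    [IsProbabilityMeasure P] (hk : 0 < k) {Z : Ω → Tensor n k}
    (h : IsIIDGaussian n P (fun I ω => Z ω I)) {v : EuclideanSpace ℝ (Fin n)} (hv : ‖v‖ = 1) :
    IsIIDGaussian n P (fun i ω => tensorAct (Z ω) (tensorPow v (k - 1)) i) := by
  have := (h.array_entries hk).rows (sum_tensorPow_sq hv (k - 1))
  simpa [tensorArray, tensorAct, mul_comm] using this

end TensorAlgebra

/-! ### Power iteration as an adaptive query algorithm. -/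

section PowerIteration

variable {n k : ℕ}

/-- Power iteration as an algorithm which queries the noise tensor, with the initial query `v^{⊗(k-1)}`
in addition. -/
noncomputable def powerAlgorithm (k : ℕ) (β : ℝ) (v u : EuclideanSpace ℝ (Fin n)) :
    QueryAlgorithm n (Fin (k - 1) → Fin n) (EuclideanSpace ℝ (Fin n)) where
  init := u
  query t w := if t = 0 then tensorPowLp v (k - 1) else tensorPowLp w (k - 1)
  update t w r := if t = 0 then w else
    ‖(β * inner ℝ v w ^ (k - 1)) • v + r‖⁻¹ • ((β * inner ℝ v w ^ (k - 1)) • v + r)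
  measurable_query t := by
    by_cases h : t = 0
    · simpa only [h, if_true] using measurable_const
    · simpa only [h, if_false] using measurable_tensorPowLp (k - 1)
  measurable_update t := by
    by_cases h : t = 0
    · simpa only [h, if_true] using measurable_fst
    · simp only [h, if_false]
      have h1 : Measurable fun p : EuclideanSpace ℝ (Fin n) × EuclideanSpace ℝ (Fin n) =>
          (β * (inner ℝ v p.1 : ℝ) ^ (k - 1)) • v + p.2 := by fun_prop
      exact h1.norm.inv.smul h1

/-- The time shift comes from the additional query at `v^{⊗(k-1)}`, which leaves the memory
unchanged. -/
theorem powerAlgorithm_memory (hk : 0 < k) (β : ℝ) (v u : EuclideanSpace ℝ (Fin n))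
    (Z : Tensor n k) (t : ℕ) : (powerAlgorithm k β v u).memory (tensorArray Z) (t + 1) =
      powerIter (spikedTensor β v Z) u t := by
  induction t with
  | zero => simp [QueryAlgorithm.memory, powerAlgorithm, powerIter]
  | succ t ih =>
    rw [QueryAlgorithm.memory, ih, powerIter, tensorAct_spikedTensor hk]
    simp [powerAlgorithm, matAct_tensorArray]

/-- The direction is a function `D` of the noise along the signal since `ξ` itself is needed as a
test vector. The unit norm of an iterate can only be established later, together with its alignment,
and is therefore a premise inside the event. -/
theorem IsIIDGaussian.measure_inner_noise_le {Ω : Type*} [MeasurableSpace Ω] {P : Measure Ω}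
    [IsProbabilityMeasure P] (hk : 0 < k) {Z : Ω → Tensor n k}
    (h : IsIIDGaussian n P (fun I ω => Z ω I)) (hn : 0 < n) (β : ℝ)
    {v : EuclideanSpace ℝ (Fin n)} (hv : ‖v‖ = 1) (u : EuclideanSpace ℝ (Fin n)) (N : ℕ)
    {D : EuclideanSpace ℝ (Fin n) → EuclideanSpace ℝ (Fin n)} (hD : Measurable D)
    {r : ℝ} (hr : 0 ≤ r) :
    P {ω | ¬ ∀ t < N, ‖powerIter (spikedTensor β v (Z ω)) u t‖ = 1 →
      |inner ℝ (D (tensorAct (Z ω) (tensorPow v (k - 1))))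
        (tensorAct (Z ω) (tensorPow (powerIter (spikedTensor β v (Z ω)) u t) (k - 1)) -
          ((inner ℝ v (powerIter (spikedTensor β v (Z ω)) u t) : ℝ) ^ (k - 1)) •
            tensorAct (Z ω) (tensorPow v (k - 1)))| ≤
      N * (r * ‖D (tensorAct (Z ω) (tensorPow v (k - 1)))‖ *
        √(1 - ((inner ℝ v (powerIter (spikedTensor β v (Z ω)) u t) : ℝ) ^ (k - 1)) ^ 2))} ≤
      ENNReal.ofReal (N * (2 * exp (-(n * r ^ 2 / 2)))) := by
  set A := powerAlgorithm k β v u with hA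
  have hq0 : A.query 0 A.init = tensorPowLp v (k - 1) := by simp [hA, powerAlgorithm]
  have hqs : ∀ t w, A.query (t + 1) w = tensorPowLp w (k - 1) := by simp [hA, powerAlgorithm]
  have hq1 : ‖A.query 0 A.init‖ = 1 := by rw [hq0, norm_tensorPowLp hv]
  refine le_trans (measure_mono ?_) (((h.array_entries hk).measure_le _).trans
    (A.gaussianPi_abs_inner_query_sub_le hn hq1 N
    (D := fun M => D (matAct M (tensorPowLp v (k - 1)))) (d := fun s => D (s.2.1 0))
    (hD.comp (QueryAlgorithm.measurable_state_snd 0)) ?_ hr))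
  · intro ω hω hcon
    refine hω fun t ht hu => ?_
    have h1 := hcon (t + 1) ht
    rw [powerAlgorithm_memory hk, hqs, hq0, inner_tensorPowLp, norm_tensorPowLp_sub hv hu] at h1
    refine h1.trans ?_
    gcongr
    · exact_mod_cast ht
    · exact le_rfl
  · intro M t ht
    rw [A.run_snd M t 0 (by omega), A.direction_zero M hq1, hq0]

end PowerIteration

/-! ### The high probability event. -/

section RegularNoise

variable {n k : ℕ}

/-- The vector `Z[w^{⊗(k-1)}]`. -/
noncomputable def noiseVec (Z : Tensor n k) (w : EuclideanSpace ℝ (Fin n)) :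
    EuclideanSpace ℝ (Fin n) := tensorAct Z (tensorPow w (k - 1))

/-- In the direction `d`, the noise along the iterates differs from the noise along the signal
only by a fluctuation. -/
def NoiseClose (L : ℝ) (N : ℕ) (v : EuclideanSpace ℝ (Fin n)) (Z : Tensor n k)
    (w : ℕ → EuclideanSpace ℝ (Fin n)) (d : EuclideanSpace ℝ (Fin n)) : Prop :=
  ∀ t < N, ‖w t‖ = 1 →
    |inner ℝ d (noiseVec Z (w t) - ((inner ℝ v (w t) : ℝ) ^ (k - 1)) • noiseVec Z v)| ≤
      N * (L * ‖d‖ * √(1 - ((inner ℝ v (w t) : ℝ) ^ (k - 1)) ^ 2))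

/-- The properties of the noise tensor that are needed in the analysis of power iteration. -/
structure RegularNoise (K L : ℝ) (N : ℕ) (β : ℝ) (v u a : EuclideanSpace ℝ (Fin n))
    (Z : Tensor n k) : Prop where
  form : ∀ x, |tensorForm Z x| ≤ K * ∏ j, ‖x j‖
  norm_sq : |‖noiseVec Z v‖ ^ 2 - 1| ≤ 3 * L
  inner_v : |inner ℝ v (noiseVec Z v)| ≤ L
  inner_a : |inner ℝ a (noiseVec Z v)| ≤ L
  close_v : NoiseClose L N v Z (powerIter (spikedTensor β v Z) u) v
  close_a : NoiseClose L N v Z (powerIter (spikedTensor β v Z) u) a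
  close_noise : NoiseClose L N v Z (powerIter (spikedTensor β v Z) u) (noiseVec Z v)

theorem exp_neg_log_sq (hn : 0 < n) : exp (-(log n ^ 2 / 4)) = (n : ℝ) ^ (-(1 / 4 * log n)) := by
  rw [rpow_def_of_pos (by exact_mod_cast hn)]
  congr 1
  ring

theorem log_sq_le (hn : 0 < n) : log n ^ 2 ≤ 4 * n := by
  have hn' : (1 : ℝ) ≤ n := by exact_mod_cast hn
  have h0 : 0 ≤ log n := log_nonneg hn'
  have h1 : log n = 2 * log (√n) := by rw [log_sqrt (by positivity)]; ring
  have h2 : log (√n) ≤ √n := (log_le_sub_one_of_pos (by positivity)).trans (by linarith)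
  have h3 : √(n : ℝ) ^ 2 = n := sq_sqrt (by positivity)
  nlinarith

/-- Seven events are excluded: four have probability at most `2E` and three at most `2NE`, with `E =
exp (-(log n)² / 4)`. The factor `3` in the bound on `‖ξ‖²` yields the rate `9/16 ≥ 1/4`, and `(log
n)² ≤ 4n` turns `e^{-n}` into `E`. -/
theorem IsIIDGaussian.measure_not_regularNoise_le {Ω : Type*} [MeasurableSpace Ω] {P : Measure Ω}
    [IsProbabilityMeasure P] (hk : 0 < k) {Z : Ω → Tensor n k}
    (h : IsIIDGaussian n P (fun I ω => Z ω I)) (hn : 0 < n) (hL : 3 * (log n / √n) ≤ 2) (β : ℝ)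
    {v a : EuclideanSpace ℝ (Fin n)} (hv : ‖v‖ = 1) (ha : ‖a‖ = 1)
    (u : EuclideanSpace ℝ (Fin n)) (N : ℕ) :
    P {ω | ¬ RegularNoise (noiseBound k) (log n / √n) N β v u a (Z ω)} ≤
      ENNReal.ofReal ((8 + 6 * N) * (n : ℝ) ^ (-(1 / 4 * log n))) := by
  have hn' : (1 : ℝ) ≤ n := by exact_mod_cast hn
  have hL0 : 0 ≤ log n / √n := div_nonneg (log_nonneg hn') (sqrt_nonneg _)
  have hLn : n * (log n / √n) ^ 2 = log n ^ 2 := by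
    rw [div_pow, sq_sqrt (by positivity)]
    field_simp
  have hξ := h.noise_entries hk hv
  have e1 := h.measure_injectiveNorm_le hn
  have e2 := hξ.measure_lt_abs_sum_sq_sub_one_le hn (r := 3 * (log n / √n)) (by positivity) hL
  have e34 : ∀ d : EuclideanSpace ℝ (Fin n), ‖d‖ = 1 →
      P {ω | ¬ |inner ℝ d (noiseVec (Z ω) v)| ≤ log n / √n} ≤
        ENNReal.ofReal (2 * exp (-(log n ^ 2 / 4))) := by
    intro d hd
    have h1 := hξ.measure_lt_abs_linear_le hn (fun i => d i) (A := 1) one_pos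
      (by rw [← EuclideanSpace.real_norm_sq_eq, hd]; norm_num) hL0
    refine le_trans (le_of_eq ?_) (h1.trans (ENNReal.ofReal_le_ofReal ?_))
    · congr 1
      ext ω
      simp only [Set.mem_ofPred_eq, not_le, noiseVec, PiLp.inner_apply, RCLike.inner_apply,
        conj_trivial, mul_comm]
    · rw [hLn]
      gcongr 2 * exp (-?_)
      nlinarith [sq_nonneg (log n)]
  have e5 : ∀ {D : EuclideanSpace ℝ (Fin n) → EuclideanSpace ℝ (Fin n)}, Measurable D →
      P {ω | ¬ NoiseClose (log n / √n) N v (Z ω) (powerIter (spikedTensor β v (Z ω)) u)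
        (D (noiseVec (Z ω) v))} ≤ ENNReal.ofReal (N * (2 * exp (-(log n ^ 2 / 4)))) := by
    intro D hD
    refine (h.measure_inner_noise_le hk hn β hv u N hD hL0).trans (ENNReal.ofReal_le_ofReal ?_)
    rw [hLn]
    gcongr
    nlinarith [sq_nonneg (log n)]
  have e3 := e34 v hv
  have e4 := e34 a ha
  have e6 := e5 (D := fun _ => v) measurable_const
  have e7 := e5 (D := fun _ => a) measurable_const
  have e8 := e5 (D := id) measurable_id
  set E := exp (-(log n ^ 2 / 4)) with hE
  have hE0 : 0 < E := exp_pos _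
  have e1' := e1.trans (ENNReal.ofReal_le_ofReal (show 2 * exp (-(n : ℝ)) ≤ 2 * E by
    rw [hE]
    gcongr
    linarith [log_sq_le hn]))
  have h9 : n * (3 * (log n / √n)) ^ 2 = 9 * log n ^ 2 := by
    rw [mul_pow, mul_left_comm, hLn]
    norm_num
  rw [h9] at e2
  have e2' := e2.trans (ENNReal.ofReal_le_ofReal (show _ ≤ 2 * E by
    rw [hE]
    gcongr 2 * exp (-?_)
    nlinarith [sq_nonneg (log n)]))
  have hsub : {ω | ¬ RegularNoise (noiseBound k) (log n / √n) N β v u a (Z ω)} ⊆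
      {ω | ¬ ∀ x, |tensorForm (Z ω) x| ≤ noiseBound k * ∏ j, ‖x j‖} ∪
      ({ω | 3 * (log n / √n) < |∑ i, tensorAct (Z ω) (tensorPow v (k - 1)) i ^ 2 - 1|} ∪
      ({ω | ¬ |inner ℝ v (noiseVec (Z ω) v)| ≤ log n / √n} ∪
      ({ω | ¬ |inner ℝ a (noiseVec (Z ω) v)| ≤ log n / √n} ∪
      ({ω | ¬ NoiseClose (log n / √n) N v (Z ω) (powerIter (spikedTensor β v (Z ω)) u) v} ∪
      ({ω | ¬ NoiseClose (log n / √n) N v (Z ω) (powerIter (spikedTensor β v (Z ω)) u) a} ∪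
      {ω | ¬ NoiseClose (log n / √n) N v (Z ω) (powerIter (spikedTensor β v (Z ω)) u)
        (noiseVec (Z ω) v)}))))) := by
    intro ω hω
    by_contra hcon
    simp only [Set.mem_union, not_or, Set.mem_ofPred_eq, not_not, not_lt] at hcon
    obtain ⟨c1, c2, c3, c4, c5, c6, c7⟩ := hcon
    refine hω ⟨c1, ?_, c3, c4, c5, c6, c7⟩
    rw [EuclideanSpace.real_norm_sq_eq]
    exact c2
  refine (measure_mono hsub).trans ?_
  have hU : ∀ {s t : Set Ω} {x y : ENNReal}, P s ≤ x → P t ≤ y → P (s ∪ t) ≤ x + y :=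
    fun hs ht => (measure_union_le _ _).trans (add_le_add hs ht)
  refine (hU e1' (hU e2' (hU e3 (hU e4 (hU e6 (hU e7 e8)))))).trans_eq ?_
  have hN : 0 ≤ (N : ℝ) * (2 * E) := by positivity
  have h2E : 0 ≤ 2 * E := by positivity
  rw [← ENNReal.ofReal_add hN hN, ← ENNReal.ofReal_add hN (by positivity),
    ← ENNReal.ofReal_add h2E (by positivity), ← ENNReal.ofReal_add h2E (by positivity),
    ← ENNReal.ofReal_add h2E (by positivity), ← ENNReal.ofReal_add h2E (by positivity),
    ← exp_neg_log_sq hn]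
  congr 1
  ring

end RegularNoise

/-! ### Scalar expansions of a normalized perturbation. -/

section RealExpansion

theorem inv_sqrt_expansion {g δ : ℝ} (hg : 0 < g) (h : g ^ 2 * (1 + δ) = 1) (hδ : |δ| ≤ 1 / 2) :
    |g - 1| ≤ |δ| ∧ |g - (1 - δ / 2)| ≤ δ ^ 2 ∧ g ^ 2 ≤ 2 ∧ g ≤ 2 := by
  have hδ' := abs_le.1 hδ
  have hg2 : g ^ 2 ≤ 2 := by nlinarith [sq_nonneg g]
  have hgp : g ^ 2 ≤ g + 1 := by
    rcases le_total g 1 with h1 | h1 <;> nlinarith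
  -- Eliminating `δ` makes both remainders rational functions of `g` with an explicit factor `(g -
  -- 1)²`, so no calculus is needed.
  have hd : δ = (1 - g ^ 2) / g ^ 2 := by
    field_simp
    linarith
  have hg2' : g ≤ 2 := by nlinarith
  refine ⟨?_, ?_, hg2, hg2'⟩
  · have h1 : |g - 1| * (g + 1) = |δ| * g ^ 2 := by
      have h3 : |(g - 1) * (g + 1)| = |δ * g ^ 2| := by
        rw [← abs_neg (δ * g ^ 2)]
        congr 1
        linarith
      rwa [abs_mul, abs_mul, abs_of_pos (show 0 < g + 1 by linarith), abs_of_pos (pow_pos hg 2)] at h3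
    have h2 : |δ| * g ^ 2 ≤ |δ| * (g + 1) := mul_le_mul_of_nonneg_left hgp (abs_nonneg _)
    exact le_of_mul_le_mul_right (h1.trans_le h2) (by linarith)
  · have h1 : g - (1 - δ / 2) = (g - 1) ^ 2 * ((2 * g + 1) / (2 * g ^ 2)) := by
      rw [hd]; field_simp; ring
    have h2 : δ ^ 2 = (g - 1) ^ 2 * ((g + 1) ^ 2 / g ^ 4) := by
      rw [hd]; field_simp; ring
    rw [h1, h2, abs_of_nonneg (by positivity)]
    refine mul_le_mul_of_nonneg_left ?_ (sq_nonneg _)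
    rw [div_le_div_iff₀ (by positivity) (by positivity)]
    have : (2 * g + 1) * g ^ 2 ≤ 2 * (g + 1) ^ 2 := by nlinarith
    nlinarith [mul_le_mul_of_nonneg_right this (sq_nonneg g)]

variable {e L Λ x r S g : ℝ}

/-- The quantities that enter the expansion of a normalized perturbation of a unit vector. -/
structure SmallPerturbation (e L Λ x r S g : ℝ) : Prop where
  e_pos : 0 < e
  L_nonneg : 0 ≤ L
  L_le : L ≤ 1
  one_le : 1 ≤ Λ
  e_le : 16 * Λ * e ≤ 1
  x_le : |x| ≤ L
  r_le : |r| ≤ Λ * L * e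
  S_le : |S - 1| ≤ 5 * Λ * L + Λ ^ 2 * e ^ 2
  S_nonneg : 0 ≤ S
  S_le' : S ≤ 9
  g_pos : 0 < g
  g_eq : g ^ 2 * (1 + (2 * (x + r) * e + S * e ^ 2)) = 1

namespace SmallPerturbation

theorem abs_add_le (h : SmallPerturbation e L Λ x r S g) : |x + r| ≤ 2 * L := by
  obtain ⟨he, hL, hL1, hΛ, heΛ, hx, hr, -, -, -, -, -⟩ := h
  refine (_root_.abs_add_le _ _).trans ?_
  nlinarith

theorem e_le_one (h : SmallPerturbation e L Λ x r S g) : e ≤ 1 / 16 := by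
  nlinarith [h.e_pos, h.one_le, h.e_le]

theorem abs_delta_le (h : SmallPerturbation e L Λ x r S g) :
    |2 * (x + r) * e + S * e ^ 2| ≤ 4 * L * e + 9 * e ^ 2 := by
  have h1 := h.abs_add_le
  refine (_root_.abs_add_le _ _).trans ?_
  rw [abs_mul, abs_mul, abs_two, abs_of_pos h.e_pos, abs_mul, abs_of_nonneg h.S_nonneg,
    abs_of_nonneg (sq_nonneg e)]
  have := mul_le_mul_of_nonneg_right h1 h.e_pos.le
  have := mul_le_mul_of_nonneg_right h.S_le' (sq_nonneg e)
  linarith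

/-- In the application `e = 1/B`, `x = ⟨z,ξ⟩`, `r = ⟨z,ρ⟩`, `S = ‖ξ+ρ‖²` and `g = B / ‖B z + ξ +
ρ‖`, that is `g = (1 + δ)^{-1/2}` with `δ = 2(x+r)e + S e²`. The terms `r e` and `(S-1) e²` and the
square `δ²` are all of order `L e² + e⁴`, which leaves `1 - x e - e²/2`. -/
theorem expansion (h : SmallPerturbation e L Λ x r S g) :
    |g - 1| ≤ 4 * L * e + 9 * e ^ 2 ∧ |g - (1 - x * e - e ^ 2 / 2)| ≤ 200 * Λ ^ 2 * (L * e ^ 2 + e ^ 4) ∧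
      g ^ 2 ≤ 2 ∧ g ≤ 2 := by
  have hd := h.abs_delta_le
  have he16 := h.e_le_one
  have hs := h.abs_add_le
  obtain ⟨he, hL, hL1, hΛ, heΛ, hx, hr, hS, hS0, hS9, hg, hgeq⟩ := h
  set δ := 2 * (x + r) * e + S * e ^ 2 with hδ
  have hhalf : |δ| ≤ 1 / 2 := hd.trans (by nlinarith)
  obtain ⟨h1, h2, h3, h4⟩ := inv_sqrt_expansion hg hgeq hhalf
  refine ⟨h1.trans hd, ?_, h3, h4⟩
  have e1 : g - (1 - x * e - e ^ 2 / 2) = (g - (1 - δ / 2)) + (-(r * e) - (S - 1) * e ^ 2 / 2) := by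
    rw [hδ]; ring
  have hδ2 : δ ^ 2 ≤ 32 * (L * e ^ 2) + 162 * e ^ 4 := by
    have hL2 : L ^ 2 ≤ L := by nlinarith
    calc δ ^ 2 = |δ| ^ 2 := (sq_abs δ).symm
      _ ≤ (4 * L * e + 9 * e ^ 2) ^ 2 := by gcongr
      _ ≤ 2 * (16 * (L ^ 2 * e ^ 2)) + 162 * e ^ 4 := by
          nlinarith [sq_nonneg (4 * L * e - 9 * e ^ 2)]
      _ ≤ _ := by nlinarith [mul_le_mul_of_nonneg_right hL2 (sq_nonneg e)]
  have e2 : |-(r * e) - (S - 1) * e ^ 2 / 2| ≤ Λ * L * e ^ 2 + (5 * Λ * L + Λ ^ 2 * e ^ 2) * e ^ 2 / 2 := by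
    refine (abs_sub _ _).trans ?_
    rw [abs_neg, abs_mul, abs_of_pos he, abs_div, abs_mul, abs_two, abs_of_nonneg (sq_nonneg e)]
    have := mul_le_mul_of_nonneg_right hr he.le
    have := mul_le_mul_of_nonneg_right hS (sq_nonneg e)
    linarith
  rw [e1]
  refine (_root_.abs_add_le _ _).trans ((add_le_add (h2.trans hδ2) e2).trans ?_)
  have hΛ2 : Λ ≤ Λ ^ 2 := by nlinarith
  have hΛ1 : 1 ≤ Λ ^ 2 := hΛ.trans hΛ2
  have p1 : 0 ≤ L * e ^ 2 := by positivity
  have p2 : 0 ≤ e ^ 4 := by positivity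
  nlinarith [mul_le_mul_of_nonneg_right hΛ2 p1, mul_le_mul_of_nonneg_right hΛ1 p1,
    mul_le_mul_of_nonneg_right hΛ1 p2]

/-- Only the error of `g` itself produces `e⁴`, and it comes multiplied by `A₀`; this factor is kept
there and bounded by `1` in front of `L e²`. -/
theorem vector_expansion (h : SmallPerturbation e L Λ x r S g) {A₀ A₁ A₂ : ℝ} (h0 : |A₀| ≤ 1)
    (h1 : |A₁| ≤ L) (h2 : |A₂| ≤ Λ * L * e) :
    |g * (A₀ + (A₁ + A₂) * e) - ((1 - e ^ 2 / 2) * A₀ + (A₁ - A₀ * x) * e)| ≤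
      300 * Λ ^ 2 * (L * e ^ 2 + |A₀| * e ^ 4) := by
  obtain ⟨g1, g2, -, g4⟩ := h.expansion
  have he16 := h.e_le_one
  obtain ⟨he, hL, hL1, hΛ, heΛ, hx, hr, hS, hS0, hS9, hg, hgeq⟩ := h
  have e1 : g * (A₀ + (A₁ + A₂) * e) - ((1 - e ^ 2 / 2) * A₀ + (A₁ - A₀ * x) * e) =
      A₀ * (g - (1 - x * e - e ^ 2 / 2)) + (g - 1) * A₁ * e + g * A₂ * e := by ring
  rw [e1]
  have b1 : |A₀ * (g - (1 - x * e - e ^ 2 / 2))| ≤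
      |A₀| * (200 * Λ ^ 2 * (L * e ^ 2 + e ^ 4)) := by
    rw [abs_mul]; gcongr
  have g1' : |g - 1| ≤ 13 * e := g1.trans (by nlinarith)
  have b2 : |(g - 1) * A₁ * e| ≤ 13 * e * L * e := by
    rw [abs_mul, abs_mul, abs_of_pos he]; gcongr
  have b3 : |g * A₂ * e| ≤ 2 * (Λ * L * e) * e := by
    rw [abs_mul, abs_mul, abs_of_pos he, abs_of_pos hg]; gcongr
  refine (_root_.abs_add_le _ _).trans
    ((add_le_add ((_root_.abs_add_le _ _).trans (add_le_add b1 b2)) b3).trans ?_)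
  have hΛ2 : Λ ≤ Λ ^ 2 := by nlinarith
  have hΛ1 : 1 ≤ Λ ^ 2 := hΛ.trans hΛ2
  have p1 : 0 ≤ L * e ^ 2 := by positivity
  have p2 : 0 ≤ |A₀| * e ^ 4 := by positivity
  have p3 : 0 ≤ Λ ^ 2 * (L * e ^ 2) := by positivity
  nlinarith [mul_le_mul_of_nonneg_right hΛ2 p1, mul_le_mul_of_nonneg_right hΛ1 p1,
    mul_le_mul_of_nonneg_right hΛ1 p2, mul_le_mul_of_nonneg_right h0 p3]

end SmallPerturbation

theorem one_sub_pow_bounds {s : ℝ} (hs : 0 ≤ s) (hs1 : s ≤ 1) (k : ℕ) :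
    1 - k * s ≤ (1 - s) ^ k ∧ (1 - s) ^ k ≤ 1 - k * s + k ^ 2 * s ^ 2 ∧ (1 - s) ^ k ≤ 1 := by
  have h1 : 1 - k * s ≤ (1 - s) ^ k := by
    have := one_add_mul_le_pow (a := -s) (by linarith) k
    rw [← sub_eq_add_neg] at this
    linarith
  refine ⟨h1, ?_, pow_le_one₀ (by linarith) (by linarith)⟩
  induction k with
  | zero => simp
  | succ k ih =>
    have h2 := ih (by
      have := one_add_mul_le_pow (a := -s) (by linarith) k
      rw [← sub_eq_add_neg] at this
      linarith)
    rw [pow_succ]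
    have h3 := mul_le_mul_of_nonneg_right h2 (show 0 ≤ 1 - s by linarith)
    push_cast
    have hk : (0 : ℝ) ≤ k := Nat.cast_nonneg k
    nlinarith [mul_nonneg hk (mul_nonneg hs (sq_nonneg s)), mul_nonneg hk (sq_nonneg s),
      mul_nonneg (mul_nonneg hk hk) (mul_nonneg hs (sq_nonneg s)), sq_nonneg s]

namespace SmallPerturbation

variable {e L Λ x r S g : ℝ}

/-- For `α = ⟨z,u⟩` this is the squared length of the part of `u` orthogonal to `z`; to leading
order it is `e²`. -/
theorem one_sub_sq (h : SmallPerturbation e L Λ x r S g) :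
    1 - (g * (1 + (x + r) * e)) ^ 2 = g ^ 2 * (S - (x + r) ^ 2) * e ^ 2 := by
  linear_combination -h.g_eq

theorem one_sub_sq_bounds (h : SmallPerturbation e L Λ x r S g) :
    |1 - (g * (1 + (x + r) * e)) ^ 2 - e ^ 2| ≤ 250 * Λ ^ 2 * (L * e ^ 2 + e ^ 4) ∧
      1 - (g * (1 + (x + r) * e)) ^ 2 ≤ 26 * e ^ 2 := by
  rw [h.one_sub_sq]
  obtain ⟨g1, g2, g3, g4⟩ := h.expansion
  have hd := h.abs_delta_le
  have he16 := h.e_le_one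
  have hs := h.abs_add_le
  obtain ⟨he, hL, hL1, hΛ, heΛ, hx, hr, hS, hS0, hS9, hg, hgeq⟩ := h
  have hL2 : L ^ 2 ≤ L := by nlinarith
  have hs2 : (x + r) ^ 2 ≤ 4 * L := by
    rw [← sq_abs]
    nlinarith [abs_nonneg (x + r)]
  have hT : |S - (x + r) ^ 2| ≤ 13 := by
    rw [abs_le]; constructor <;> nlinarith [sq_nonneg (x + r)]
  constructor
  · have e1 : g ^ 2 * (S - (x + r) ^ 2) * e ^ 2 - e ^ 2 =
        ((-(2 * (x + r) * e + S * e ^ 2) * g ^ 2) * (S - (x + r) ^ 2) + (S - 1) - (x + r) ^ 2) * e ^ 2 := by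
      linear_combination (S - (x + r) ^ 2) * e ^ 2 * hgeq
    rw [e1, abs_mul, abs_of_nonneg (sq_nonneg e)]
    have b1 : |(-(2 * (x + r) * e + S * e ^ 2) * g ^ 2) * (S - (x + r) ^ 2)| ≤
        (4 * L * e + 9 * e ^ 2) * 2 * 13 := by
      rw [abs_mul, abs_mul, abs_neg, abs_of_nonneg (sq_nonneg g)]
      gcongr
    have b2 : |(-(2 * (x + r) * e + S * e ^ 2) * g ^ 2) * (S - (x + r) ^ 2) + (S - 1) - (x + r) ^ 2| ≤
        (4 * L * e + 9 * e ^ 2) * 2 * 13 + (5 * Λ * L + Λ ^ 2 * e ^ 2) + 4 * L := by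
      refine (abs_sub _ _).trans (add_le_add ((_root_.abs_add_le _ _).trans (add_le_add b1 hS)) ?_)
      rwa [abs_of_nonneg (sq_nonneg _)]
    have hΛ2 : Λ ≤ Λ ^ 2 := by nlinarith
    have hΛ1 : 1 ≤ Λ ^ 2 := hΛ.trans hΛ2
    have p2 : 0 ≤ e ^ 2 := by positivity
    have hLe : L * e ≤ L / 16 := by nlinarith
    calc _ ≤ ((4 * L * e + 9 * e ^ 2) * 2 * 13 + (5 * Λ * L + Λ ^ 2 * e ^ 2) + 4 * L) * e ^ 2 := by
          gcongr
      _ ≤ (250 * Λ ^ 2 * (L + e ^ 2)) * e ^ 2 := by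
          gcongr
          have m1 := mul_le_mul_of_nonneg_right hΛ2 hL
          have m2 := mul_le_mul_of_nonneg_right hΛ1 hL
          have m3 := mul_le_mul_of_nonneg_right hΛ1 p2
          linarith
      _ = _ := by ring
  · gcongr
    calc g ^ 2 * (S - (x + r) ^ 2) ≤ g ^ 2 * 13 := by
          gcongr; exact (le_abs_self _).trans hT
      _ ≤ 26 := by linarith

theorem pow_expansion (h : SmallPerturbation e L Λ x r S g) {k : ℕ} (hk : 1 ≤ k) {α : ℝ}
    (hα : α = g * (1 + (x + r) * e)) (hα1 : α ≤ 1) :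
    |α ^ k - (1 - k * e ^ 2 / 2)| ≤ 1500 * k ^ 2 * Λ ^ 2 * (L * e ^ 2 + e ^ 4) ∧
      |α ^ (k - 1) - 1| ≤ k * (26 * e ^ 2) := by
  obtain ⟨y1, y2⟩ := h.one_sub_sq_bounds
  have he16 := h.e_le_one
  have hs := h.abs_add_le
  obtain ⟨he, hL, hL1, hΛ, -, -, -, -, -, -, hg, -⟩ := h
  rw [← hα] at y1 y2
  have hk' : (1 : ℝ) ≤ k := by exact_mod_cast hk
  have hα0 : 0 ≤ α := by
    rw [hα]
    have := (abs_le.1 hs).1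
    have : 0 ≤ 1 + (x + r) * e := by nlinarith
    positivity
  have hΛ1 : 1 ≤ Λ ^ 2 := one_le_pow₀ hΛ
  -- The information is on `1 - α² = s (2 - s)`, so `s = e²/2` up to the error and `s²`; powers of
  -- `1 - s` then follow from Bernoulli's inequality and its second-order converse.
  obtain ⟨s, hs⟩ : ∃ s, α = 1 - s := ⟨1 - α, by ring⟩
  have hs0 : 0 ≤ s := by linarith
  have hs1 : s ≤ 1 := by linarith
  have hys : 1 - α ^ 2 = s * (2 - s) := by rw [hs]; ring
  rw [hys] at y1 y2
  have hsy : s ≤ 26 * e ^ 2 := by nlinarith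
  have hs2 : s ^ 2 ≤ 676 * e ^ 4 := by
    calc s ^ 2 ≤ (26 * e ^ 2) ^ 2 := by gcongr
      _ = _ := by ring
  obtain ⟨p1, p2, -⟩ := one_sub_pow_bounds hs0 hs1 k
  obtain ⟨q1, -, q3⟩ := one_sub_pow_bounds hs0 hs1 (k - 1)
  rw [← hs] at p1 p2 q1 q3
  constructor
  · have d2 : |α ^ k - (1 - k * s)| ≤ k ^ 2 * s ^ 2 := by
      have : 0 ≤ (k : ℝ) ^ 2 * s ^ 2 := by positivity
      rw [abs_le]; constructor <;> linarith
    have d3 : |k * (e ^ 2 / 2 - s)| ≤ k * (125 * Λ ^ 2 * (L * e ^ 2 + e ^ 4) + s ^ 2 / 2) := by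
      rw [abs_mul, abs_of_nonneg (by positivity : (0 : ℝ) ≤ k)]
      refine mul_le_mul_of_nonneg_left ?_ (by positivity)
      have y3 := abs_le.1 y1
      have := sq_nonneg s
      rw [abs_le]; constructor <;> linarith
    have d4 : α ^ k - (1 - k * e ^ 2 / 2) = (α ^ k - (1 - k * s)) + k * (e ^ 2 / 2 - s) := by ring
    rw [d4]
    refine (_root_.abs_add_le _ _).trans ((add_le_add d2 d3).trans ?_)
    have hkk : (k : ℝ) ≤ k ^ 2 := by nlinarith
    have P : 0 ≤ L * e ^ 2 + e ^ 4 := by positivity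
    calc k ^ 2 * s ^ 2 + k * (125 * Λ ^ 2 * (L * e ^ 2 + e ^ 4) + s ^ 2 / 2)
        ≤ k ^ 2 * s ^ 2 + k ^ 2 * (125 * Λ ^ 2 * (L * e ^ 2 + e ^ 4) + s ^ 2 / 2) := by gcongr
      _ = k ^ 2 * (3 / 2 * s ^ 2 + 125 * Λ ^ 2 * (L * e ^ 2 + e ^ 4)) := by ring
      _ ≤ k ^ 2 * (1500 * Λ ^ 2 * (L * e ^ 2 + e ^ 4)) := by
          refine mul_le_mul_of_nonneg_left ?_ (by positivity)
          have : e ^ 4 ≤ Λ ^ 2 * e ^ 4 := le_mul_of_one_le_left (by positivity) hΛ1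
          have : 0 ≤ Λ ^ 2 * (L * e ^ 2) := by positivity
          have : 0 ≤ e ^ 4 := by positivity
          linarith
      _ = _ := by ring
  · have hkc : ((k - 1 : ℕ) : ℝ) ≤ k := by exact_mod_cast Nat.sub_le k 1
    rw [abs_sub_comm, abs_of_nonneg (by linarith)]
    calc 1 - α ^ (k - 1) ≤ ((k - 1 : ℕ) : ℝ) * s := by linarith
      _ ≤ k * (26 * e ^ 2) := by gcongr

/-- The estimator is itself tilted by `ξ / B`, and `‖ξ‖² ≈ 1`; thus `⟨u,ξ⟩` exceeds `⟨z,ξ⟩` by about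
`1/B`. -/
theorem inner_expansion (h : SmallPerturbation e L Λ x r S g) {Ξ R : ℝ} (hΞ : |Ξ - 1| ≤ 3 * L)
    (hR : |R| ≤ Λ * L * e) :
    |g * (x + (Ξ + R) * e) - (x + e)| ≤ 45 * (Λ ^ 2 * (L * e + e ^ 3)) ∧
      |g * (x + (Ξ + R) * e)| ≤ 2 * (L + 5 * e) := by
  obtain ⟨g1, -, -, g4⟩ := h.expansion
  have he16 := h.e_le_one
  obtain ⟨he, hL, hL1, hΛ, heΛ, hx, -, -, -, -, hg, -⟩ := h
  have hΛ1 : 1 ≤ Λ ^ 2 := one_le_pow₀ hΛ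
  have hΞR : |Ξ + R| ≤ 5 := by
    have h3 : |R| ≤ 1 := hR.trans (by nlinarith)
    have := abs_le.1 h3
    have := abs_le.1 hΞ
    rw [abs_le]; constructor <;> linarith
  constructor
  · have d1 : g * (x + (Ξ + R) * e) - (x + e) =
        (g - 1) * x + (g - 1) * (Ξ + R) * e + ((Ξ - 1) + R) * e := by ring
    have hLe : L * e ≤ 1 * e := by gcongr
    have d2 : |(g - 1) * x| ≤ 13 * e * L := by
      rw [abs_mul]
      have : |g - 1| ≤ 13 * e := g1.trans (by nlinarith)
      gcongr
    have d3 : |(g - 1) * (Ξ + R) * e| ≤ (4 * L * e + 9 * e ^ 2) * 5 * e := by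
      rw [abs_mul, abs_mul, abs_of_pos he]; gcongr
    have d4 : |((Ξ - 1) + R) * e| ≤ (3 * L + Λ * L * e) * e := by
      rw [abs_mul, abs_of_pos he]
      have := (_root_.abs_add_le (Ξ - 1) R).trans (add_le_add hΞ hR)
      gcongr
    rw [d1]
    refine (_root_.abs_add_le _ _).trans ((add_le_add ((_root_.abs_add_le _ _).trans
      (add_le_add d2 d3)) d4).trans ?_)
    have hP : 0 ≤ L * e + e ^ 3 := by positivity
    have m1 := mul_le_mul_of_nonneg_right hΛ1 hP
    have m2 : (16 * Λ * e) * (L * e) ≤ 1 * (L * e) := by gcongr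
    have m3 : (L * e) * e ≤ (L * e) * (1 / 16) := by gcongr
    have m4 : 0 ≤ e ^ 3 := by positivity
    have m5 : 0 ≤ L * e := by positivity
    linarith
  · rw [abs_mul, abs_of_pos hg]
    have : |x + (Ξ + R) * e| ≤ L + 5 * e := by
      refine (_root_.abs_add_le _ _).trans (add_le_add hx ?_)
      rw [abs_mul, abs_of_pos he]; gcongr
    gcongr

/-- The signal contributes `B α^k ≈ B - k e / 2` because `B e² = e`, and the noise contributes `x +
e`; together they give the bias `-(k/2 - 1) e`. -/
theorem size_expansion (h : SmallPerturbation e L Λ x r S g) {B : ℝ} (hB : B * e = 1)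
    {k : ℕ} (hk : 1 ≤ k) {α : ℝ} (hα : α = g * (1 + (x + r) * e)) (hα1 : α ≤ 1)
    {Ξ R w₀ w₁ w₂ : ℝ} (hΞ : |Ξ - 1| ≤ 3 * L) (hR : |R| ≤ Λ * L * e) (h0 : |w₀| ≤ Λ * L * e)
    (h1 : |w₁| ≤ Λ * L * e) (h2 : |w₂| ≤ Λ ^ 2 * e ^ 2) :
    |B * α ^ k + (α ^ (k - 1) * (g * (x + (Ξ + R) * e)) + g * (w₀ + (w₁ + w₂) * e)) -
      (B + x - ((k : ℝ) / 2 - 1) * e)| ≤ 2000 * k ^ 2 * Λ ^ 2 * (L * e + e ^ 3) := by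
  obtain ⟨p1, p2⟩ := h.pow_expansion hk hα hα1
  obtain ⟨u1, u2⟩ := h.inner_expansion hΞ hR
  obtain ⟨-, -, -, g4⟩ := h.expansion
  have he16 := h.e_le_one
  obtain ⟨he, hL, -, hΛ, -, -, -, -, -, -, hg, -⟩ := h
  have hk' : (1 : ℝ) ≤ k := by exact_mod_cast hk
  have hΛ1 : 1 ≤ Λ ^ 2 := one_le_pow₀ hΛ
  have hΛ2 : Λ ≤ Λ ^ 2 := by nlinarith
  have hLe : 0 ≤ L * e := by positivity
  have he3 : 0 ≤ e ^ 3 := by positivity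
  have hP : 0 ≤ L * e + e ^ 3 := by positivity
  have c1 : |B * (α ^ k - (1 - k * e ^ 2 / 2))| ≤ 1500 * k ^ 2 * Λ ^ 2 * (L * e + e ^ 3) := by
    have hBpos : 0 < B := pos_of_mul_pos_left (hB ▸ one_pos) he.le
    rw [abs_mul, abs_of_pos hBpos]
    calc B * |α ^ k - (1 - k * e ^ 2 / 2)| ≤ B * (1500 * k ^ 2 * Λ ^ 2 * (L * e ^ 2 + e ^ 4)) := by
          gcongr
      _ = 1500 * k ^ 2 * Λ ^ 2 * (L * e + e ^ 3) * (B * e) := by ring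
      _ = _ := by rw [hB, mul_one]
  set U := g * (x + (Ξ + R) * e) with hU
  have c3 : |(α ^ (k - 1) - 1) * U| ≤ 260 * (k * (L * e + e ^ 3)) := by
    rw [abs_mul]
    calc _ ≤ k * (26 * e ^ 2) * (2 * (L + 5 * e)) := by gcongr
      _ = k * (52 * (L * e * e) + 260 * e ^ 3) := by ring
      _ ≤ k * (260 * (L * e + e ^ 3)) := by
          refine mul_le_mul_of_nonneg_left ?_ (by positivity)
          have : L * e * e ≤ L * e * 1 := by gcongr; linarith
          linarith
      _ = _ := by ring
  have c4 : |g * (w₀ + (w₁ + w₂) * e)| ≤ 4 * (Λ ^ 2 * (L * e + e ^ 3)) := by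
    rw [abs_mul, abs_of_pos hg]
    have d1 : |w₀ + (w₁ + w₂) * e| ≤ Λ * L * e + (Λ * L * e + Λ ^ 2 * e ^ 2) * e := by
      refine (_root_.abs_add_le _ _).trans (add_le_add h0 ?_)
      rw [abs_mul, abs_of_pos he]
      have := (_root_.abs_add_le w₁ w₂).trans (add_le_add h1 h2)
      gcongr
    calc g * |w₀ + (w₁ + w₂) * e| ≤ 2 * (Λ * L * e + (Λ * L * e + Λ ^ 2 * e ^ 2) * e) := by gcongr
      _ = 2 * (Λ * (L * e) + Λ * (L * e) * e + Λ ^ 2 * e ^ 3) := by ring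
      _ ≤ 2 * (Λ ^ 2 * (L * e) + Λ ^ 2 * (L * e) * 1 + Λ ^ 2 * e ^ 3) := by
          gcongr
          linarith
      _ ≤ _ := by linarith [mul_nonneg (sq_nonneg Λ) he3]
  have split : B * α ^ k + (α ^ (k - 1) * U + g * (w₀ + (w₁ + w₂) * e)) -
      (B + x - ((k : ℝ) / 2 - 1) * e) = B * (α ^ k - (1 - k * e ^ 2 / 2)) + (U - (x + e)) +
        (α ^ (k - 1) - 1) * U + g * (w₀ + (w₁ + w₂) * e) := by
    linear_combination (-(k : ℝ) * e / 2) * hB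
  rw [split]
  refine (_root_.abs_add_le _ _).trans ((add_le_add ((_root_.abs_add_le _ _).trans
    (add_le_add ((_root_.abs_add_le _ _).trans (add_le_add c1 u1)) c3)) c4).trans ?_)
  have hkk : (1 : ℝ) ≤ k ^ 2 := one_le_pow₀ hk'
  have hkk' : (k : ℝ) ≤ k ^ 2 := by nlinarith
  have Q : 0 ≤ Λ ^ 2 * (L * e + e ^ 3) := by positivity
  have f1 := mul_le_mul_of_nonneg_right hkk Q
  have f2 : k * (L * e + e ^ 3) ≤ k ^ 2 * (Λ ^ 2 * (L * e + e ^ 3)) := by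
    gcongr
    exact le_mul_of_one_le_left hP hΛ1
  linarith

end SmallPerturbation

end RealExpansion

/-! ### Normalized perturbations of a multiple of a unit vector. -/

section NormalizedPerturbation

variable {V : Type*} [NormedAddCommGroup V] [InnerProductSpace ℝ V]

/-- For `p ≠ 0` and its normalization `p̂`, one has `M (p̂ - z) = (M - ‖p‖) p̂ + (p - M z)`, and
each term has norm at most `‖p - M z‖`. -/
theorem norm_normalize_sub_le {z p : V} (hz : ‖z‖ = 1) {M : ℝ} (hM : 0 < M) :
    ‖‖p‖⁻¹ • p - z‖ ≤ 2 * ‖p - M • z‖ / M := by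
  rw [le_div_iff₀ hM]
  have hMz : ‖M • z‖ = M := by rw [norm_smul, hz, mul_one, norm_of_nonneg hM.le]
  by_cases hp : p = 0
  · subst hp
    simp only [smul_zero, zero_sub, norm_neg, hz, hMz]
    linarith
  have hp' : ‖p‖ ≠ 0 := norm_ne_zero_iff.2 hp
  have h1 : M • (‖p‖⁻¹ • p - z) = (M - ‖p‖) • (‖p‖⁻¹ • p) + (p - M • z) := by
    rw [smul_sub, sub_smul, smul_smul ‖p‖, mul_inv_cancel₀ hp', one_smul]
    abel
  have h2 : ‖‖p‖⁻¹ • p‖ = 1 := by rw [norm_smul, norm_inv, norm_norm, inv_mul_cancel₀ hp']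
  have h3 : |M - ‖p‖| ≤ ‖p - M • z‖ := by
    rw [← hMz, hMz, norm_sub_rev]
    have := abs_norm_sub_norm_le (M • z) p
    rwa [hMz] at this
  calc ‖‖p‖⁻¹ • p - z‖ * M = ‖M • (‖p‖⁻¹ • p - z)‖ := by
        rw [norm_smul, norm_of_nonneg hM.le, mul_comm]
    _ ≤ |M - ‖p‖| * 1 + ‖p - M • z‖ := by
        rw [h1]
        refine (norm_add_le _ _).trans ?_
        rw [norm_smul, h2, norm_eq_abs]
    _ ≤ _ := by linarith

theorem norm_normalize {p : V} (hp : p ≠ 0) : ‖‖p‖⁻¹ • p‖ = 1 := by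
  rw [norm_smul, norm_inv, norm_norm, inv_mul_cancel₀ (norm_ne_zero_iff.2 hp)]

theorem normalize_smul {c : ℝ} (hc : 0 < c) (p : V) : ‖c • p‖⁻¹ • c • p = ‖p‖⁻¹ • p := by
  rw [norm_smul, smul_smul, norm_of_nonneg hc.le, mul_inv]
  congr 1
  field_simp

theorem norm_normalize_sub_normalize_le {p q : V} (hp : p ≠ 0) :
    ‖‖q‖⁻¹ • q - ‖p‖⁻¹ • p‖ ≤ 2 * ‖q - p‖ / ‖p‖ := by
  have h := norm_normalize_sub_le (p := q) (norm_normalize hp) (norm_pos_iff.2 hp)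
  rwa [smul_smul, mul_inv_cancel₀ (norm_ne_zero_iff.2 hp), one_smul] at h

/-- The alignment of a normalized perturbation of `M • z` with `z`. -/
theorem inner_normalize_ge {z ζ : V} (hz : ‖z‖ = 1) {M K : ℝ} (hM : 0 < M) (hK : 0 < K)
    (hζ : ‖ζ‖ ≤ K) (hzζ : |inner ℝ z ζ| ≤ M / 2) :
    M • z + ζ ≠ 0 ∧ min (1 / 2) (M / (4 * K)) ≤
      inner ℝ z (‖M • z + ζ‖⁻¹ • (M • z + ζ)) := by
  set m := M + inner ℝ z ζ with hm
  have hm2 : M / 2 ≤ m := by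
    have := (abs_le.1 hzζ).1
    linarith
  have hmpos : 0 < m := by linarith
  have hin : inner ℝ z (M • z + ζ) = m := by
    rw [inner_add_right, inner_smul_right, real_inner_self_eq_norm_sq, hz]; simp [hm]
  have hne : M • z + ζ ≠ 0 := by
    intro h
    rw [h, inner_zero_right] at hin
    linarith
  refine ⟨hne, ?_⟩
  have hperp : ‖ζ - (inner ℝ z ζ : ℝ) • z‖ ≤ K := by
    refine le_trans ?_ hζ
    have h1 : ‖ζ - (inner ℝ z ζ : ℝ) • z‖ ^ 2 ≤ ‖ζ‖ ^ 2 := by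
      rw [norm_sub_sq_real, inner_smul_right, norm_smul, hz, real_inner_comm z ζ, norm_eq_abs, mul_one,
        sq_abs]
      nlinarith [sq_nonneg (inner ℝ z ζ : ℝ)]
    exact (sq_le_sq₀ (norm_nonneg _) (norm_nonneg _)).1 h1
  have hnorm : ‖M • z + ζ‖ ≤ m + K := by
    have h2 : M • z + ζ = m • z + (ζ - (inner ℝ z ζ : ℝ) • z) := by
      rw [hm, add_smul]; abel
    rw [h2]
    refine (norm_add_le _ _).trans (add_le_add ?_ hperp)
    rw [norm_smul, hz, mul_one, norm_of_nonneg hmpos.le]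
  have hpos : 0 < ‖M • z + ζ‖ := norm_pos_iff.2 hne
  rw [inner_smul_right, hin, inv_mul_eq_div, le_div_iff₀ hpos]
  have hmin : 0 ≤ min (1 / 2) (M / (4 * K)) := by positivity
  refine (mul_le_mul_of_nonneg_left hnorm hmin).trans ?_
  -- Either the component along `z` beats the noise and the overlap is at least `1/2`, or the norm
  -- is at most `2K` and the overlap is at least `M / (4K)`.
  rcases le_total K m with h | h
  · calc min (1 / 2) (M / (4 * K)) * (m + K) ≤ 1 / 2 * (m + K) := by gcongr; exact min_le_left _ _
      _ ≤ m := by linarith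
  · calc min (1 / 2) (M / (4 * K)) * (m + K) ≤ M / (4 * K) * (m + K) := by
          gcongr; exact min_le_right _ _
      _ ≤ M / (4 * K) * (2 * K) := by gcongr; linarith
      _ = M / 2 := by field_simp; norm_num
      _ ≤ m := hm2

variable {z ξ ρ : V} {B L Λ : ℝ}

/-- A small perturbation `B z + ξ + ρ` of a multiple of a unit vector. -/
structure SignalPlusNoise (z ξ ρ : V) (B L Λ : ℝ) : Prop where
  norm_z : ‖z‖ = 1
  B_pos : 0 < B
  L_nonneg : 0 ≤ L
  L_le : L ≤ 1
  one_le : 1 ≤ Λ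
  B_ge : 16 * Λ ≤ B
  inner_ξ : |inner ℝ z ξ| ≤ L
  norm_ξ : |‖ξ‖ ^ 2 - 1| ≤ 3 * L
  inner_ρ : |inner ℝ z ρ| ≤ Λ * L / B
  inner_ξρ : |inner ℝ ξ ρ| ≤ Λ * L / B
  norm_ρ : ‖ρ‖ ≤ Λ / B

namespace SignalPlusNoise

/-- The vector does not vanish since `B ≥ 16` while `‖ξ + ρ‖ ≤ 3`; expanding its squared norm gives
the equation for `g`. -/
theorem smallPerturbation (h : SignalPlusNoise z ξ ρ B L Λ) :
    B • z + (ξ + ρ) ≠ 0 ∧ SmallPerturbation B⁻¹ L Λ (inner ℝ z ξ) (inner ℝ z ρ) (‖ξ + ρ‖ ^ 2)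
      (B / ‖B • z + (ξ + ρ)‖) := by
  obtain ⟨hz, hB, hL, hL1, hΛ, hBΛ, hx, hξ, hr, hR, hρ⟩ := h
  rw [div_eq_mul_inv] at hr hR hρ
  have he : 0 < B⁻¹ := inv_pos.2 hB
  have heΛ : 16 * Λ * B⁻¹ ≤ 1 := by
    rw [← div_eq_mul_inv, div_le_one hB]; exact hBΛ
  have hΛe : Λ * B⁻¹ ≤ 1 / 16 := by linarith
  have he16 : B⁻¹ ≤ 1 / 16 := by nlinarith
  have hS : ‖ξ + ρ‖ ^ 2 = ‖ξ‖ ^ 2 + 2 * inner ℝ ξ ρ + ‖ρ‖ ^ 2 := norm_add_sq_real ξ ρ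
  have hρ2 : ‖ρ‖ ^ 2 ≤ Λ ^ 2 * B⁻¹ ^ 2 := by
    rw [← mul_pow]; gcongr
  have hρ3 : ‖ρ‖ ^ 2 ≤ 1 := by
    have : ‖ρ‖ ≤ 1 := by linarith
    nlinarith [norm_nonneg ρ]
  have hΛL : Λ * L * B⁻¹ ≤ 1 / 16 := by nlinarith
  have hS9 : ‖ξ + ρ‖ ^ 2 ≤ 9 := by
    have := abs_le.1 hξ
    have := abs_le.1 hR
    linarith
  have hS3 : ‖ξ + ρ‖ ≤ 3 := by nlinarith [norm_nonneg (ξ + ρ)]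
  have hne : B • z + (ξ + ρ) ≠ 0 := by
    intro h0
    have h1 : B • z = -(ξ + ρ) := eq_neg_of_add_eq_zero_left h0
    have h2 : B = ‖ξ + ρ‖ := by
      rw [← norm_neg, ← h1, norm_smul, hz, mul_one, norm_of_nonneg hB.le]
    linarith
  have hpos : 0 < ‖B • z + (ξ + ρ)‖ := norm_pos_iff.2 hne
  refine ⟨hne, he, hL, hL1, hΛ, heΛ, hx, hr, ?_, sq_nonneg _, hS9, div_pos hB hpos, ?_⟩
  · rw [hS]
    have h1 := abs_le.1 hξ
    have h2 := abs_le.1 hR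
    have h3 := sq_nonneg ‖ρ‖
    have h4 : L ≤ Λ * L := le_mul_of_one_le_left hL hΛ
    have h5 : Λ * L * B⁻¹ ≤ Λ * L * 1 := by gcongr; linarith
    rw [abs_le]
    constructor <;> linarith
  · have h1 : ‖B • z + (ξ + ρ)‖ ^ 2 =
        B ^ 2 + 2 * B * (inner ℝ z ξ + inner ℝ z ρ) + ‖ξ + ρ‖ ^ 2 := by
      rw [norm_add_sq_real, norm_smul, hz, mul_one, norm_of_nonneg hB.le, real_inner_smul_left,
        inner_add_right]
      ring
    rw [div_pow, h1]
    rw [← h1, div_mul_eq_mul_div, div_eq_one_iff_eq (by positivity), h1]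
    field_simp
    ring

theorem inner_normalize (hB : 0 < B) (a : V) :
    inner ℝ a (‖B • z + (ξ + ρ)‖⁻¹ • (B • z + (ξ + ρ))) =
      B / ‖B • z + (ξ + ρ)‖ * (inner ℝ a z + (inner ℝ a ξ + inner ℝ a ρ) * B⁻¹) := by
  rw [inner_smul_right, inner_add_right, inner_smul_right, inner_add_right]
  field_simp

theorem vector_expansion (h : SignalPlusNoise z ξ ρ B L Λ) {a : V} (ha : ‖a‖ = 1)
    (h1 : |inner ℝ a ξ| ≤ L) (h2 : |inner ℝ a ρ| ≤ Λ * L / B) :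
    |inner ℝ a (‖B • z + (ξ + ρ)‖⁻¹ • (B • z + (ξ + ρ))) -
      ((1 - 1 / (2 * B ^ 2)) * inner ℝ a z + (inner ℝ a ξ - inner ℝ a z * inner ℝ z ξ) / B)| ≤
      300 * Λ ^ 2 * (L / B ^ 2 + |inner ℝ a z| / B ^ 4) := by
  have h0 : |inner ℝ a z| ≤ 1 := by
    have := abs_real_inner_le_norm a z
    rwa [ha, h.norm_z, one_mul] at this
  rw [div_eq_mul_inv] at h2
  have := h.smallPerturbation.2.vector_expansion h0 h1 h2
  rw [inner_normalize h.B_pos]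
  convert this using 2
  · congr 2
    · simp only [one_div, mul_inv, inv_pow]; ring
  · simp only [inv_pow]; ring

/-- Two remainders occur: `ρ` in the step that produced `u`, and `ρ'` in the noise evaluated at `u`.
-/
theorem size_expansion (h : SignalPlusNoise z ξ ρ B L Λ) {k : ℕ} (hk : 1 ≤ k) {ρ' : V}
    (h0 : |inner ℝ z ρ'| ≤ Λ * L / B) (h1 : |inner ℝ ξ ρ'| ≤ Λ * L / B) (h2 : ‖ρ'‖ ≤ Λ / B)
    {u : V} (hu : u = ‖B • z + (ξ + ρ)‖⁻¹ • (B • z + (ξ + ρ))) :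
    |B * inner ℝ z u ^ k + inner ℝ u ((inner ℝ z u : ℝ) ^ (k - 1) • ξ + ρ') -
      (B + inner ℝ z ξ - ((k : ℝ) / 2 - 1) / B)| ≤
      2000 * k ^ 2 * Λ ^ 2 * (L / B + 1 / B ^ 3) := by
  obtain ⟨hne, hs⟩ := h.smallPerturbation
  have hB := h.B_pos
  have hzu : inner ℝ z u =
      B / ‖B • z + (ξ + ρ)‖ * (1 + (inner ℝ z ξ + inner ℝ z ρ) * B⁻¹) := by
    rw [hu, inner_normalize hB, real_inner_self_eq_norm_sq, h.norm_z, one_pow]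
  have hα1 : inner ℝ z u ≤ (1 : ℝ) := by
    have h3 := real_inner_le_norm z u
    rwa [hu, h.norm_z, norm_normalize hne, one_mul, ← hu] at h3
  have hξu : inner ℝ u ξ =
      B / ‖B • z + (ξ + ρ)‖ * (inner ℝ z ξ + (‖ξ‖ ^ 2 + inner ℝ ξ ρ) * B⁻¹) := by
    rw [real_inner_comm, hu, inner_normalize hB, real_inner_self_eq_norm_sq, real_inner_comm z ξ]
  have hρu : inner ℝ u ρ' =
      B / ‖B • z + (ξ + ρ)‖ * (inner ℝ z ρ' + (inner ℝ ξ ρ' + inner ℝ ρ ρ') * B⁻¹) := by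
    rw [real_inner_comm, hu, inner_normalize hB, real_inner_comm z ρ', real_inner_comm ξ ρ',
      real_inner_comm ρ ρ']
  have h4 : |inner ℝ ρ ρ'| ≤ Λ ^ 2 * B⁻¹ ^ 2 := by
    refine (abs_real_inner_le_norm _ _).trans ?_
    calc ‖ρ‖ * ‖ρ'‖ ≤ (Λ / B) * (Λ / B) := by
          gcongr
          · exact (norm_nonneg ρ).trans h.norm_ρ
          · exact h.norm_ρ
      _ = _ := by rw [div_eq_mul_inv]; ring
  have hR := h.inner_ξρ
  rw [div_eq_mul_inv] at h0 h1 hR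
  have key := hs.size_expansion (mul_inv_cancel₀ hB.ne') hk hzu hα1 h.norm_ξ hR h0 h1 h4
  rw [inner_add_right, inner_smul_right, hξu, hρu]
  convert key using 2
  · rw [div_eq_mul_inv ((k : ℝ) / 2 - 1)]
  · rw [div_eq_mul_inv, one_div, inv_pow]

end SignalPlusNoise

end NormalizedPerturbation

/-! ### Deterministic dynamics: growth, alignment, contraction, expansions. -/

section SignedDynamics

variable {V : Type*} [NormedAddCommGroup V] [InnerProductSpace ℝ V]

/-- Normalized iteration `u_{t+1} ∝ B ⟨z_t, u_t⟩ ^ d z_{t+1} + ζ(u_t)` with a bounded noise `ζ`,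
homogeneous of degree `d`. -/
structure SignedDynamics (ζ : V → V) (B K K₁ : ℝ) (d : ℕ) (z u : ℕ → V) : Prop where
  B_pos : 0 < B
  K_pos : 0 < K
  K₁_nonneg : 0 ≤ K₁
  norm_z : ∀ t, ‖z t‖ = 1
  norm_zero : ‖u 0‖ = 1
  succ : ∀ t, u (t + 1) = ‖(B * (inner ℝ (z t) (u t) : ℝ) ^ d) • z (t + 1) + ζ (u t)‖⁻¹ •
    ((B * (inner ℝ (z t) (u t) : ℝ) ^ d) • z (t + 1) + ζ (u t))
  norm_noise : ∀ w, ‖w‖ ≤ 1 → ‖ζ w‖ ≤ K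
  lipschitz : ∀ w w', ‖w‖ ≤ 2 → ‖w'‖ ≤ 2 → ‖ζ w - ζ w'‖ ≤ K₁ * ‖w - w'‖
  homogeneous : ∀ (c : ℝ) w, ζ (c • w) = c ^ d • ζ w

namespace SignedDynamics

variable {ζ : V → V} {B K K₁ : ℝ} {d : ℕ} {z u : ℕ → V}

/-- An overlap `b ≥ α` produces a signal `B b^d ≥ G b`, at least twice the noise along the target,
while the total noise has norm at most `K`. So `b` is multiplied by `G / (4K)` unless it reaches
`1/2`; as `α ≤ 1/2`, it never falls below `α`. -/
theorem growth (h : SignedDynamics ζ B K K₁ d z u) (hd : 1 ≤ d) {α G : ℝ} {m : ℕ}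
    (hα : 0 < α) (hα' : α ≤ 1 / 2) (hG : G ≤ B * α ^ (d - 1)) (hGK : 4 * K ≤ G)
    (hnoise : ∀ t < m, ‖u t‖ = 1 → |inner ℝ (z (t + 1)) (ζ (u t))| ≤ G * α / 2)
    (h0 : α ≤ inner ℝ (z 0) (u 0)) {t : ℕ} (ht : t ≤ m) :
    ‖u t‖ = 1 ∧ min (1 / 2) (α * (G / (4 * K)) ^ t) ≤ inner ℝ (z t) (u t) := by
  have hK := h.K_pos
  have hB := h.B_pos
  have hGpos : 0 < G := by linarith
  have hq : 1 ≤ G / (4 * K) := by rw [one_le_div (by positivity)]; exact hGK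
  set q := G / (4 * K) with hqdef
  induction t with
  | zero => exact ⟨h.norm_zero, by simpa using Or.inr h0⟩
  | succ t ih =>
    obtain ⟨hu, hb⟩ := ih (by omega)
    set b : ℝ := inner ℝ (z t) (u t) with hbdef
    have hαb : α ≤ b := by
      refine le_trans (le_min hα' ?_) hb
      exact le_mul_of_one_le_right hα.le (one_le_pow₀ hq)
    have hM : G * b ≤ B * b ^ d := by
      calc G * b ≤ B * b ^ (d - 1) * b := by
            have : 0 ≤ b := hα.le.trans hαb
            gcongr
            exact hG.trans (by gcongr)
        _ = B * b ^ d := by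
            rw [mul_assoc, ← pow_succ, Nat.sub_add_cancel hd]
    have hGα : G * α ≤ G * b := by gcongr
    have hMpos : 0 < B * b ^ d := by
      have : 0 < G * α := by positivity
      linarith
    have hn := hnoise t (by omega) hu
    obtain ⟨hne, hin⟩ := inner_normalize_ge (h.norm_z (t + 1)) hMpos hK (h.norm_noise _ hu.le)
      (hn.trans (by linarith))
    rw [h.succ t]
    refine ⟨norm_normalize hne, le_trans ?_ hin⟩
    have h1 : q * b ≤ B * b ^ d / (4 * K) := by
      rw [hqdef, div_mul_eq_mul_div]; gcongr
    refine le_min (min_le_left _ _) ?_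
    refine le_trans ?_ h1
    have h2 : q * min (1 / 2) (α * q ^ t) ≤ q * b := by gcongr
    refine le_trans ?_ h2
    rw [mul_min_of_nonneg _ _ (by linarith)]
    refine min_le_min (by linarith) (le_of_eq (by ring))

/-- With overlap at least `1/2` the signal is at least `B / 2^d ≥ 4K`. The next iterate is then
within `1/2` of its target, which forces an overlap of at least `1/2` again. -/
theorem step_of_aligned (h : SignedDynamics ζ B K K₁ d z u) (hBK : 4 * K * 2 ^ d ≤ B) {t : ℕ}
    (hu : ‖u t‖ = 1) (hb : 1 / 2 ≤ (inner ℝ (z t) (u t) : ℝ)) :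
    ‖u (t + 1)‖ = 1 ∧ 1 / 2 ≤ (inner ℝ (z (t + 1)) (u (t + 1)) : ℝ) ∧
      ‖u (t + 1) - z (t + 1)‖ ≤ 2 ^ (d + 1) * K / B := by
  have hK := h.K_pos
  have hB := h.B_pos
  set b : ℝ := inner ℝ (z t) (u t) with hbdef
  have hbd : (1 / 2 : ℝ) ^ d ≤ b ^ d := by gcongr
  have hM : B / 2 ^ d ≤ B * b ^ d := by
    rw [div_eq_mul_inv, ← one_div, ← one_div_pow]; gcongr
  have hM4 : 4 * K ≤ B / 2 ^ d := by rwa [le_div_iff₀ (by positivity)]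
  have hMpos : 0 < B * b ^ d := by linarith
  have hζ := h.norm_noise _ hu.le
  have hne : (B * b ^ d) • z (t + 1) + ζ (u t) ≠ 0 := by
    intro h0
    have h1 : ‖(B * b ^ d) • z (t + 1)‖ = ‖ζ (u t)‖ := by
      rw [eq_neg_of_add_eq_zero_left h0, norm_neg]
    rw [norm_smul, h.norm_z, mul_one, norm_of_nonneg hMpos.le] at h1
    linarith
  have hn1 : ‖u (t + 1)‖ = 1 := by rw [h.succ]; exact norm_normalize hne
  have hdist : ‖u (t + 1) - z (t + 1)‖ ≤ 2 ^ (d + 1) * K / B := by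
    rw [h.succ]
    refine (norm_normalize_sub_le (h.norm_z (t + 1)) hMpos).trans ?_
    rw [add_sub_cancel_left]
    calc 2 * ‖ζ (u t)‖ / (B * b ^ d) ≤ 2 * K / (B / 2 ^ d) := by gcongr
      _ = _ := by rw [pow_succ]; field_simp
  refine ⟨hn1, ?_, hdist⟩
  have h3 : 2 ^ (d + 1) * K / B ≤ 1 / 2 := by
    rw [div_le_iff₀ hB, pow_succ]; linarith
  have h4 := norm_sub_sq_real (u (t + 1)) (z (t + 1))
  rw [hn1, h.norm_z, real_inner_comm] at h4
  nlinarith [norm_nonneg (u (t + 1) - z (t + 1))]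

theorem aligned_of_le (h : SignedDynamics ζ B K K₁ d z u) (hBK : 4 * K * 2 ^ d ≤ B) {m : ℕ}
    (hu : ‖u m‖ = 1) (hb : 1 / 2 ≤ (inner ℝ (z m) (u m) : ℝ)) {t : ℕ} (ht : m ≤ t) :
    ‖u t‖ = 1 ∧ 1 / 2 ≤ (inner ℝ (z t) (u t) : ℝ) := by
  induction t, ht using Nat.le_induction with
  | base => exact ⟨hu, hb⟩
  | succ t _ ih => exact ⟨(h.step_of_aligned hBK ih.1 ih.2).1, (h.step_of_aligned hBK ih.1 ih.2).2.1⟩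

/-- Normalization ignores the positive factor `b^d`, and homogeneity moves it into the argument of
the noise. The signal term no longer depends on `u t`, which is what makes the step a contraction.
-/
theorem succ_of_aligned (h : SignedDynamics ζ B K K₁ d z u) {t : ℕ}
    (hb : 0 < (inner ℝ (z t) (u t) : ℝ)) :
    u (t + 1) = ‖B • z (t + 1) + ζ ((inner ℝ (z t) (u t) : ℝ)⁻¹ • u t)‖⁻¹ •
      (B • z (t + 1) + ζ ((inner ℝ (z t) (u t) : ℝ)⁻¹ • u t)) := by
  have hbd : 0 < (inner ℝ (z t) (u t) : ℝ) ^ d := pow_pos hb d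
  rw [h.succ, ← normalize_smul hbd (B • z (t + 1) + _)]
  have h1 : (inner ℝ (z t) (u t) : ℝ) ^ d •
      (B • z (t + 1) + ζ ((inner ℝ (z t) (u t) : ℝ)⁻¹ • u t)) =
      (B * (inner ℝ (z t) (u t) : ℝ) ^ d) • z (t + 1) + ζ (u t) := by
    rw [h.homogeneous, smul_add, smul_smul, smul_smul, ← mul_pow, mul_inv_cancel₀ hb.ne', one_pow,
      one_smul, mul_comm]
  rw [h1]

/-- The signal terms cancel. The map `u ↦ u / ⟨z,u⟩` has Lipschitz constant `6` here, the noise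
`K₁`, and normalizing a vector of norm at least `B / 2` contributes `4 / B`. -/
theorem contraction (h : SignedDynamics ζ B K K₁ d z u) (hBK : 4 * K * 2 ^ d ≤ B) {t t' : ℕ}
    (hz : z t = z t') (hz' : z (t + 1) = z (t' + 1))
    (hu : ‖u t‖ = 1) (hb : 1 / 2 ≤ (inner ℝ (z t) (u t) : ℝ))
    (hu' : ‖u t'‖ = 1) (hb' : 1 / 2 ≤ (inner ℝ (z t') (u t') : ℝ)) :
    ‖u (t' + 1) - u (t + 1)‖ ≤ 24 * K₁ / B * ‖u t' - u t‖ := by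
  have hB := h.B_pos
  have hK := h.K_pos
  have hK₁ := h.K₁_nonneg
  rw [h.succ_of_aligned (t := t) (by linarith), h.succ_of_aligned (t := t') (by linarith), ← hz, ← hz']
  rw [← hz] at hb'
  set b : ℝ := inner ℝ (z t) (u t) with hbdef
  set b' : ℝ := inner ℝ (z t) (u t') with hbdef'
  have hbpos : 0 < b := by linarith
  have hbpos' : 0 < b' := by linarith
  have hinv : b⁻¹ ≤ 2 := by rw [inv_le_comm₀ hbpos two_pos]; linarith
  have hinv' : b'⁻¹ ≤ 2 := by rw [inv_le_comm₀ hbpos' two_pos]; linarith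
  have hnw : ‖b⁻¹ • u t‖ ≤ 2 := by
    rw [norm_smul, hu, mul_one, norm_of_nonneg (inv_nonneg.2 hbpos.le)]; exact hinv
  have hnw' : ‖b'⁻¹ • u t'‖ ≤ 2 := by
    rw [norm_smul, hu', mul_one, norm_of_nonneg (inv_nonneg.2 hbpos'.le)]; exact hinv'
  have hbb : |b - b'| ≤ ‖u t' - u t‖ := by
    rw [hbdef, hbdef', ← inner_sub_right, norm_sub_rev]
    have := abs_real_inner_le_norm (z t) (u t - u t')
    rwa [h.norm_z, one_mul] at this
  have hww : ‖b'⁻¹ • u t' - b⁻¹ • u t‖ ≤ 6 * ‖u t' - u t‖ := by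
    have e1 : b'⁻¹ • u t' - b⁻¹ • u t = b'⁻¹ • (u t' - u t) + (b'⁻¹ * b⁻¹ * (b - b')) • u t := by
      have : b'⁻¹ * b⁻¹ * (b - b') = b'⁻¹ - b⁻¹ := by field_simp
      rw [this, smul_sub, sub_smul]; abel
    rw [e1]
    refine (norm_add_le _ _).trans ?_
    rw [norm_smul, norm_smul, hu, mul_one, norm_mul, norm_mul,
      norm_of_nonneg (inv_nonneg.2 hbpos.le), norm_of_nonneg (inv_nonneg.2 hbpos'.le), norm_eq_abs]
    calc b'⁻¹ * ‖u t' - u t‖ + b'⁻¹ * b⁻¹ * |b - b'|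
        ≤ 2 * ‖u t' - u t‖ + 2 * 2 * ‖u t' - u t‖ := by gcongr
      _ = _ := by ring
  have hζw : ‖ζ (b⁻¹ • u t)‖ ≤ B / 4 := by
    rw [h.homogeneous, norm_smul, norm_pow, norm_of_nonneg (inv_nonneg.2 hbpos.le)]
    calc b⁻¹ ^ d * ‖ζ (u t)‖ ≤ 2 ^ d * K := by
          gcongr
          exact h.norm_noise _ hu.le
      _ ≤ B / 4 := by linarith
  have hp : B / 2 ≤ ‖B • z (t + 1) + ζ (b⁻¹ • u t)‖ := by
    have h1 := norm_sub_norm_le (B • z (t + 1)) (-ζ (b⁻¹ • u t))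
    rw [sub_neg_eq_add, norm_neg, norm_smul, h.norm_z, mul_one, norm_of_nonneg hB.le] at h1
    linarith
  have hp0 : B • z (t + 1) + ζ (b⁻¹ • u t) ≠ 0 := norm_pos_iff.1 (by linarith)
  refine (norm_normalize_sub_normalize_le hp0).trans ?_
  rw [add_sub_add_left_eq_sub]
  calc 2 * ‖ζ (b'⁻¹ • u t') - ζ (b⁻¹ • u t)‖ / ‖B • z (t + 1) + ζ (b⁻¹ • u t)‖
      ≤ 2 * (K₁ * (6 * ‖u t' - u t‖)) / (B / 2) := by
        gcongr
        exact (h.lipschitz _ _ hnw' hnw).trans (by gcongr)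
    _ = _ := by field_simp; ring

/-- Since the targets have period two, a trajectory and its shift by `2j` obey the same recursion
and are contracted towards each other, starting from a distance of at most `2`. -/
theorem norm_sub_le_of_period (h : SignedDynamics ζ B K K₁ d z u) (hBK : 4 * K * 2 ^ d ≤ B)
    {m : ℕ} (hz : ∀ t, m ≤ t → ∀ j, z (t + 2 * j) = z t)
    (hu : ‖u m‖ = 1) (hb : 1 / 2 ≤ (inner ℝ (z m) (u m) : ℝ)) {t : ℕ} (ht : m ≤ t) (j s : ℕ) :
    ‖u (t + s + 2 * j) - u (t + s)‖ ≤ 2 * (24 * K₁ / B) ^ s := by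
  have hB := h.B_pos
  have hK₁ := h.K₁_nonneg
  induction s with
  | zero =>
    have h1 := (h.aligned_of_le hBK hu hb (t := t + 2 * j) (by omega)).1
    have h2 := (h.aligned_of_le hBK hu hb (t := t) ht).1
    have := norm_sub_le (u (t + 2 * j)) (u t)
    simp only [add_zero, pow_zero, mul_one]
    linarith
  | succ s ih =>
    obtain ⟨h1, h2⟩ := h.aligned_of_le hBK hu hb (t := t + s + 2 * j) (by omega)
    obtain ⟨h3, h4⟩ := h.aligned_of_le hBK hu hb (t := t + s) (by omega)
    have hz1 := hz (t + s) (by omega) j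
    have hz2 := hz (t + s + 1) (by omega) j
    rw [show t + s + 1 + 2 * j = t + s + 2 * j + 1 by ring] at hz2
    have h5 := h.contraction hBK hz1.symm hz2.symm h3 h4 h1 h2
    rw [show t + (s + 1) + 2 * j = t + s + 2 * j + 1 by ring, ← add_assoc]
    refine h5.trans ?_
    calc 24 * K₁ / B * ‖u (t + s + 2 * j) - u (t + s)‖
        ≤ 24 * K₁ / B * (2 * (24 * K₁ / B) ^ s) := by gcongr
      _ = _ := by ring

end SignedDynamics

/-- Signed dynamics whose noise has a regular behaviour along the signal and along the first `N`
iterates, also in a direction `a`. -/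
structure RegularDynamics (ζ : V → V) (B K K₁ L : ℝ) (d N : ℕ) (a : V) (z u : ℕ → V) : Prop
    extends SignedDynamics ζ B K K₁ d z u where
  L_nonneg : 0 ≤ L
  L_le : L ≤ 1
  norm_a : ‖a‖ = 1
  norm_sq : ∀ t, |‖ζ (z t)‖ ^ 2 - 1| ≤ 3 * L
  inner_z : ∀ t t', |inner ℝ (z t') (ζ (z t))| ≤ L
  inner_a : ∀ t, |inner ℝ a (ζ (z t))| ≤ L
  close : ∀ t < N, ‖u t‖ = 1 → ∀ e : V, (e = a ∨ (∃ t', e = z t') ∨ ∃ t', e = ζ (z t')) →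
    |inner ℝ e (ζ (u t) - ((inner ℝ (z t) (u t) : ℝ) ^ d) • ζ (z t))| ≤
      N * (L * ‖e‖ * √(1 - ((inner ℝ (z t) (u t) : ℝ) ^ d) ^ 2))

namespace RegularDynamics

variable {ζ : V → V} {B K K₁ L : ℝ} {d N : ℕ} {a : V} {z u : ℕ → V}

theorem abs_inner_noise_le (h : RegularDynamics ζ B K K₁ L d N a z u) {t : ℕ} (ht : t < N)
    (hu : ‖u t‖ = 1) : |inner ℝ (z (t + 1)) (ζ (u t))| ≤ (N + 1) * L := by
  have hL := h.L_nonneg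
  have h1 := h.close t ht hu (z (t + 1)) (Or.inr (Or.inl ⟨_, rfl⟩))
  set b : ℝ := inner ℝ (z t) (u t) with hbdef
  have hb : |b| ≤ 1 := by
    have := abs_real_inner_le_norm (z t) (u t)
    rwa [h.norm_z, hu, one_mul] at this
  have hs : √(1 - (b ^ d) ^ 2) ≤ 1 := sqrt_le_one.2 (by linarith [sq_nonneg (b ^ d)])
  have h2 : (inner ℝ (z (t + 1)) (ζ (u t)) : ℝ) =
      inner ℝ (z (t + 1)) (ζ (u t) - b ^ d • ζ (z t)) + b ^ d * inner ℝ (z (t + 1)) (ζ (z t)) := by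
    rw [inner_sub_right, inner_smul_right]; ring
  rw [h2]
  refine (abs_add_le _ _).trans ?_
  rw [h.norm_z, mul_one] at h1
  rw [abs_mul, abs_pow]
  calc _ ≤ N * (L * 1) + 1 * L := by
        refine add_le_add (h1.trans (by gcongr)) ?_
        exact mul_le_mul (pow_le_one₀ (abs_nonneg b) hb) (h.inner_z t (t + 1)) (abs_nonneg _)
          zero_le_one
    _ = _ := by ring

/-- As `1 - b = ‖u - z‖² / 2`, alignment up to `D / B` bounds `√(1 - b^{2d})` by `d D / B`: the
fluctuations gain a factor `1/B` over their generic size `L`. -/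
theorem fluctuation (h : RegularDynamics ζ B K K₁ L d N a z u) {D : ℝ} (hd : 1 ≤ d)
    {t : ℕ} (ht : t < N) (hu : ‖u t‖ = 1) (hb : 1 / 2 ≤ (inner ℝ (z t) (u t) : ℝ))
    (hD : ‖u t - z t‖ ≤ D / B) :
    (∀ e : V, (e = a ∨ (∃ t', e = z t') ∨ ∃ t', e = ζ (z t')) →
      |inner ℝ e (ζ (u t) - ((inner ℝ (z t) (u t) : ℝ) ^ d) • ζ (z t))| ≤
        2 * N * d * D * L / B) ∧
    ‖ζ (u t) - ((inner ℝ (z t) (u t) : ℝ) ^ d) • ζ (z t)‖ ≤ (K₁ + d * K) * D / B := by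
  have hB := h.B_pos
  have hK := h.K_pos
  have hK₁ := h.K₁_nonneg
  have hL := h.L_nonneg
  have hd' : (1 : ℝ) ≤ d := by exact_mod_cast hd
  have hDB : 0 ≤ D / B := (norm_nonneg _).trans hD
  have hD0 : 0 ≤ D := by
    rcases div_nonneg_iff.1 hDB with h1 | h1
    · exact h1.1
    · linarith
  have hsq := norm_sub_sq_real (u t) (z t)
  rw [hu, h.norm_z, real_inner_comm] at hsq
  set b : ℝ := inner ℝ (z t) (u t) with hbdef
  have hb1 : b ≤ 1 := by
    nlinarith [sq_nonneg ‖u t - z t‖]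
  have hbd0 : 0 ≤ b ^ d := by positivity
  have hbd1 : b ^ d ≤ 1 := pow_le_one₀ (by linarith) hb1
  have h1b : 1 - b = ‖u t - z t‖ ^ 2 / 2 := by linarith
  have hbern : 1 - b ^ d ≤ d * (1 - b) := by
    have := one_add_mul_le_pow (a := b - 1) (by linarith) d
    rw [add_sub_cancel] at this
    linarith
  constructor
  · intro e he
    have hen : ‖e‖ ≤ 2 := by
      rcases he with rfl | ⟨t', rfl⟩ | ⟨t', rfl⟩
      · rw [h.norm_a]; norm_num
      · rw [h.norm_z]; norm_num
      · have h1 := (abs_le.1 (h.norm_sq t')).2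
        have h2 := h.L_le
        nlinarith [norm_nonneg (ζ (z t'))]
    have hs : √(1 - (b ^ d) ^ 2) ≤ d * (D / B) := by
      refine sqrt_le_iff.2 ⟨by positivity, ?_⟩
      have h3 : ‖u t - z t‖ ^ 2 ≤ (D / B) ^ 2 := by gcongr
      calc 1 - (b ^ d) ^ 2 ≤ 2 * (1 - b ^ d) := by nlinarith [sq_nonneg (1 - b ^ d)]
        _ ≤ 2 * (d * (1 - b)) := by linarith
        _ = d * ‖u t - z t‖ ^ 2 := by rw [h1b]; ring
        _ ≤ d * (D / B) ^ 2 := by gcongr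
        _ ≤ d * d * (D / B) ^ 2 := by
            gcongr
            exact le_mul_of_one_le_left (by positivity) hd'
        _ = _ := by ring
    refine (h.close t ht hu e he).trans ?_
    calc N * (L * ‖e‖ * √(1 - (b ^ d) ^ 2)) ≤ N * (L * 2 * (d * (D / B))) := by gcongr
      _ = _ := by ring
  · have h4 : ζ (u t) - b ^ d • ζ (z t) = (ζ (u t) - ζ (z t)) + (1 - b ^ d) • ζ (z t) := by
      rw [sub_smul, one_smul]; abel
    have h5 : ‖u t - z t‖ ≤ 2 := by nlinarith [norm_nonneg (u t - z t)]
    rw [h4]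
    refine (norm_add_le _ _).trans ?_
    rw [norm_smul, norm_of_nonneg (sub_nonneg.2 hbd1)]
    have h6 : 1 - b ^ d ≤ d * (D / B) := by
      refine hbern.trans ?_
      gcongr
      rw [h1b]
      nlinarith [norm_nonneg (u t - z t)]
    have h7 : ‖ζ (u t) - ζ (z t)‖ ≤ K₁ * (D / B) :=
      (h.lipschitz _ _ (by rw [hu]; norm_num) (by rw [h.norm_z]; norm_num)).trans (by gcongr)
    have h8 := h.norm_noise (z t) (h.norm_z t).le
    calc ‖ζ (u t) - ζ (z t)‖ + (1 - b ^ d) * ‖ζ (z t)‖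
        ≤ K₁ * (D / B) + d * (D / B) * K := by gcongr
      _ = _ := by ring

/-- The constant in the expansions. -/
noncomputable def errorConst (K K₁ D : ℝ) (d N : ℕ) : ℝ :=
  2 ^ d * (2 * N * d * D + (K₁ + d * K) * D) + 1

theorem expansions (h : RegularDynamics ζ B K K₁ L d N a z u) {D : ℝ} (hd : 1 ≤ d) {t : ℕ}
    (ht : t + 1 < N) (hu : ‖u t‖ = 1) (hb : 1 / 2 ≤ (inner ℝ (z t) (u t) : ℝ))
    (hD : ‖u t - z t‖ ≤ D / B) (hu' : ‖u (t + 1)‖ = 1)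
    (hb' : 1 / 2 ≤ (inner ℝ (z (t + 1)) (u (t + 1)) : ℝ)) (hD' : ‖u (t + 1) - z (t + 1)‖ ≤ D / B)
    {s : ℝ} (hs : s = 1 ∨ s = -1) (hζ : ζ (z (t + 1)) = s • ζ (z t))
    (hBΛ : 16 * errorConst K K₁ D d N ≤ B) :
    |inner ℝ a (u (t + 1)) - ((1 - 1 / (2 * (s * B) ^ 2)) * inner ℝ a (z (t + 1)) +
      (inner ℝ a (ζ (z (t + 1))) - inner ℝ a (z (t + 1)) *
        inner ℝ (z (t + 1)) (ζ (z (t + 1)))) / (s * B))| ≤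
      300 * errorConst K K₁ D d N ^ 2 * (L / B ^ 2 + |inner ℝ a (z (t + 1))| / B ^ 4) ∧
    |s * B * inner ℝ (z (t + 1)) (u (t + 1)) ^ (d + 1) + inner ℝ (u (t + 1)) (ζ (u (t + 1))) -
      (s * B + inner ℝ (ζ (z (t + 1))) (z (t + 1)) - (((d + 1 : ℕ) : ℝ) / 2 - 1) / (s * B))| ≤
      2000 * ((d + 1 : ℕ) : ℝ) ^ 2 * errorConst K K₁ D d N ^ 2 * (L / B + 1 / B ^ 3) := by
  have hB := h.B_pos
  have hK := h.K_pos
  have hK₁ := h.K₁_nonneg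
  have hL := h.L_nonneg
  have hDB : 0 ≤ D / B := (norm_nonneg _).trans hD
  have hD0 : 0 ≤ D := by
    have := mul_nonneg hDB hB.le
    rwa [div_mul_cancel₀ _ hB.ne'] at this
  set Λ := errorConst K K₁ D d N with hΛdef
  set Λ₀ := 2 * N * d * D + (K₁ + d * K) * D with hΛ₀
  have hΛ₀0 : 0 ≤ Λ₀ := by positivity
  have hΛeq : Λ = 2 ^ d * Λ₀ + 1 := rfl
  have h2d : (1 : ℝ) ≤ 2 ^ d := one_le_pow₀ (by norm_num)
  have hΛ₀Λ : Λ₀ ≤ Λ := by nlinarith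
  have hΛ1 : 1 ≤ Λ := by
    have : 0 ≤ 2 ^ d * Λ₀ := by positivity
    linarith
  have hs2 : s * s = 1 := by rcases hs with rfl | rfl <;> norm_num
  have hsabs : |s| = 1 := by rcases hs with rfl | rfl <;> norm_num
  have hs0 : s ≠ 0 := by rcases hs with rfl | rfl <;> norm_num
  obtain ⟨f1, f2⟩ := h.fluctuation hd (by omega) hu hb hD
  obtain ⟨f1', f2'⟩ := h.fluctuation hd ht hu' hb' hD'
  set b : ℝ := inner ℝ (z t) (u t) with hbdef
  have hbpos : 0 < b := by linarith
  set r := ζ (u t) - b ^ d • ζ (z t) with hr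
  set r' := ζ (u (t + 1)) - (inner ℝ (z (t + 1)) (u (t + 1)) : ℝ) ^ d • ζ (z (t + 1)) with hr'
  have g1 : 2 * N * d * D * L / B ≤ Λ₀ * L / B := by
    gcongr
    rw [hΛ₀]
    have : 0 ≤ (K₁ + d * K) * D := by positivity
    linarith
  have g2 : (K₁ + d * K) * D / B ≤ Λ₀ / B := by
    gcongr
    rw [hΛ₀]
    have : 0 ≤ 2 * N * d * D := by positivity
    linarith
  have hinv : |(b ^ d)⁻¹| ≤ 2 ^ d := by
    rw [abs_of_pos (by positivity), ← inv_pow]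
    gcongr
    rw [inv_le_comm₀ hbpos two_pos]; linarith
  have q1 : ∀ e : V, (e = a ∨ (∃ t', e = z t') ∨ ∃ t', e = ζ (z t')) →
      |inner ℝ e ((b ^ d)⁻¹ • r)| ≤ Λ * L / B := by
    intro e he
    rw [inner_smul_right, abs_mul]
    calc |(b ^ d)⁻¹| * |inner ℝ e r| ≤ 2 ^ d * (Λ₀ * L / B) := by
          gcongr
          exact (f1 e he).trans g1
      _ = 2 ^ d * Λ₀ * L / B := by ring
      _ ≤ Λ * L / B := by gcongr; linarith
  have q2 : ‖(b ^ d)⁻¹ • r‖ ≤ Λ / B := by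
    rw [norm_smul, norm_eq_abs]
    calc |(b ^ d)⁻¹| * ‖r‖ ≤ 2 ^ d * (Λ₀ / B) := by
          gcongr
          exact f2.trans g2
      _ = 2 ^ d * Λ₀ / B := by ring
      _ ≤ Λ / B := by gcongr; linarith
  have q1' : ∀ e : V, (e = a ∨ (∃ t', e = z t') ∨ ∃ t', e = ζ (z t')) →
      |inner ℝ e (s • r')| ≤ Λ * L / B := by
    intro e he
    rw [inner_smul_right, abs_mul, hsabs, one_mul]
    exact ((f1' e he).trans g1).trans (by gcongr)
  have q2' : ‖s • r'‖ ≤ Λ / B := by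
    rw [norm_smul, norm_eq_abs, hsabs, one_mul]
    exact (f2'.trans g2).trans (by gcongr)
  -- After rescaling by `b^{-d} ≤ 2^d`, the step is exactly signal plus noise plus remainder. The
  -- noise vector belongs to time `t`; it differs from the one at `t + 1` by the sign `s`, which
  -- turns `B` into `s B` in the result.
  have hS : SignalPlusNoise (z (t + 1)) (ζ (z t)) ((b ^ d)⁻¹ • r) B L Λ :=
    ⟨h.norm_z _, hB, hL, h.L_le, hΛ1, hBΛ, h.inner_z t (t + 1), h.norm_sq t,
      q1 _ (Or.inr (Or.inl ⟨_, rfl⟩)), q1 _ (Or.inr (Or.inr ⟨_, rfl⟩)), q2⟩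
  have hut : u (t + 1) = ‖B • z (t + 1) + (ζ (z t) + (b ^ d)⁻¹ • r)‖⁻¹ •
      (B • z (t + 1) + (ζ (z t) + (b ^ d)⁻¹ • r)) := by
    rw [h.succ_of_aligned hbpos]
    have h1 : ζ (b⁻¹ • u t) = ζ (z t) + (b ^ d)⁻¹ • r := by
      rw [h.homogeneous, hr, smul_sub, smul_smul, inv_mul_cancel₀ (by positivity), one_smul,
        inv_pow]
      abel
    rw [h1]
  constructor
  · have h1 := hS.vector_expansion h.norm_a (h.inner_a t) (q1 a (Or.inl rfl))
    rw [← hut] at h1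
    convert h1 using 3
    rw [hζ, inner_smul_right, inner_smul_right, mul_pow, sq s, hs2, one_mul]
    congr 1
    field_simp
  · have h1 := hS.size_expansion (k := d + 1) (by omega) (ρ' := s • r')
      (q1' _ (Or.inr (Or.inl ⟨_, rfl⟩))) (q1' _ (Or.inr (Or.inr ⟨_, rfl⟩))) q2' hut
    rw [Nat.add_sub_cancel] at h1
    have e1 : ζ (u (t + 1)) =
        s • ((inner ℝ (z (t + 1)) (u (t + 1)) : ℝ) ^ d • ζ (z t) + s • r') := by
      rw [smul_add, smul_smul s s, hs2, one_smul, hr', hζ, smul_comm s]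
      abel
    have e2 : inner ℝ (ζ (z (t + 1))) (z (t + 1)) = s * inner ℝ (z (t + 1)) (ζ (z t)) := by
      rw [hζ, real_inner_smul_left, real_inner_comm]
    rw [e2, e1, inner_smul_right]
    refine le_trans (le_of_eq ?_) h1
    have e3 : ((((d + 1 : ℕ) : ℝ)) / 2 - 1) / (s * B) = s * (((((d + 1 : ℕ) : ℝ)) / 2 - 1) / B) := by
      rcases hs with rfl | rfl
      · rw [one_mul, one_mul]
      · rw [neg_one_mul, neg_one_mul, div_neg]
    rw [e3]
    refine Eq.trans ?_ (one_mul _)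
    refine Eq.trans ?_ (congrArg (· * _) hsabs)
    refine Eq.trans ?_ (abs_mul s _)
    congr 1
    ring

/-- The constant in the expansions at late times. -/
noncomputable def lateConst (K K₁ : ℝ) (d m : ℕ) : ℝ :=
  2000 * ((d + 1 : ℕ) : ℝ) ^ 2 * errorConst K K₁ (2 ^ (d + 1) * K) d (2 * m + 5) ^ 2 +
    (((d + 1 : ℕ) : ℝ) + K + K₁) * (2 * (24 * K₁) ^ (m + 2))

theorem late_expansions {m : ℕ} (h : RegularDynamics ζ B K K₁ L d (2 * m + 5) a z u) (hd : 1 ≤ d)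
    (hm : 1 ≤ m) (hBK : 4 * K * 2 ^ d ≤ B)
    (hBΛ : 16 * errorConst K K₁ (2 ^ (d + 1) * K) d (2 * m + 5) ≤ B) (hB1 : 1 ≤ B)
    (hBm : 1 ≤ L * B ^ m) (hz : ∀ t, m ≤ t → ∀ j, z (t + 2 * j) = z t)
    (hu : ‖u m‖ = 1) (hb : 1 / 2 ≤ (inner ℝ (z m) (u m) : ℝ))
    {s : ℝ} (hs : s = 1 ∨ s = -1) (hζ : ∀ t, m ≤ t → ζ (z (t + 1)) = s • ζ (z t))
    {T : ℕ} (hT : m + 2 ≤ T) :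
    ‖u T - z T‖ ≤ 2 ^ (d + 1) * K / B ∧
    |inner ℝ a (u T) - ((1 - 1 / (2 * (s * B) ^ 2)) * inner ℝ a (z T) +
      (inner ℝ a (ζ (z T)) - inner ℝ a (z T) * inner ℝ (z T) (ζ (z T))) / (s * B))| ≤
      lateConst K K₁ d m * (L / B ^ 2 + |inner ℝ a (z T)| / B ^ 4) ∧
    |s * B * inner ℝ (z T) (u T) ^ (d + 1) + inner ℝ (u T) (ζ (u T)) -
      (s * B + inner ℝ (ζ (z T)) (z T) - (((d + 1 : ℕ) : ℝ) / 2 - 1) / (s * B))| ≤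
      lateConst K K₁ d m * (L / B + 1 / B ^ 3) := by
  have hB := h.B_pos
  have hK := h.K_pos
  have hK₁ := h.K₁_nonneg
  have hL := h.L_nonneg
  have al := fun {t : ℕ} (ht : m ≤ t) => h.aligned_of_le hBK hu hb ht
  have cl : ∀ {t : ℕ}, m + 1 ≤ t → ‖u t - z t‖ ≤ 2 ^ (d + 1) * K / B := by
    intro t ht
    obtain ⟨t, rfl⟩ : ∃ t', t = t' + 1 := ⟨t - 1, by omega⟩
    obtain ⟨h1, h2⟩ := al (t := t) (by omega)
    exact (h.step_of_aligned hBK h1 h2).2.2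
  refine ⟨cl (by omega), ?_⟩
  set Λ := errorConst K K₁ (2 ^ (d + 1) * K) d (2 * m + 5) with hΛ
  set E := 2 * (24 * K₁) ^ (m + 2) with hE
  have hE0 : 0 ≤ E := by positivity
  have hd1 : (1 : ℝ) ≤ ((d + 1 : ℕ) : ℝ) := by exact_mod_cast Nat.le_add_left 1 d
  obtain ⟨T', hT', hT'N, hzT, hδ⟩ : ∃ T', m + 2 ≤ T' ∧ T' < 2 * m + 5 ∧ z T = z T' ∧
      ‖u T - u T'‖ ≤ E * (L / B ^ 2) := by
    by_cases hTN : T < 2 * m + 5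
    · refine ⟨T, hT, hTN, rfl, ?_⟩
      rw [sub_self, norm_zero]
      positivity
    -- The reference time is at most `2m + 3`, has the parity of `T`, and leaves `m + 2` contracting
    -- steps after alignment. Their factor `B^{-(m+2)}` is at most `L / B²` because `L B^m ≥ 1`.
    · obtain ⟨j, hj⟩ : ∃ j, T = m + T % 2 + (m + 2) + 2 * j :=
        ⟨(T - (m + T % 2 + (m + 2))) / 2, by omega⟩
      have h1 := h.norm_sub_le_of_period hBK hz hu hb (t := m + T % 2) (by omega) j (m + 2)
      have h2 := hz (m + T % 2 + (m + 2)) (by omega) j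
      rw [← hj] at h1 h2
      refine ⟨m + T % 2 + (m + 2), by omega, by omega, h2, h1.trans ?_⟩
      rw [div_pow, hE, mul_div_assoc', mul_div_assoc', div_le_div_iff₀ (by positivity)
        (by positivity), pow_add B]
      have h3 : 0 ≤ 2 * (24 * K₁) ^ (m + 2) * B ^ 2 := by positivity
      nlinarith
  obtain ⟨t, rfl⟩ : ∃ t, T' = t + 1 := ⟨T' - 1, by omega⟩
  obtain ⟨a1, a2⟩ := al (t := t) (by omega)
  obtain ⟨a3, a4⟩ := al (t := t + 1) (by omega)
  obtain ⟨e1, e2⟩ := h.expansions hd hT'N a1 a2 (cl (by omega)) a3 a4 (cl (by omega)) hs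
    (hζ t (by omega)) hBΛ
  have a5 := (al (t := T) (by omega)).1
  rw [← hzT] at e1 e2
  set T' := t + 1 with hTt
  have hC : lateConst K K₁ d m = 2000 * ((d + 1 : ℕ) : ℝ) ^ 2 * Λ ^ 2 +
    (((d + 1 : ℕ) : ℝ) + K + K₁) * E := rfl
  have hLB : 0 ≤ L / B ^ 2 := by positivity
  constructor
  · have d1 : |inner ℝ a (u T) - inner ℝ a (u T')| ≤ E * (L / B ^ 2) := by
      rw [← inner_sub_right]
      refine (abs_real_inner_le_norm _ _).trans ?_
      rwa [h.norm_a, one_mul]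
    set Y := (1 - 1 / (2 * (s * B) ^ 2)) * inner ℝ a (z T) +
      (inner ℝ a (ζ (z T)) - inner ℝ a (z T) * inner ℝ (z T) (ζ (z T))) / (s * B)
    calc |inner ℝ a (u T) - Y| ≤ |inner ℝ a (u T) - inner ℝ a (u T')| + |inner ℝ a (u T') - Y| :=
          abs_sub_le _ _ _
      _ ≤ E * (L / B ^ 2) + 300 * Λ ^ 2 * (L / B ^ 2 + |inner ℝ a (z T)| / B ^ 4) :=
          add_le_add d1 e1
      _ ≤ E * (L / B ^ 2 + |inner ℝ a (z T)| / B ^ 4) +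
            300 * Λ ^ 2 * (L / B ^ 2 + |inner ℝ a (z T)| / B ^ 4) := by
          gcongr
          have : 0 ≤ |inner ℝ a (z T)| / B ^ 4 := by positivity
          linarith
      _ = (300 * Λ ^ 2 + E) * (L / B ^ 2 + |inner ℝ a (z T)| / B ^ 4) := by ring
      _ ≤ _ := by
          rw [hC]
          gcongr
          · nlinarith
          · exact le_mul_of_one_le_left hE0 (by linarith)
  · have hxy : |(inner ℝ (z T) (u T) : ℝ) ^ (d + 1) - inner ℝ (z T) (u T') ^ (d + 1)| ≤
        ((d + 1 : ℕ) : ℝ) * (E * (L / B ^ 2)) := by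
      have n1 : ∀ w : V, ‖w‖ = 1 → |(inner ℝ (z T) w : ℝ)| ≤ 1 := fun w hw => by
        have := abs_real_inner_le_norm (z T) w
        rwa [h.norm_z, hw, one_mul] at this
      have n2 : |(inner ℝ (z T) (u T) : ℝ) - inner ℝ (z T) (u T')| ≤ E * (L / B ^ 2) := by
        rw [← inner_sub_right]
        refine (abs_real_inner_le_norm _ _).trans ?_
        rwa [h.norm_z, one_mul]
      refine (abs_pow_sub_pow_le _ _ _).trans ?_
      rw [mul_comm]
      have n3 : max |(inner ℝ (z T) (u T) : ℝ)| |(inner ℝ (z T) (u T') : ℝ)| ^ (d + 1 - 1) ≤ 1 :=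
        pow_le_one₀ (by positivity) (max_le (n1 _ a5) (n1 _ a3))
      calc _ ≤ 1 * (E * (L / B ^ 2) * ((d + 1 : ℕ) : ℝ)) := by gcongr
        _ = _ := by ring
    have hζd : |inner ℝ (u T) (ζ (u T)) - inner ℝ (u T') (ζ (u T'))| ≤
        (K + K₁) * (E * (L / B ^ 2)) := by
      have n1 : (inner ℝ (u T) (ζ (u T)) - inner ℝ (u T') (ζ (u T')) : ℝ) =
          inner ℝ (u T - u T') (ζ (u T)) + inner ℝ (u T') (ζ (u T) - ζ (u T')) := by
        rw [inner_sub_left, inner_sub_right]; ring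
      rw [n1]
      refine (abs_add_le _ _).trans ?_
      have n2 := abs_real_inner_le_norm (u T - u T') (ζ (u T))
      have n3 := abs_real_inner_le_norm (u T') (ζ (u T) - ζ (u T'))
      rw [a3, one_mul] at n3
      have n4 := h.lipschitz (u T) (u T') (by rw [a5]; norm_num) (by rw [a3]; norm_num)
      have n5 := h.norm_noise (u T) a5.le
      calc _ ≤ ‖u T - u T'‖ * K + K₁ * ‖u T - u T'‖ := by
            refine add_le_add (n2.trans ?_) (n3.trans n4)
            gcongr
        _ = (K + K₁) * ‖u T - u T'‖ := by ring
        _ ≤ _ := by gcongr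
    set Y := s * B + inner ℝ (ζ (z T)) (z T) - (((d + 1 : ℕ) : ℝ) / 2 - 1) / (s * B)
    have hsabs : |s| = 1 := by rcases hs with rfl | rfl <;> norm_num
    set δ := E * (L / B ^ 2) with hδdef
    have hδ0 : 0 ≤ δ := by positivity
    have hsB : |s * B| = B := by rw [abs_mul, hsabs, one_mul, abs_of_pos hB]
    have hBδ : B * δ = E * (L / B) := by rw [hδdef]; field_simp
    have d1 : |(s * B * inner ℝ (z T) (u T) ^ (d + 1) + inner ℝ (u T) (ζ (u T))) -
        (s * B * inner ℝ (z T) (u T') ^ (d + 1) + inner ℝ (u T') (ζ (u T')))| ≤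
        (((d + 1 : ℕ) : ℝ) + K + K₁) * E * (L / B) := by
      rw [add_sub_add_comm, ← mul_sub]
      refine (abs_add_le _ _).trans ?_
      rw [abs_mul, hsB]
      calc _ ≤ B * (((d + 1 : ℕ) : ℝ) * δ) + (K + K₁) * δ := by gcongr
        _ ≤ B * (((d + 1 : ℕ) : ℝ) * δ) + B * ((K + K₁) * δ) := by
            have := le_mul_of_one_le_left (b := (K + K₁) * δ) (by positivity) hB1
            linarith
        _ = (((d + 1 : ℕ) : ℝ) + K + K₁) * (B * δ) := by ring
        _ = _ := by rw [hBδ]; ring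
    have hP : L / B ≤ L / B + 1 / B ^ 3 := by
      have : 0 ≤ 1 / B ^ 3 := by positivity
      linarith
    refine (abs_sub_le _ _ _).trans ((add_le_add d1 e2).trans ?_)
    calc _ ≤ (((d + 1 : ℕ) : ℝ) + K + K₁) * E * (L / B + 1 / B ^ 3) +
          2000 * ((d + 1 : ℕ) : ℝ) ^ 2 * Λ ^ 2 * (L / B + 1 / B ^ 3) := by gcongr
      _ = _ := by rw [hC]; ring

end RegularDynamics

end SignedDynamics

/-! ### Sign bookkeeping. -/

section Signs

/-- The sign of the signal component along power iteration, with initial overlap `x`. -/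
noncomputable def iterSign (β x : ℝ) (d : ℕ) : ℕ → ℝ
  | 0 => Real.sign x
  | t + 1 => Real.sign β * iterSign β x d t ^ d

variable {β x : ℝ} {d : ℕ}

theorem sign_eq_or (hβ : β ≠ 0) : Real.sign β = 1 ∨ Real.sign β = -1 := by
  rcases Real.sign_apply_eq_of_ne_zero β hβ with h | h
  exacts [Or.inr h, Or.inl h]

theorem sign_mul_abs_self (x : ℝ) : Real.sign x * |x| = x := by
  rcases lt_trichotomy x 0 with h | rfl | h
  · rw [Real.sign_of_neg h, abs_of_neg h]; ring
  · simp
  · rw [Real.sign_of_pos h, abs_of_pos h, one_mul]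

theorem real_sign_mul_self (hβ : β ≠ 0) : Real.sign β * β = |β| := by
  rcases lt_or_gt_of_ne hβ with h | h
  · rw [Real.sign_of_neg h, abs_of_neg h]; ring
  · rw [Real.sign_of_pos h, abs_of_pos h, one_mul]

theorem iterSign_eq_or (hβ : β ≠ 0) (hx : x ≠ 0) (t : ℕ) :
    iterSign β x d t = 1 ∨ iterSign β x d t = -1 := by
  induction t with
  | zero => exact sign_eq_or hx
  | succ t ih =>
    rw [iterSign]
    rcases sign_eq_or hβ with h | h <;> rcases ih with h' | h' <;>
      rcases neg_one_pow_eq_or ℝ d with h'' | h'' <;> simp [h, h', h'']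

theorem sign_pow_even {s : ℝ} (hs : s = 1 ∨ s = -1) {j : ℕ} (hj : Even j) : s ^ j = 1 := by
  rcases hs with rfl | rfl
  · exact one_pow j
  · exact hj.neg_one_pow

theorem sign_pow_odd {s : ℝ} (hs : s = 1 ∨ s = -1) {j : ℕ} (hj : Odd j) : s ^ j = s := by
  obtain ⟨i, rfl⟩ := hj
  rw [pow_succ, sign_pow_even hs (even_two_mul i), one_mul]

theorem iterSign_succ_of_even (hβ : β ≠ 0) (hx : x ≠ 0) (hd : Even d) (t : ℕ) :
    iterSign β x d (t + 1) = Real.sign β := by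
  rw [iterSign, sign_pow_even (iterSign_eq_or hβ hx t) hd, mul_one]

theorem iterSign_of_odd (hβ : β ≠ 0) (hx : x ≠ 0) (hd : Odd d) (t : ℕ) :
    iterSign β x d t = Real.sign β ^ t * Real.sign x := by
  induction t with
  | zero => rw [iterSign, pow_zero, one_mul]
  | succ t ih => rw [iterSign, sign_pow_odd (iterSign_eq_or hβ hx t) hd, ih]; ring

/-- Time `0` must be excluded: for even `d` the initial sign is forgotten after one step. -/
theorem iterSign_add_two_mul (hβ : β ≠ 0) (hx : x ≠ 0) {t : ℕ} (ht : 1 ≤ t) (j : ℕ) :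
    iterSign β x d (t + 2 * j) = iterSign β x d t := by
  rcases Nat.even_or_odd d with hd | hd
  · obtain ⟨t, rfl⟩ : ∃ t', t = t' + 1 := ⟨t - 1, by omega⟩
    rw [show t + 1 + 2 * j = t + 2 * j + 1 by ring, iterSign_succ_of_even hβ hx hd,
      iterSign_succ_of_even hβ hx hd]
  · rw [iterSign_of_odd hβ hx hd, iterSign_of_odd hβ hx hd, pow_add,
      sign_pow_even (sign_eq_or hβ) (even_two_mul j), mul_one]

theorem iterSign_succ_pow (hβ : β ≠ 0) (hx : x ≠ 0) (t : ℕ) :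
    iterSign β x d (t + 1) ^ d = Real.sign β ^ d * iterSign β x d t ^ d := by
  have h := sign_eq_or hβ
  have h' := iterSign_eq_or (d := d) hβ hx t
  rcases Nat.even_or_odd d with hd | hd
  · rw [sign_pow_even h hd, sign_pow_even h' hd, sign_pow_even (iterSign_eq_or hβ hx _) hd, one_mul]
  · rw [sign_pow_odd h hd, sign_pow_odd (iterSign_eq_or hβ hx _) hd, iterSign]

/-- With `d = k - 1`, the value is the limit of the size estimator: `|β|` for odd `k` and `β` for
even `k`. -/
theorem mul_iterSign_succ_pow (hβ : β ≠ 0) (hx : x ≠ 0) (t : ℕ) :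
    β * iterSign β x d (t + 1) ^ (d + 1) = Real.sign β ^ d * |β| := by
  have h := sign_eq_or hβ
  have h' := iterSign_eq_or (d := d) hβ hx t
  have hβ' : Real.sign β * |β| = β := sign_mul_abs_self β
  rcases Nat.even_or_odd d with hd | hd
  · rw [iterSign_succ_of_even hβ hx hd, sign_pow_odd h hd.add_one, sign_pow_even h hd, one_mul]
    nth_rewrite 1 [← hβ']
    rw [mul_right_comm, ← sq, sign_pow_even h even_two, one_mul]
  · rw [sign_pow_even (iterSign_eq_or hβ hx _) hd.add_one, sign_pow_odd h hd, hβ', mul_one]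

theorem abs_mul_iterSign (hβ : β ≠ 0) (hx : x ≠ 0) (t : ℕ) :
    |β| * iterSign β x d t ^ d * iterSign β x d (t + 1) = β := by
  have h' := iterSign_eq_or (d := d) hβ hx t
  have h2 : iterSign β x d t ^ d * iterSign β x d t ^ d = 1 := by
    rw [← pow_add]; exact sign_pow_even h' ⟨d, rfl⟩
  have hβ' : Real.sign β * |β| = β := sign_mul_abs_self β
  calc _ = (Real.sign β * |β|) * (iterSign β x d t ^ d * iterSign β x d t ^ d) := by
        rw [iterSign]; ring
    _ = β := by rw [h2, hβ', mul_one]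

end Signs

/-! ### From regular noise to expansions of power iteration. -/

section RegularIteration

variable {n k : ℕ}

theorem noiseVec_smul (Z : Tensor n k) (c : ℝ) (w : EuclideanSpace ℝ (Fin n)) :
    noiseVec Z (c • w) = c ^ (k - 1) • noiseVec Z w := by
  rw [noiseVec, tensorPow_smul, tensorAct_smul, noiseVec]

theorem noiseBound_pos (k : ℕ) : 0 < noiseBound k := by
  unfold noiseBound
  positivity

theorem tensorEval_spikedTensor (hk : 0 < k) (β : ℝ) (v : EuclideanSpace ℝ (Fin n))
    (Z : Tensor n k) (w : EuclideanSpace ℝ (Fin n)) :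
    tensorEval (spikedTensor β v Z) w = β * inner ℝ v w ^ k + inner ℝ w (noiseVec Z w) := by
  rw [tensorEval_eq_inner hk, tensorAct_spikedTensor hk, inner_add_right, inner_smul_right,
    real_inner_comm v w, mul_assoc, ← pow_succ, Nat.sub_add_cancel hk, noiseVec]

/-- Replacing `v` by `σ_t v` changes norms and absolute inner products by nothing, and leaves
`⟨v,w⟩^{k-1} Z[v^{⊗(k-1)}]` invariant as the sign enters twice. -/
theorem RegularNoise.regularDynamics {K L β : ℝ} {N : ℕ} {v u a : EuclideanSpace ℝ (Fin n)}
    {Z : Tensor n k} (h : RegularNoise K L N β v u a Z) (hk : 0 < k) (hK : 0 < K) (hL : 0 ≤ L)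
    (hL1 : L ≤ 1) (hβ : β ≠ 0) (hv : ‖v‖ = 1) (hu : ‖u‖ = 1) (ha : ‖a‖ = 1)
    (huv : (inner ℝ u v : ℝ) ≠ 0) :
    RegularDynamics (noiseVec Z) |β| K (K * k * 2 ^ (k - 1)) L (k - 1) N a
      (fun t => iterSign β (inner ℝ u v) (k - 1) t • v) (powerIter (spikedTensor β v Z) u) := by
  set σ := iterSign β (inner ℝ u v) (k - 1) with hσ
  have hσ1 : ∀ t, σ t = 1 ∨ σ t = -1 := iterSign_eq_or hβ huv
  have hσa : ∀ t, |σ t| = 1 := fun t => by rcases hσ1 t with h | h <;> rw [h] <;> norm_num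
  have hσsq : ∀ t, σ t * σ t = 1 := fun t => by rcases hσ1 t with h | h <;> rw [h] <;> norm_num
  have hσp : ∀ t, |σ t ^ (k - 1)| = 1 := fun t => by rw [abs_pow, hσa, one_pow]
  have hζ : ∀ t, noiseVec Z (σ t • v) = σ t ^ (k - 1) • noiseVec Z v := fun t => noiseVec_smul ..
  have hnζ : ∀ t, ‖noiseVec Z (σ t • v)‖ = ‖noiseVec Z v‖ := fun t => by
    rw [hζ, norm_smul, norm_eq_abs, hσp, one_mul]
  have hd : ∀ t w, (inner ℝ (σ t • v) w : ℝ) ^ (k - 1) • noiseVec Z (σ t • v) =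
      (inner ℝ v w : ℝ) ^ (k - 1) • noiseVec Z v := fun t w => by
    rw [hζ, smul_smul, ← mul_pow, real_inner_smul_left, mul_right_comm, hσsq, one_mul]
  have hd2 : ∀ t w, ((inner ℝ (σ t • v) w : ℝ) ^ (k - 1)) ^ 2 =
      ((inner ℝ v w : ℝ) ^ (k - 1)) ^ 2 := fun t w => by
    rw [← pow_mul, ← pow_mul, mul_comm, pow_mul, pow_mul, real_inner_smul_left, mul_pow, sq (σ t),
      hσsq, one_mul]
  refine ⟨⟨abs_pos.2 hβ, hK, by positivity, ?_, hu, ?_, ?_, ?_, ?_⟩, hL, hL1, ha, ?_, ?_, ?_, ?_⟩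
  · intro t
    rw [norm_smul, norm_eq_abs, hσa, hv, one_mul]
  · intro t
    have e : (|β| * (inner ℝ (σ t • v) (powerIter (spikedTensor β v Z) u t) : ℝ) ^ (k - 1)) •
        σ (t + 1) • v = (β * inner ℝ v (powerIter (spikedTensor β v Z) u t) ^ (k - 1)) • v := by
      rw [smul_smul, real_inner_smul_left, mul_pow, ← mul_assoc, mul_right_comm]
      congr 2
      exact abs_mul_iterSign hβ huv t
    rw [e, powerIter, tensorAct_spikedTensor hk]
    rfl
  · exact fun w hw => norm_tensorAct_le hk hK.le h.form hw
  · exact fun w w' hw hw' => norm_tensorAct_sub_le hk hK.le h.form hw hw'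
  · exact fun c w => noiseVec_smul ..
  · intro t
    rw [hnζ]
    exact h.norm_sq
  · intro t t'
    rw [hζ, real_inner_smul_left, inner_smul_right, abs_mul, abs_mul, hσa, hσp, one_mul, one_mul]
    exact h.inner_v
  · intro t
    rw [hζ, inner_smul_right, abs_mul, hσp, one_mul]
    exact h.inner_a
  · intro t ht hut e he
    rw [hd, hd2]
    rcases he with rfl | ⟨t', rfl⟩ | ⟨t', rfl⟩
    · exact h.close_a t ht hut
    · rw [real_inner_smul_left, abs_mul, norm_smul, norm_eq_abs, hσa, one_mul, one_mul]
      exact h.close_v t ht hut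
    · rw [hnζ, hζ, real_inner_smul_left, abs_mul, hσp, one_mul]
      exact h.close_noise t ht hut

/-- The requirements on the dimension and on the signal size under which power iteration is
aligned with the signal after `m` steps. -/
structure StrongSignal (K L β x : ℝ) (k m : ℕ) : Prop where
  L_nonneg : 0 ≤ L
  L_le : L ≤ 1
  one_le : 1 ≤ m
  ne_zero : x ≠ 0
  growth : ∃ G, G ≤ |β| * min (1 / 2) |x| ^ (k - 2) ∧ 4 * K ≤ G ∧
    ((2 * m + 5 : ℕ) + 1) * L ≤ G * min (1 / 2) |x| / 2 ∧
    1 / 2 ≤ min (1 / 2) |x| * (G / (4 * K)) ^ m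
  bound_le : 4 * K * 2 ^ (k - 1) ≤ |β|
  error_le : 16 * RegularDynamics.errorConst K (K * k * 2 ^ (k - 1)) (2 ^ (k - 1 + 1) * K) (k - 1)
    (2 * m + 5) ≤ |β|
  one_le_abs : 1 ≤ |β|
  one_le_mul : 1 ≤ L * |β| ^ m

theorem RegularNoise.late_expansions {K L β : ℝ} {m : ℕ} {v u a : EuclideanSpace ℝ (Fin n)}
    {Z : Tensor n k} (h : RegularNoise K L (2 * m + 5) β v u a Z) (hk : 2 ≤ k) (hK : 0 < K)
    (hv : ‖v‖ = 1) (hu : ‖u‖ = 1) (ha : ‖a‖ = 1) (hS : StrongSignal K L β (inner ℝ u v) k m)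
    {T : ℕ} (hT : m + 2 ≤ T) {b : ℝ} (hb : b = Real.sign β ^ (k - 1) * |β|)
    {w z : EuclideanSpace ℝ (Fin n)} (hw : w = powerIter (spikedTensor β v Z) u T)
    (hz : z = iterSign β (inner ℝ u v) (k - 1) T • v) :
    ‖w - z‖ ≤ 2 ^ (k - 1 + 1) * K / |β| ∧
    |inner ℝ a w - ((1 - 1 / (2 * b ^ 2)) * inner ℝ a z +
      (inner ℝ a (noiseVec Z z) - inner ℝ a z * inner ℝ z (noiseVec Z z)) / b)| ≤
      RegularDynamics.lateConst K (K * k * 2 ^ (k - 1)) (k - 1) m *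
        (L / |β| ^ 2 + |inner ℝ a z| / |β| ^ 4) ∧
    |tensorEval (spikedTensor β v Z) w -
      (b + inner ℝ (noiseVec Z z) z - ((k : ℝ) / 2 - 1) / b)| ≤
      RegularDynamics.lateConst K (K * k * 2 ^ (k - 1)) (k - 1) m *
        (L / |β| + 1 / |β| ^ 3) := by
  have hβ : β ≠ 0 := abs_pos.1 (by linarith [hS.one_le_abs])
  have hx := hS.ne_zero
  have H := h.regularDynamics (by omega) hK hS.L_nonneg hS.L_le hβ hv hu ha hx
  set σ := iterSign β (inner ℝ u v) (k - 1) with hσ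
  have hu0 : powerIter (spikedTensor β v Z) u 0 = u := rfl
  have hal : ‖powerIter (spikedTensor β v Z) u m‖ = 1 ∧
      1 / 2 ≤ (inner ℝ (σ m • v) (powerIter (spikedTensor β v Z) u m) : ℝ) := by
    obtain ⟨G, g1, g2, g3, g4⟩ := hS.growth
    -- The starting target is `sgn⟨u,v⟩ v`, so the initial overlap is `|⟨u,v⟩|`; it is capped at
    -- `1/2` to serve as the lower bound preserved by the growth.
    obtain ⟨r1, r2⟩ := H.growth (α := min (1 / 2) |inner ℝ u v|) (G := G) (m := m) (by omega)
      (lt_min (by norm_num) (abs_pos.2 hx)) (min_le_left _ _) g1 g2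
      (fun t ht hut => (H.abs_inner_noise_le (by omega) hut).trans g3) (by
        rw [hu0, real_inner_smul_left, real_inner_comm u v]
        exact (min_le_right _ _).trans_eq (real_sign_mul_self hx).symm) le_rfl
    exact ⟨r1, by rwa [min_eq_left g4] at r2⟩
  have hs : Real.sign β ^ (k - 1) = 1 ∨ Real.sign β ^ (k - 1) = -1 := by
    rcases sign_eq_or hβ with h | h <;> rw [h]
    · exact Or.inl (one_pow _)
    · exact neg_one_pow_eq_or ℝ _
  have hE := H.late_expansions (by omega) hS.one_le hS.bound_le hS.error_le hS.one_le_abs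
    hS.one_le_mul (fun t ht j => by
      simp only [hσ]
      rw [iterSign_add_two_mul hβ hx (hS.one_le.trans ht)]) hal.1 hal.2 hs
    (fun t _ => by
      rw [noiseVec_smul, noiseVec_smul, smul_smul, hσ, iterSign_succ_pow hβ hx]) hT
  simp only [← hb, ← hz, ← hw] at hE
  rw [show (k - 1 + 1 : ℕ) = k by omega] at hE ⊢
  refine ⟨hE.1, hE.2.1, ?_⟩
  have e : β * inner ℝ v w ^ k = b * inner ℝ z w ^ k := by
    obtain ⟨t, rfl⟩ : ∃ t, T = t + 1 := ⟨T - 1, by omega⟩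
    have h1 := mul_iterSign_succ_pow (d := k - 1) hβ hx t
    rw [show (k - 1 + 1 : ℕ) = k by omega, ← hσ, ← hb] at h1
    rw [hz, real_inner_smul_left, mul_pow, ← h1, mul_assoc, ← mul_assoc (σ (t + 1) ^ k), ← mul_pow,
      show σ (t + 1) * σ (t + 1) = 1 by
        rcases iterSign_eq_or (d := k - 1) hβ hx (t + 1) with h | h <;> rw [hσ, h] <;> norm_num,
      one_pow, one_mul]
  rw [tensorEval_spikedTensor (by omega), e]
  exact hE.2.2

end RegularIteration

/-! ### Choice of the number of steps and of the dimension. -/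

section Thresholds

theorem StrongSignal.of_growth {K L β x c A : ℝ} {n k m : ℕ} (hK : 0 < K)
    (hn : 0 < n) (hc : 0 < c) (hc' : c ≤ 1 / 2) (hL : L = log n / √n) (hL1 : L ≤ 1)
    (hlog : 1 ≤ log n) (hm : 1 ≤ m) (hx : c / √n ≤ |x|) (hx1 : |x| ≤ 1)
    (hA : A ≤ |β * x ^ (k - 2)|) (hAm : √n ≤ A ^ m) (h1 : 1 ≤ A)
    (hA1 : 4 * K * 2 ^ (k - 1) ≤ A)
    (hA2 : 16 * RegularDynamics.errorConst K (K * k * 2 ^ (k - 1)) (2 ^ (k - 1 + 1) * K) (k - 1)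
      (2 * m + 5) ≤ A)
    (hA3 : ((2 * m + 5 : ℕ) + 1) * log n ≤ A / 2 ^ (k - 2) * c / 2)
    (hA4 : √n * (2 ^ (k - 2) * (4 * K)) ^ m ≤ 2 * c * A ^ m) : StrongSignal K L β x k m := by
  have hn' : (1 : ℝ) ≤ n := by exact_mod_cast hn
  have hs : 1 ≤ √(n : ℝ) := one_le_sqrt.2 hn'
  have hspos : 0 < √(n : ℝ) := by linarith
  have hxpos : 0 < |x| := lt_of_lt_of_le (by positivity) hx
  have hAβ : A ≤ |β| := by
    refine hA.trans ?_
    rw [abs_mul, abs_pow]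
    exact mul_le_of_le_one_right (abs_nonneg β) (pow_le_one₀ (abs_nonneg x) hx1)
  have hα : c / √n ≤ min (1 / 2) |x| := le_min ((div_le_self hc.le hs).trans hc') hx
  -- Capping the overlap at `1/2` costs at most a factor `2` in `|x|`, hence `2^{k-2}` in the growth
  -- rate; this is why `G = A / 2^{k-2}`.
  have hαx : |x| / 2 ≤ min (1 / 2) |x| := le_min (by linarith) (by linarith)
  have hApos : 0 < A := by linarith
  refine ⟨?_, hL1, hm, abs_pos.1 hxpos, ⟨A / 2 ^ (k - 2), ?_, ?_, ?_, ?_⟩, hA1.trans hAβ,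
    hA2.trans hAβ, h1.trans hAβ, ?_⟩
  · rw [hL]; positivity
  · calc A / 2 ^ (k - 2) ≤ |β * x ^ (k - 2)| / 2 ^ (k - 2) := by gcongr
      _ = |β| * (|x| / 2) ^ (k - 2) := by rw [abs_mul, abs_pow, div_pow, mul_div_assoc]
      _ ≤ _ := by gcongr
  · rw [le_div_iff₀ (by positivity)]
    refine le_trans ?_ hA1
    gcongr
    · norm_num
    · omega
  · calc ((2 * m + 5 : ℕ) + 1) * L = ((2 * m + 5 : ℕ) + 1) * log n / √n := by
          rw [hL, mul_div_assoc]
      _ ≤ A / 2 ^ (k - 2) * c / 2 / √n := by gcongr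
      _ = A / 2 ^ (k - 2) * (c / √n) / 2 := by ring
      _ ≤ _ := by gcongr
  · calc (1 / 2 : ℝ) ≤ c / √n * (A / 2 ^ (k - 2) / (4 * K)) ^ m := by
          rw [div_div, div_pow, div_mul_div_comm, div_le_div_iff₀ two_pos (by positivity)]
          linarith
      _ ≤ _ := by gcongr
  · have h2 : √n ≤ |β| ^ m := hAm.trans (by gcongr)
    calc (1 : ℝ) ≤ log n / √n * √n := by rw [div_mul_cancel₀ _ hspos.ne']; exact hlog
      _ ≤ L * |β| ^ m := by rw [hL]; gcongr

/-- The number of steps after which power iteration is aligned with the signal. -/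
noncomputable def alignmentTime (ε : ℝ) : ℕ := ⌊1 / (2 * ε)⌋₊ + 1

theorem half_lt_mul_alignmentTime {ε : ℝ} (hε : 0 < ε) : 1 / 2 < ε * alignmentTime ε := by
  have h := Nat.lt_floor_add_one (1 / (2 * ε))
  rw [div_lt_iff₀ (by positivity)] at h
  rw [alignmentTime]
  push_cast
  linarith

/-- Apart from the smallness of `log n / √n`, the requirements ask `n^ε` to beat constants and `log
n`, and `n^{εm}` to beat a multiple of `√n`. The last holds because `ε m > 1/2` strictly, which
absorbs the factors `4K` and `2^{k-2}` lost in each step. -/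
theorem exists_strongSignal {k : ℕ} {ε c₀ : ℝ} (hε : 0 < ε) (hc₀ : 0 < c₀) :
    ∃ n₀ : ℕ, ∀ n, n₀ ≤ n → 0 < n ∧ 1 ≤ log n ∧ 3 * (log n / √n) ≤ 2 ∧
      ∀ β x : ℝ, c₀ / √n ≤ |x| → |x| ≤ 1 → (n : ℝ) ^ ε ≤ |β * x ^ (k - 2)| →
        StrongSignal (noiseBound k) (log n / √n) β x k (alignmentTime ε) := by
  set m := alignmentTime ε with hm
  set K := noiseBound k with hKdef
  have hK : 0 < K := noiseBound_pos k
  set c := min (1 / 2) c₀ with hc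
  have hcpos : 0 < c := lt_min (by norm_num) hc₀
  have hmε : 1 / 2 < ε * m := half_lt_mul_alignmentTime hε
  have hcast : Tendsto (fun n : ℕ => (n : ℝ)) atTop atTop := tendsto_natCast_atTop_atTop
  have e1 : ∀ᶠ n : ℕ in atTop, log n / √n ≤ 1 / 2 := by
    have h := (isLittleO_log_rpow_atTop (r := 1 / 2) (by norm_num)).bound
      (show (0 : ℝ) < 1 / 2 by norm_num)
    filter_upwards [hcast.eventually h, eventually_gt_atTop 0] with n hn hn0
    have hn' : (0 : ℝ) < n := by exact_mod_cast hn0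
    rw [div_le_iff₀ (sqrt_pos.2 hn'), sqrt_eq_rpow]
    refine (le_abs_self _).trans (hn.trans_eq ?_)
    rw [norm_of_nonneg (by positivity)]
  have e2 : ∀ M : ℝ, ∀ᶠ n : ℕ in atTop, M ≤ (n : ℝ) ^ ε := fun M =>
    ((tendsto_rpow_atTop hε).comp hcast).eventually_ge_atTop M
  have e3 : ∀ᶠ n : ℕ in atTop,
      ((2 * m + 5 : ℕ) + 1) * log n ≤ (n : ℝ) ^ ε / 2 ^ (k - 2) * c / 2 := by
    have h := (isLittleO_log_rpow_atTop hε).bound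
      (show (0 : ℝ) < c / 2 ^ (k - 2) / 2 / ((2 * m + 5 : ℕ) + 1) by positivity)
    filter_upwards [hcast.eventually h] with n hn
    rw [norm_of_nonneg (show (0 : ℝ) ≤ (n : ℝ) ^ ε by positivity)] at hn
    calc _ ≤ (((2 * m + 5 : ℕ) : ℝ) + 1) *
          (c / 2 ^ (k - 2) / 2 / ((2 * m + 5 : ℕ) + 1) * (n : ℝ) ^ ε) := by
          gcongr
          exact (le_abs_self _).trans hn
      _ = _ := by field_simp
  have e4 : ∀ᶠ n : ℕ in atTop, √n * (2 ^ (k - 2) * (4 * K)) ^ m ≤ 2 * c * ((n : ℝ) ^ ε) ^ m := by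
    have h := ((tendsto_rpow_atTop (sub_pos.2 hmε)).comp hcast).eventually_ge_atTop
      ((2 ^ (k - 2) * (4 * K)) ^ m / (2 * c))
    filter_upwards [h, eventually_gt_atTop 0] with n hn hn0
    have hn' : (0 : ℝ) < n := by exact_mod_cast hn0
    rw [div_le_iff₀ (by positivity)] at hn
    have h2 : ((n : ℝ) ^ ε) ^ m = √n * (n : ℝ) ^ (ε * m - 1 / 2) := by
      rw [sqrt_eq_rpow, ← rpow_add hn', ← rpow_natCast, ← rpow_mul hn'.le]
      congr 1
      ring
    rw [h2]
    calc _ ≤ √n * ((n : ℝ) ^ (ε * m - 1 / 2) * (2 * c)) := by gcongr; exact hn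
      _ = _ := by ring
  have e5 : ∀ᶠ n : ℕ in atTop, 1 ≤ log n := (tendsto_log_atTop.comp hcast).eventually_ge_atTop 1
  obtain ⟨n₀, h₀⟩ := eventually_atTop.1 ((eventually_gt_atTop 0).and (e1.and (e3.and (e4.and
    (e5.and ((e2 1).and ((e2 (4 * K * 2 ^ (k - 1))).and (e2 (16 * RegularDynamics.errorConst K
      (K * k * 2 ^ (k - 1)) (2 ^ (k - 1 + 1) * K) (k - 1) (2 * m + 5))))))))))
  refine ⟨n₀, fun n hn => ?_⟩
  obtain ⟨f0, f1, f3, f4, f5, f6, f7, f8⟩ := h₀ n hn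
  have hn' : (1 : ℝ) ≤ n := by exact_mod_cast f0
  refine ⟨f0, f5, by linarith, fun β x hx hx1 hβ => ?_⟩
  refine StrongSignal.of_growth hK f0 hcpos (min_le_left _ _) rfl (by linarith) f5
    (Nat.le_add_left 1 _) (le_trans ?_ hx) hx1 hβ ?_ f6 f7 f8 f3 f4
  · gcongr
    exact min_le_right _ _
  · rw [sqrt_eq_rpow, ← rpow_natCast, ← rpow_mul (by linarith)]
    exact rpow_le_rpow_of_exponent_le hn' hmε.le

/-- Since `log |β| / log n ≥ ε`, the threshold is at least `1/(2ε) + 3`: enough for the growth phase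
and two further steps. -/
theorem alignmentTime_add_two_le {n : ℕ} {ε β : ℝ} (hε : 0 < ε) (hlog : 1 ≤ log n) (hn : 0 < n)
    (hβ : (n : ℝ) ^ ε ≤ |β|) {T : ℕ} (hT : iterThreshold n ε β ≤ T) :
    alignmentTime ε + 2 ≤ T := by
  have hn' : (0 : ℝ) < n := by exact_mod_cast hn
  have h1 : ε ≤ log |β| / log n := by
    rw [le_div_iff₀ (by linarith), ← log_rpow hn']
    exact log_le_log (by positivity) hβ
  have h2 : 1 / (2 * ε) + 3 ≤ T := by
    refine le_trans ?_ hT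
    calc 1 / (2 * ε) + 3 = 1 + 1 / ε * (1 / 2 + 2 * ε) := by field_simp; ring
      _ ≤ 1 + 1 / ε * (1 / 2 + 2 * (log |β| / log n)) := by gcongr
      _ = iterThreshold n ε β := by rw [iterThreshold, mul_div_assoc]
  have h3 := Nat.floor_le (show 0 ≤ 1 / (2 * ε) by positivity)
  have h4 : ((alignmentTime ε + 2 : ℕ) : ℝ) ≤ T := by
    rw [alignmentTime]
    push_cast
    linarith
  exact_mod_cast h4

end Thresholds

/-! ### Probabilistic statements for the spiked tensor. -/

section Recovery

variable {n k : ℕ}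

/-- The constant in the error bounds and in the probability bounds. -/
noncomputable def recoveryConst (k : ℕ) (ε : ℝ) : ℝ :=
  RegularDynamics.lateConst (noiseBound k) (noiseBound k * k * 2 ^ (k - 1)) (k - 1)
    (alignmentTime ε) + (k + 1) + 2 ^ (k - 1 + 1) * noiseBound k +
    (8 + 6 * (2 * alignmentTime ε + 5 : ℕ))

theorem lateConst_nonneg (k m : ℕ) :
    0 ≤ RegularDynamics.lateConst (noiseBound k) (noiseBound k * k * 2 ^ (k - 1)) (k - 1) m := by
  have := noiseBound_pos k
  unfold RegularDynamics.lateConst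
  positivity

theorem recoveryConst_pos (k : ℕ) (ε : ℝ) : 0 < recoveryConst k ε := by
  have := lateConst_nonneg k (alignmentTime ε)
  have := noiseBound_pos k
  unfold recoveryConst
  positivity

/-- The setting of power iteration on a spiked tensor with a strong signal. -/
structure SpikedSetting {Ω : Type*} [MeasurableSpace Ω] (P : Measure Ω) (Z : Ω → Tensor n k)
    (ε β : ℝ) (v u : EuclideanSpace ℝ (Fin n)) : Prop where
  two_le : 2 ≤ k
  iid : IsIIDGaussian n P (fun I ω => Z ω I)
  pos : 0 < n
  ε_pos : 0 < ε
  one_le_log : 1 ≤ log n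
  log_le : 3 * (log n / √n) ≤ 2
  norm_v : ‖v‖ = 1
  norm_u : ‖u‖ = 1
  rpow_le : (n : ℝ) ^ ε ≤ |β|
  strong : StrongSignal (noiseBound k) (log n / √n) β (inner ℝ u v) k (alignmentTime ε)

namespace SpikedSetting

variable {Ω : Type*} [MeasurableSpace Ω] {P : Measure Ω} {Z : Ω → Tensor n k}
  {ε β b : ℝ} {v u : EuclideanSpace ℝ (Fin n)}
  {z : ℕ → EuclideanSpace ℝ (Fin n)}

theorem β_ne_zero (h : SpikedSetting P Z ε β v u) : β ≠ 0 :=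
  abs_pos.1 (by linarith [h.strong.one_le_abs])

theorem closeTo (h : SpikedSetting P Z ε β v u) {ω : Ω}
    (hr : RegularNoise (noiseBound k) (log n / √n) (2 * alignmentTime ε + 5) β v u v (Z ω))
    (hb : b = Real.sign β ^ (k - 1) * |β|) {T : ℕ} (hT : iterThreshold n ε β ≤ T)
    {z : EuclideanSpace ℝ (Fin n)} (hz : z = iterSign β (inner ℝ u v) (k - 1) T • v) :
    CloseTo (recoveryConst k ε) β (spikedTensor β v (Z ω)) (powerIter (spikedTensor β v (Z ω)) u T)
      b z := by
  have hT2 := alignmentTime_add_two_le h.ε_pos h.one_le_log h.pos h.rpow_le hT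
  obtain ⟨h1, -, h3⟩ := hr.late_expansions h.two_le (noiseBound_pos k) h.norm_v h.norm_u h.norm_v
    h.strong hT2 hb rfl hz
  have hβ := h.β_ne_zero
  have hk : (2 : ℝ) ≤ k := by exact_mod_cast h.two_le
  have hβ1 := h.strong.one_le_abs
  have hβpos : 0 < |β| := by linarith
  have hL := h.strong.L_nonneg
  have hC := lateConst_nonneg k (alignmentTime ε)
  have hK := noiseBound_pos k
  set K := noiseBound k
  set L := log n / √n
  set C := RegularDynamics.lateConst K (K * k * 2 ^ (k - 1)) (k - 1) (alignmentTime ε) with hCdef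
  have hRC : recoveryConst k ε = C + (k + 1) + 2 ^ (k - 1 + 1) * K +
    (8 + 6 * (2 * alignmentTime ε + 5 : ℕ)) := rfl
  have hKp : 0 ≤ 2 ^ (k - 1 + 1) * K := by positivity
  have hN : (0 : ℝ) ≤ 8 + 6 * (2 * alignmentTime ε + 5 : ℕ) := by positivity
  have hσ := iterSign_eq_or (d := k - 1) hβ h.strong.ne_zero T
  have hbabs : |b| = |β| := by
    rw [hb, abs_mul, abs_pow, abs_abs]
    rcases sign_eq_or hβ with h | h <;> simp [h]
  have hinner : |inner ℝ (noiseVec (Z ω) z) z| ≤ L := by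
    have h4 := hr.inner_v
    rw [real_inner_comm, hz, noiseVec_smul, real_inner_smul_left, inner_smul_right, abs_mul,
      abs_mul, abs_pow]
    rcases hσ with h | h <;> simpa [h] using h4
  constructor
  · set X := tensorEval (spikedTensor β v (Z ω)) (powerIter (spikedTensor β v (Z ω)) u T)
    have e : X - b = (X - (b + inner ℝ (noiseVec (Z ω) z) z - ((k : ℝ) / 2 - 1) / b)) +
        inner ℝ (noiseVec (Z ω) z) z - ((k : ℝ) / 2 - 1) / b := by ring
    rw [e]
    refine (abs_sub _ _).trans ((add_le_add_left (abs_add_le _ _) _).trans ?_)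
    have h5 : |((k : ℝ) / 2 - 1) / b| ≤ k * (1 / |β|) := by
      rw [abs_div, hbabs, abs_of_nonneg (by linarith), mul_one_div]
      gcongr
      linarith
    have h6 : L / |β| ≤ L := div_le_self hL hβ1
    have h7 : 1 / |β| ^ 3 ≤ 1 / |β| := by
      gcongr
      exact le_self_pow₀ hβ1 (by norm_num)
    have h8 : 0 ≤ 1 / |β| := by positivity
    calc _ ≤ C * (L / |β| + 1 / |β| ^ 3) + L + k * (1 / |β|) := by gcongr
      _ ≤ C * (L + 1 / |β|) + (k + 1) * (L + 1 / |β|) := by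
          have : C * (L / |β| + 1 / |β| ^ 3) ≤ C * (L + 1 / |β|) := by gcongr
          have : 0 ≤ k * L := by positivity
          linarith
      _ = (C + (k + 1)) * (L + 1 / |β|) := by ring
      _ ≤ _ := by
          rw [hRC]
          exact mul_le_mul_of_nonneg_right (by linarith) (by positivity)
  · refine h1.trans ?_
    rw [hRC]
    exact div_le_div_of_nonneg_right (by linarith) hβpos.le

variable [IsProbabilityMeasure P]

theorem holdsWHP (h : SpikedSetting P Z ε β v u) {a : EuclideanSpace ℝ (Fin n)} (ha : ‖a‖ = 1)
    {E : Ω → Prop} (hE : ∀ ω, RegularNoise (noiseBound k) (log n / √n) (2 * alignmentTime ε + 5)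
      β v u a (Z ω) → E ω) : HoldsWHP P (1 / 4) (recoveryConst k ε) n E := by
  have hsub : {ω | ¬ E ω} ⊆ {ω | ¬ RegularNoise (noiseBound k) (log n / √n)
      (2 * alignmentTime ε + 5) β v u a (Z ω)} := fun ω hω hr => hω (hE ω hr)
  refine (measure_mono hsub).trans
    ((h.iid.measure_not_regularNoise_le (by have := h.two_le; omega) h.pos h.log_le β h.norm_v ha u
      (2 * alignmentTime ε + 5)).trans (ENNReal.ofReal_le_ofReal ?_))
  have := lateConst_nonneg k (alignmentTime ε)
  have := noiseBound_pos k
  gcongr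
  unfold recoveryConst
  have : (0 : ℝ) ≤ 2 ^ (k - 1 + 1) * noiseBound k := by positivity
  linarith

/-- The event of regular noise does not involve `T`, so one event serves all times at once. No test
direction is needed, and `v` takes the place of `a`. -/
theorem iterApproaches (h : SpikedSetting P Z ε β v u) (hb : b = Real.sign β ^ (k - 1) * |β|)
    (hz : ∀ t, 1 ≤ t → z t = iterSign β (inner ℝ u v) (k - 1) t • v) :
    IterApproaches P (1 / 4) (recoveryConst k ε) ε β (fun ω => spikedTensor β v (Z ω)) u b z :=
  h.holdsWHP h.norm_v fun _ hr T hT => h.closeTo hr hb hT (hz T (by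
    have := alignmentTime_add_two_le h.ε_pos h.one_le_log h.pos h.rpow_le hT
    omega))

theorem iterExpansions (h : SpikedSetting P Z ε β v u) (hb : b = Real.sign β ^ (k - 1) * |β|)
    (hz : ∀ t, 1 ≤ t → z t = iterSign β (inner ℝ u v) (k - 1) t • v) :
    IterExpansions P (1 / 4) (recoveryConst k ε) ε β (fun ω => spikedTensor β v (Z ω)) Z u b z := by
  intro a ha T hT
  refine h.holdsWHP ha fun ω hr => ?_
  have hT2 := alignmentTime_add_two_le h.ε_pos h.one_le_log h.pos h.rpow_le hT
  obtain ⟨-, h2, h3⟩ := hr.late_expansions h.two_le (noiseBound_pos k) h.norm_v h.norm_u ha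
    h.strong hT2 hb rfl (hz T (by omega))
  have hβ := h.β_ne_zero
  have hbabs : |b| = |β| := by
    rw [hb, abs_mul, abs_pow, abs_abs]
    rcases sign_eq_or hβ with h | h <;> simp [h]
  have hlog : 0 ≤ log n := by linarith [h.one_le_log]
  have hC := lateConst_nonneg k (alignmentTime ε)
  have hK := noiseBound_pos k
  have hle : RegularDynamics.lateConst (noiseBound k) (noiseBound k * k * 2 ^ (k - 1)) (k - 1)
      (alignmentTime ε) ≤ recoveryConst k ε := by
    unfold recoveryConst
    have : (0 : ℝ) ≤ 2 ^ (k - 1 + 1) * noiseBound k := by positivity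
    have : (0 : ℝ) ≤ 8 + 6 * (2 * alignmentTime ε + 5 : ℕ) := by positivity
    have : (0 : ℝ) ≤ k := Nat.cast_nonneg k
    linarith
  have hb2 : b ^ 2 = |β| ^ 2 := by rw [← hbabs, sq_abs]
  have hb4 : b ^ 4 = |β| ^ 4 := by
    rw [show (4 : ℕ) = 2 * 2 from rfl, pow_mul, pow_mul, hb2]
  constructor
  · refine h2.trans ?_
    rw [hb2, hb4]
    refine mul_le_mul hle ?_ (by positivity) (recoveryConst_pos k ε).le
    gcongr
    rw [div_div, mul_comm √(n : ℝ)]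
    -- The bound obtained has no `(log n)^{3/2}` term; it is only added here to match the weaker
    -- form of the claim.
    exact le_add_of_nonneg_right (by positivity)
  · refine h3.trans ?_
    rw [hbabs]
    refine mul_le_mul hle ?_ (by positivity) (recoveryConst_pos k ε).le
    gcongr
    rw [div_div, mul_comm √(n : ℝ)]
    exact le_add_of_nonneg_right (by positivity)

/-- The targets at consecutive times are antipodal, hence at distance `2`, and late iterates are
within `1/2` of them. Consecutive iterates therefore stay at distance at least `1`, which a
convergent sequence excludes. -/
theorem holdsWHP_not_tendsto (h : SpikedSetting P Z ε β v u) (hk : Even k) (hβ : β < 0) :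
    HoldsWHP P (1 / 4) (recoveryConst k ε) n fun ω => ¬ ∃ l : ℝ × EuclideanSpace ℝ (Fin n),
      Tendsto (fun t => (tensorEval (spikedTensor β v (Z ω))
          (powerIter (spikedTensor β v (Z ω)) u t),
        powerIter (spikedTensor β v (Z ω)) u t)) atTop (𝓝 l) := by
  refine h.holdsWHP h.norm_v fun ω hr ⟨l, hl⟩ => ?_
  set w := powerIter (spikedTensor β v (Z ω)) u with hw
  set σ := iterSign β (inner ℝ u v) (k - 1) with hσ
  have hk2 := h.two_le
  have hd : Odd (k - 1) := Nat.Even.sub_odd (by omega) hk odd_one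
  have hl2 : Tendsto w atTop (𝓝 l.2) := (continuous_snd.tendsto l).comp hl
  have hdiff : Tendsto (fun t => ‖w (t + 1) - w t‖) atTop (𝓝 0) := by
    have := ((hl2.comp (tendsto_add_atTop_nat 1)).sub hl2).norm
    simpa using this
  have hβpos : 0 < |β| := abs_pos.2 hβ.ne
  have hclose : ∀ t, alignmentTime ε + 2 ≤ t → ‖w t - σ t • v‖ ≤ 1 / 2 := fun t ht => by
    refine (hr.late_expansions h.two_le (noiseBound_pos k) h.norm_v h.norm_u h.norm_v
      h.strong ht rfl rfl rfl).1.trans ?_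
    rw [div_le_iff₀ hβpos, pow_succ]
    linarith [h.strong.bound_le]
  obtain ⟨t, ht, hlt⟩ := ((eventually_ge_atTop (alignmentTime ε + 2)).and
    (hdiff.eventually_lt_const one_pos)).exists
  have h1 := hclose t ht
  have h2 := hclose (t + 1) (by omega)
  have hs : σ (t + 1) = -σ t := by
    rw [hσ, iterSign, sign_pow_odd (iterSign_eq_or hβ.ne h.strong.ne_zero t) hd,
      Real.sign_of_neg hβ, neg_one_mul]
  have h3 : (2 : ℝ) = ‖σ (t + 1) • v - σ t • v‖ := by
    rw [← sub_smul, hs, norm_smul, h.norm_v, norm_eq_abs]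
    rcases iterSign_eq_or (d := k - 1) hβ.ne h.strong.ne_zero t with h | h <;> rw [hσ, h] <;>
      norm_num
  have h4 : σ (t + 1) • v - σ t • v =
      (w (t + 1) - w t) - (w (t + 1) - σ (t + 1) • v) + (w t - σ t • v) := by abel
  rw [h4] at h3
  have h5 := norm_add_le ((w (t + 1) - w t) - (w (t + 1) - σ (t + 1) • v)) (w t - σ t • v)
  have h6 := norm_sub_le (w (t + 1) - w t) (w (t + 1) - σ (t + 1) • v)
  linarith

end SpikedSetting

end Recovery

/-! ### The four cases of parity and sign. -/

theorem theorem2p1 :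
    ∃ c : ℝ, 0 < c ∧ ∀ (k : ℕ) (ε c₀ : ℝ), 2 ≤ k → 0 < ε → 0 < c₀ →
    ∃ (C : ℝ) (n₀ : ℕ), 0 < C ∧
    ∀ (n : ℕ), n₀ ≤ n →
    ∀ (Ω : Type*) [MeasurableSpace Ω] (P : Measure Ω) [IsProbabilityMeasure P]
      (Z : Ω → Tensor n k), IsIIDGaussian n P (fun I ω => Z ω I) →
    ∀ (β : ℝ) (v u : EuclideanSpace ℝ (Fin n)), ‖v‖ = 1 → ‖u‖ = 1 →
      c₀ / √n ≤ |inner ℝ u v| →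
      (n : ℝ) ^ ε ≤ |β * inner ℝ u v ^ (k - 2)| →
      -- the entries of `ξ = Z[v^{⊗(k-1)}]` are i.i.d. `N(0, 1/n)`
      IsIIDGaussian n P (fun i ω => tensorAct (Z ω) (tensorPow v (k - 1)) i) ∧
      -- `k` odd, `β > 0`: limit `(β, v)`
      (Odd k → 0 < β →
        IterApproaches P c C ε β (fun ω => spikedTensor β v (Z ω)) u β (fun _ => v) ∧
        IterExpansions P c C ε β (fun ω => spikedTensor β v (Z ω)) Z u β (fun _ => v)) ∧
      -- `k` odd, `β < 0`: limit `(-β, -v)`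
      (Odd k → β < 0 →
        IterApproaches P c C ε β (fun ω => spikedTensor β v (Z ω)) u (-β) (fun _ => -v) ∧
        IterExpansions P c C ε β (fun ω => spikedTensor β v (Z ω)) Z u (-β) (fun _ => -v)) ∧
      -- `k` even, `β > 0`: limit `(β, sgn⟨u,v⟩ v)`
      (Even k → 0 < β →
        IterApproaches P c C ε β (fun ω => spikedTensor β v (Z ω)) u β
          (fun _ => Real.sign (inner ℝ u v) • v) ∧
        IterExpansions P c C ε β (fun ω => spikedTensor β v (Z ω)) Z u β
          (fun _ => Real.sign (inner ℝ u v) • v)) ∧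
      -- `k` even, `β < 0`: no convergence, alternation between `(β, ± sgn⟨u,v⟩ v)`
      (Even k → β < 0 →
        IterApproaches P c C ε β (fun ω => spikedTensor β v (Z ω)) u β
          (fun t => ((-1) ^ t * Real.sign (inner ℝ u v)) • v) ∧
        HoldsWHP P c C n (fun ω => ¬ ∃ l : ℝ × EuclideanSpace ℝ (Fin n),
          Tendsto (fun t => (tensorEval (spikedTensor β v (Z ω))
              (powerIter (spikedTensor β v (Z ω)) u t),
            powerIter (spikedTensor β v (Z ω)) u t)) atTop (𝓝 l)) ∧
        IterExpansions P c C ε β (fun ω => spikedTensor β v (Z ω)) Z u β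
          (fun t => ((-1) ^ t * Real.sign (inner ℝ u v)) • v)) := by
  refine ⟨1 / 4, by norm_num, fun k ε c₀ hk hε hc₀ => ?_⟩
  obtain ⟨n₀, hn₀⟩ := exists_strongSignal hε hc₀
  refine ⟨recoveryConst k ε, n₀, recoveryConst_pos k ε, ?_⟩
  intro n hn Ω _ P _ Z hZ β v u hv hu huv hβ
  obtain ⟨hn0, hlog, hL, hS⟩ := hn₀ n hn
  have hx1 : |(inner ℝ u v : ℝ)| ≤ 1 := by
    have := abs_real_inner_le_norm u v
    rwa [hu, hv, one_mul] at this
  have hβ1 : (n : ℝ) ^ ε ≤ |β| := by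
    refine hβ.trans ?_
    rw [abs_mul, abs_pow]
    exact mul_le_of_le_one_right (abs_nonneg β) (pow_le_one₀ (abs_nonneg _) hx1)
  have h : SpikedSetting P Z ε β v u :=
    ⟨hk, hZ, hn0, hε, hlog, hL, hv, hu, hβ1, hS β _ huv hx1 hβ⟩
  have hβ0 := h.β_ne_zero
  have hx0 := h.strong.ne_zero
  have odd_value : Odd k → |β| = Real.sign β ^ (k - 1) * |β| := fun hodd => by
    rw [sign_pow_even (sign_eq_or hβ0) (Nat.Odd.sub_odd hodd odd_one), one_mul]
  have odd_sign : Odd k → ∀ t, 1 ≤ t → iterSign β (inner ℝ u v) (k - 1) t = Real.sign β :=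
    fun hodd t ht => by
      obtain ⟨t, rfl⟩ : ∃ t', t = t' + 1 := ⟨t - 1, by omega⟩
      exact iterSign_succ_of_even hβ0 hx0 (Nat.Odd.sub_odd hodd odd_one) t
  have even_value : Even k → β = Real.sign β ^ (k - 1) * |β| := fun heven => by
    rw [sign_pow_odd (sign_eq_or hβ0) (Nat.Even.sub_odd (by omega) heven odd_one),
      sign_mul_abs_self]
  have even_sign : Even k → ∀ t, iterSign β (inner ℝ u v) (k - 1) t =
      Real.sign β ^ t * Real.sign (inner ℝ u v) := fun heven =>
    iterSign_of_odd hβ0 hx0 (Nat.Even.sub_odd (by omega) heven odd_one)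
  refine ⟨hZ.noise_entries (by omega) hv, fun hodd hpos => ?_, fun hodd hneg => ?_,
    fun heven hpos => ?_, fun heven hneg => ?_⟩
  · have hb := odd_value hodd
    have hz : ∀ t, 1 ≤ t → v = iterSign β (inner ℝ u v) (k - 1) t • v := fun t ht => by
      rw [odd_sign hodd t ht, Real.sign_of_pos hpos, one_smul]
    nth_rewrite 1 [abs_of_pos hpos] at hb
    exact ⟨h.iterApproaches hb hz, h.iterExpansions hb hz⟩
  · have hb := odd_value hodd
    have hz : ∀ t, 1 ≤ t → -v = iterSign β (inner ℝ u v) (k - 1) t • v := fun t ht => by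
      rw [odd_sign hodd t ht, Real.sign_of_neg hneg, neg_one_smul]
    nth_rewrite 1 [abs_of_neg hneg] at hb
    exact ⟨h.iterApproaches hb hz, h.iterExpansions hb hz⟩
  · have hb := even_value heven
    have hz : ∀ t, 1 ≤ t → Real.sign (inner ℝ u v) • v =
        iterSign β (inner ℝ u v) (k - 1) t • v := fun t _ => by
      rw [even_sign heven t, Real.sign_of_pos hpos, one_pow, one_mul]
    exact ⟨h.iterApproaches hb hz, h.iterExpansions hb hz⟩
  · have hb := even_value heven
    have hz : ∀ t, 1 ≤ t → ((-1) ^ t * Real.sign (inner ℝ u v)) • v =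
        iterSign β (inner ℝ u v) (k - 1) t • v := fun t _ => by
      rw [even_sign heven t, Real.sign_of_neg hneg]
    exact ⟨h.iterApproaches hb hz, h.holdsWHP_not_tendsto heven hneg, h.iterExpansions hb hz⟩
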